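/- Setting. For a number $m$ of sensors let $\mathbf a(\varphi)=[1,e^{j\varphi},\dots,e^{j(m-1)\varphi}]^T\in\mathbb C^m$, $\varphi\in[-\pi,\pi]$, be the manifold of the half-wavelength uniform linear array (ULA) in terms of the electrical angle, and $\mathbf d(\varphi)=\mathbf a'(\varphi)$. For a pair $\boldsymbol\phi=[\phi_1\ \phi_2]$ put $\mathbf A=[\mathbf a(\phi_1)\ \mathbf a(\phi_2)]$, $\mathbf B=[\mathbf d(\phi_1)\ \mathbf d(\phi_2)]$, $\mathbf P_{\mathbf A}^\perp=\mathbf I-\mathbf A(\mathbf A^H\mathbf A)^{-1}\mathbf A^H$. Let $T\ge1$ be the number of snapshots and let $\boldsymbol\Xi=[\boldsymbol\xi_1\ \boldsymbol\xi_2]$ range over the matrices $\mathbf U\mathbf U^H$ with $\mathbf U\in\mathbb C^{2\times T}$ having rows of unit norm, i.e. over $\boldsymbol\Xi=\begin{bmatrix}1&\rho\\ \bar\rho&1\end{bmatrix}$ with $|\rho|=1$ if $T=1$ and $|\rho|\le1$ if $T\ge2$; "almost all $\boldsymbol\Xi$" refers to arc length on the circle $|\rho|=1$ if $T=1$, and to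 area on the disk $|\rho|\le1$ if $T\ge2$. With $\odot$ the entrywise product, put $$\mathbf R=\operatorname{Re}[\mathbf B^H\mathbf P_{\mathbf A}^\perp\mathbf B\odot\boldsymbol\Xi^T],\qquad \mathbf D_0=\operatorname{diag}\Big(\mathbf R^{-1}\operatorname{Re}\begin{bmatrix}\mathbf d(\phi_1)^H\mathbf A(\mathbf A^H\mathbf A)^{-1}\boldsymbol\xi_1\\ \mathbf d(\phi_2)^H\mathbf A(\mathbf A^H\mathbf A)^{-1}\boldsymbol\xi_2\end{bmatrix}\Big).$$ The pair $\boldsymbol\phi$ is consistent over $\boldsymbol\Xi$ (for $m$ sensors) if $$\big\|\mathbf a^H(\varphi)\big(\mathbf P_{\mathbf A}^\perp\mathbf B\mathbf D_0-\mathbf A(\mathbf A^H\mathbf A)^{-1}\big)\boldsymbol\Xi^{1/2}\big\|_2\le1\quad\text{for all }\varphi\in[-\pi,\pi].$$ A sequence $\boldsymbol\phi_m$ of pairs is almost asymptotically consistent if for almost all $\boldsymbol\Xi$ there is $M$ such that for every $m>M$ the pair $\boldsymbol\phi_m$ is consistent over $\boldsymbol\Xi$ for $m$ sensors. Limit objects.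 Let $F_a(\delta)=\frac{e^{j\delta}-1}{j\delta}$ (with $F_a(0)=1$), $G_a=F_a'$, $H_a=-G_a'$, $$\mathbf F_a=\begin{bmatrix}1&F_a(\delta)\\F_a(-\delta)&1\end{bmatrix},\quad \mathbf G_a=\begin{bmatrix}\tfrac j2&G_a(\delta)\\G_a(-\delta)&\tfrac j2\end{bmatrix}=[\mathbf g_{a1}\ \mathbf g_{a2}],\quad \mathbf H_a=\begin{bmatrix}\tfrac13&H_a(\delta)\\H_a(-\delta)&\tfrac13\end{bmatrix},$$ $\mathbf f_a(\delta',\delta)=[F_a(\delta')\ \ F_a(\delta+\delta')]$, $\mathbf g_a(\delta',\delta)=[G_a(\delta')\ \ G_a(\delta+\delta')]$, $\mathbf R_a=\operatorname{Re}[(\mathbf H_a-\mathbf G_a^H\mathbf F_a^{-1}\mathbf G_a)\odot\boldsymbol\Xi^T]$ and $\mathbf D_a=\operatorname{diag}(\boldsymbol\beta_a)$ with $$\boldsymbol\beta_a=\mathbf R_a^{-1}\operatorname{Re}\begin{bmatrix}\mathbf g_{a1}^H\mathbf F_a^{-1}\boldsymbol\xi_1\\ \mathbf g_{a2}^H\mathbf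 F_a^{-1}\boldsymbol\xi_2\end{bmatrix}.$$ Proposition. Let $T\ge1$, let $\Delta\phi_m\in[-\pi,\pi]\setminus\{0\}$ and $\boldsymbol\phi_m=[0\ \ \Delta\phi_m]$. (1) Suppose $m\Delta\phi_m\to\delta$ with $\delta\in\mathbb R$, $\delta\neq0$, and consider the condition $$\big\|\big((\mathbf g_a(\delta',\delta)-\mathbf f_a(\delta',\delta)\mathbf F_a^{-1}\mathbf G_a)\mathbf D_a-\mathbf f_a(\delta',\delta)\mathbf F_a^{-1}\big)\boldsymbol\Xi^{1/2}\big\|_2\le1\quad\text{for every }\delta'\in\mathbb R.\tag{$*$}$$ For almost every $\boldsymbol\Xi$: if $(*)$ holds for $\boldsymbol\Xi$, then there is $M$ such that $\boldsymbol\phi_m$ is consistent over $\boldsymbol\Xi$ for all $m>M$. Consequently, if $(*)$ holds for almost all $\boldsymbol\Xi$, then $\boldsymbol\phi_m$ is almost asymptotically consistent. (2) If $m\Delta\phi_m\to+\infty$, then $\boldsymbol\phi_m$ is almost asymptotically consistent. (3) If $m\Delta\phi_m\to0$, then $\boldsymbol\phi_m$ is not almost asymptotically consistent. -/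

import Mathlib

open scoped MatrixOrder

noncomputable section

namespace CLASS

/-! ### Objects attached to a basis manifold `a : ℝ → ℂ^m` and an index vector `θ` -/

section Manifold

variable {m n : ℕ}

/-- The matrix `A(θ) = [a(θ₁) … a(θₙ)]`. -/
def steer (a : ℝ → Fin m → ℂ) (θ : Fin n → ℝ) : Matrix (Fin m) (Fin n) ℂ :=
  Matrix.of fun k i => a (θ i) k

/-- The matrix `B(θ) = [a'(θ₁) … a'(θₙ)]` of derivatives of the manifold. -/
def dsteer (a : ℝ → Fin m → ℂ) (θ : Fin n → ℝ) : Matrix (Fin m) (Fin n) ℂ :=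
  steer (deriv a) θ

/-- `A (Aᴴ A)⁻¹`. -/
def steerDual (a : ℝ → Fin m → ℂ) (θ : Fin n → ℝ) : Matrix (Fin m) (Fin n) ℂ :=
  steer a θ * ((steer a θ).conjTranspose * steer a θ)⁻¹

/-- `P_A^⊥ = I - A (Aᴴ A)⁻¹ Aᴴ`. -/
def projPerp (a : ℝ → Fin m → ℂ) (θ : Fin n → ℝ) : Matrix (Fin m) (Fin m) ℂ :=
  1 - steerDual a θ * (steer a θ).conjTranspose

/-- `R = Re [Bᴴ P_A^⊥ B ⊙ Ξᵀ]`. -/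
def Rmat (a : ℝ → Fin m → ℂ) (θ : Fin n → ℝ) (Ξ : Matrix (Fin n) (Fin n) ℂ) :
    Matrix (Fin n) (Fin n) ℝ :=
  (Matrix.hadamard ((dsteer a θ).conjTranspose * projPerp a θ * dsteer a θ)
    Ξ.transpose).map Complex.re

/-- The vector `R⁻¹ Re [dᵢᴴ A (Aᴴ A)⁻¹ ξᵢ]ᵢ`, where `dᵢ`, `ξᵢ` are the `i`-th columns of `B` and
`Ξ`; it is the normalized first order shift `Γ β` of the estimated indexes. -/
def shift (a : ℝ → Fin m → ℂ) (θ : Fin n → ℝ) (Ξ : Matrix (Fin n) (Fin n) ℂ) : Fin n → ℝ :=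
  Matrix.mulVec (Rmat a θ Ξ)⁻¹
    fun i => (((dsteer a θ).conjTranspose * steerDual a θ * Ξ) i i).re

/-- The diagonal matrix `D₀`. -/
def D0 (a : ℝ → Fin m → ℂ) (θ : Fin n → ℝ) (Ξ : Matrix (Fin n) (Fin n) ℂ) :
    Matrix (Fin n) (Fin n) ℂ :=
  Matrix.diagonal fun i => (shift a θ Ξ i : ℂ)

/-- The index vector `θ` is consistent over `Ξ`, for the manifold `a` on the index set `Θ`:
`‖aᴴ(t) (P_A^⊥ B D₀ - A (Aᴴ A)⁻¹) Ξ^{1/2}‖₂ ≤ 1` for every `t ∈ Θ`. -/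
def ConsistentOver (Θ : Set ℝ) (a : ℝ → Fin m → ℂ) (θ : Fin n → ℝ)
    (Ξ : Matrix (Fin n) (Fin n) ℂ) : Prop :=
  ∀ t ∈ Θ, ‖WithLp.toLp 2 (Matrix.vecMul (star (a t))
    ((projPerp a θ * dsteer a θ * D0 a θ Ξ - steerDual a θ) * CFC.sqrt Ξ))‖ ≤ 1

end Manifold

/-! ### Almost all matrices `Ξ` for two sources -/

/-- The matrix `Ξ = U Uᴴ` for two sources whose normalized amplitude rows (the unit rows of `U`)
have inner product `ρ`. -/
def corr (ρ : ℂ) : Matrix (Fin 2) (Fin 2) ℂ :=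
  !![1, ρ; star ρ, 1]

/-- "For almost all matrices `Ξ`" with `T` snapshots. For `T = 1` the matrices `Ξ = U Uᴴ`, where
`U` is `2 × T` with unit rows, are the `corr ρ` with `|ρ| = 1`, and null sets are those of arc
length on this circle. For `T ≥ 2` they are the `corr ρ` with `|ρ| ≤ 1`, and null sets are those of
area on this disk. -/
def AlmostAll (T : ℕ) (P : Matrix (Fin 2) (Fin 2) ℂ → Prop) : Prop :=
  if T = 1 then
    ∀ᵐ ψ : ℝ, P (corr (Complex.exp (ψ * Complex.I)))
  else
    ∀ᵐ ρ ∂((MeasureTheory.volume : MeasureTheory.Measure ℂ).restrict (Metric.closedBall 0 1)),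
      P (corr ρ)

/-! ### The uniform linear array -/

/-- The half-wavelength ULA manifold as a function of the electrical angle:
`a(φ) = [1, e^{jφ}, …, e^{j(m-1)φ}]ᵀ`. -/
def ula (m : ℕ) (φ : ℝ) : Fin m → ℂ :=
  fun k => Complex.exp (Complex.I * ((k : ℕ) : ℂ) * φ)

/-- The range of the electrical angle `φ = π cos θ`. -/
def electricalAngles : Set ℝ := Set.Icc (-Real.pi) Real.pi

/-- There is `M` such that for every number `m > M` of sensors `φ_m` is consistent over `Ξ`. -/
def EventuallyConsistentOver (φ : ℕ → Fin 2 → ℝ) (Ξ : Matrix (Fin 2) (Fin 2) ℂ) : Prop :=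
  ∃ M : ℕ, ∀ m > M, ConsistentOver electricalAngles (ula m) (φ m) Ξ

/-- The sequence `φ_m` of pairs of electrical angles is almost asymptotically consistent. -/
def AlmostAsymptoticallyConsistent (T : ℕ) (φ : ℕ → Fin 2 → ℝ) : Prop :=
  AlmostAll T (EventuallyConsistentOver φ)

/-! ### The limit functions and the limit test -/

/-- `F_a(δ) = (e^{jδ} - 1) / (jδ)`, extended by continuity at `0`. -/
def Fa (δ : ℝ) : ℂ :=
  if δ = 0 then 1 else (Complex.exp (Complex.I * δ) - 1) / (Complex.I * δ)

/-- `G_a = F_a'`. -/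
def Ga (δ : ℝ) : ℂ := deriv Fa δ

/-- `H_a = -G_a'`. -/
def Ha (δ : ℝ) : ℂ := -deriv Ga δ

/-- The limit matrix `𝐅_a(δ)`. -/
def FaMat (δ : ℝ) : Matrix (Fin 2) (Fin 2) ℂ := !![1, Fa δ; Fa (-δ), 1]

/-- The limit matrix `𝐆_a(δ)`. -/
def GaMat (δ : ℝ) : Matrix (Fin 2) (Fin 2) ℂ :=
  !![Complex.I / 2, Ga δ; Ga (-δ), Complex.I / 2]

/-- The limit matrix `𝐇_a(δ)`. -/
def HaMat (δ : ℝ) : Matrix (Fin 2) (Fin 2) ℂ := !![1 / 3, Ha δ; Ha (-δ), 1 / 3]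

/-- The row vector `𝐟_a(δ', δ) = [F_a(δ'), F_a(δ + δ')]`. -/
def faVec (δ' δ : ℝ) : Fin 2 → ℂ := ![Fa δ', Fa (δ + δ')]

/-- The row vector `𝐠_a(δ', δ) = [G_a(δ'), G_a(δ + δ')]`. -/
def gaVec (δ' δ : ℝ) : Fin 2 → ℂ := ![Ga δ', Ga (δ + δ')]

/-- `R_a = Re [(𝐇_a - 𝐆_aᴴ 𝐅_a⁻¹ 𝐆_a) ⊙ Ξᵀ]`. -/
def RaMat (δ : ℝ) (Ξ : Matrix (Fin 2) (Fin 2) ℂ) : Matrix (Fin 2) (Fin 2) ℝ :=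
  (Matrix.hadamard (HaMat δ - (GaMat δ).conjTranspose * (FaMat δ)⁻¹ * GaMat δ)
    Ξ.transpose).map Complex.re

/-- `β_a = R_a⁻¹ Re [g_{ai}ᴴ 𝐅_a⁻¹ ξᵢ]ᵢ`, where `g_{ai}`, `ξᵢ` are the `i`-th columns of `𝐆_a` and
`Ξ`. -/
def betaA (δ : ℝ) (Ξ : Matrix (Fin 2) (Fin 2) ℂ) : Fin 2 → ℝ :=
  Matrix.mulVec (RaMat δ Ξ)⁻¹
    fun i => (((GaMat δ).conjTranspose * (FaMat δ)⁻¹ * Ξ) i i).re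

/-- The diagonal matrix `D_a` of the elements of `β_a`. -/
def Da (δ : ℝ) (Ξ : Matrix (Fin 2) (Fin 2) ℂ) : Matrix (Fin 2) (Fin 2) ℂ :=
  Matrix.diagonal fun i => (betaA δ Ξ i : ℂ)

/-- The limit test at `δ` over `Ξ`: for every `δ' ∈ ℝ`,
`‖((𝐠_a(δ', δ) - 𝐟_a(δ', δ) 𝐅_a⁻¹ 𝐆_a) D_a - 𝐟_a(δ', δ) 𝐅_a⁻¹) Ξ^{1/2}‖₂ ≤ 1`. -/
def LimitTest (δ : ℝ) (Ξ : Matrix (Fin 2) (Fin 2) ℂ) : Prop :=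
  ∀ δ' : ℝ, ‖WithLp.toLp 2 (Matrix.vecMul
    (Matrix.vecMul (gaVec δ' δ - Matrix.vecMul (faVec δ' δ) ((FaMat δ)⁻¹ * GaMat δ)) (Da δ Ξ)
      - Matrix.vecMul (faVec δ' δ) (FaMat δ)⁻¹)
    (CFC.sqrt Ξ))‖ ≤ 1

end CLASS

end

open Filter Topology Complex
open scoped MatrixOrder ComplexConjugate

noncomputable section

namespace CLASS

/-! ### The test power in terms of a centred kernel -/

/-! Measured from its centre and scaled to aperture one, the array has sensors symmetric about 0.
Hence inner products of steering vectors and of their derivatives are a phase times combinations of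
a real even kernel and its derivatives: `dk m` for the array, the sinc kernel `lk` for the limit
objects. The phases drop out of the test, except through the effective correlation `r = Re (conj w *
ρ)`, where `w` is the relative phase of the sources at the centre. Exchanging the sources is a
symmetry, so the normalized shifts are `t` and `-t`; splitting the tested row into symmetric and
antisymmetric parts turns both tests into `power D δ r x ≤ 1` (`IsGramFamily.norm_sq`,
`ula_test_iff`, `limit_test_iff`). In the regular case the power is one with zero slope at the
sources; the question is whether it exceeds one elsewhere.

Scaled separation tending to `δ ≠ 0`: the kernels `dk m` converge to `lk` locally uniformly with all
derivatives, and `dk m` and `dk m 1` are small far from the multiples of the period. If the limit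
power is below one off the sources and has negative second derivative there, the array passes
eventually (`eventually_of_limit`). The limit test only gives weak inequalities, so equality must be
shown to be exceptional (`exists_countable_strict`). For fixed `x` the excess of the limit power
over one has the sign of a constant times a cubic in `t`, and `t` is an injective Möbius function of
`r` if `lk 1 δ ≠ 0`. At an admissible `t` approached by admissible values from both sides, a
touching point `x` makes `t` a double root, so a discriminant vanishes at `x`. That discriminant is
analytic in `x` and not identically zero, which leaves countably many `x` and finitely many `t` for
each; the one-sidedly isolated `t` are countable anyway. If `lk 1 δ = 0`, the power is affine in `r`
and touching occurs only at the largest or smallest admissible `r`. A countable set of `r` is a null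
set of `ρ`, on the circle and on the disk.

Diverging separation: the interaction of the sources disappears, and the power near one source
approaches the single-source value `lk 0 x ^ 2`; no `ρ` is exceptional (`eventually_separated`).

Vanishing separation: the matrix defining the shift degenerates faster than its right-hand side, and
for `|Re ρ| < 1` the power at a suitable fixed `x` is unbounded (`eventually_coalescing`). A set of
full measure contains such a `ρ`. -/

/-- `D j` is the `j`-th derivative of a real even kernel `D 0` with `D 0 0 = 1`. -/
structure IsKernel (D : ℕ → ℝ → ℝ) : Prop where
  hasDerivAt : ∀ j x, HasDerivAt (D j) (D (j + 1) x) x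
  neg : ∀ j x, D j (-x) = (-1) ^ j * D j x
  one : D 0 0 = 1

section KernelDefs

variable (D : ℕ → ℝ → ℝ) (δ : ℝ)

/-- Diagonal entry of the normalized matrix `Bᴴ P_A^⊥ B`. -/
def kerK : ℝ := -D 2 0 - D 1 δ ^ 2 / (1 - D 0 δ ^ 2)

/-- Off-diagonal entry of the normalized matrix `Bᴴ P_A^⊥ B`. -/
def kerL : ℝ := -D 2 δ - D 0 δ * D 1 δ ^ 2 / (1 - D 0 δ ^ 2)

/-- The normalized shift of the first source; the second one has the opposite shift. -/
def kerT (r : ℝ) : ℝ := D 1 δ / (1 - D 0 δ ^ 2) * (D 0 δ - r) / (kerK D δ - kerL D δ * r)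

/-- `j`-th derivative of the sum of the two entries of `aᴴ A (Aᴴ A)⁻¹`. -/
def evenU (j : ℕ) (x : ℝ) : ℝ := (D j x + D j (x + δ)) / (1 + D 0 δ)

/-- `j`-th derivative of the difference of the two entries of `aᴴ A (Aᴴ A)⁻¹`. -/
def oddU (j : ℕ) (x : ℝ) : ℝ := (D j x - D j (x + δ)) / (1 - D 0 δ)

/-- `j`-th derivative of the difference of the two entries of `aᴴ P_A^⊥ B`. -/
def evenW (j : ℕ) (x : ℝ) : ℝ := D (j + 1) x - D (j + 1) (x + δ) + D 1 δ * evenU D δ j x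

/-- `j`-th derivative of the sum of the two entries of `aᴴ P_A^⊥ B`. -/
def oddW (j : ℕ) (x : ℝ) : ℝ := D (j + 1) x + D (j + 1) (x + δ) - D 1 δ * oddU D δ j x

/-- `j`-th derivative of the symmetric part of the tested row vector. -/
def evenV (t : ℝ) (j : ℕ) (x : ℝ) : ℝ := evenU D δ j x - t * evenW D δ j x

/-- `j`-th derivative of the antisymmetric part of the tested row vector. -/
def oddV (t : ℝ) (j : ℕ) (x : ℝ) : ℝ := oddU D δ j x - t * oddW D δ j x

/-- The squared norm of the tested row vector. -/
def power (r x : ℝ) : ℝ :=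
  (1 + r) / 2 * evenV D δ (kerT D δ r) 0 x ^ 2 + (1 - r) / 2 * oddV D δ (kerT D δ r) 0 x ^ 2

end KernelDefs

/-! ### Reduction of the matrix expressions -/

/-- The row vector `(g - f F⁻¹ G) D - f F⁻¹` built from the Gram matrices `F`, `G`, `H`. -/
def gramRow (F G H : Matrix (Fin 2) (Fin 2) ℂ) (f g : Fin 2 → ℂ)
    (Ξ : Matrix (Fin 2) (Fin 2) ℂ) : Fin 2 → ℂ :=
  Matrix.vecMul (g - Matrix.vecMul f (F⁻¹ * G))
    (Matrix.diagonal fun i => ((Matrix.mulVec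
      ((Matrix.hadamard (H - G.conjTranspose * F⁻¹ * G) Ξ.transpose).map Complex.re)⁻¹
      (fun i => ((G.conjTranspose * F⁻¹ * Ξ) i i).re) i : ℝ) : ℂ)) - Matrix.vecMul f F⁻¹


section GramEvaluation

variable {w e ρ : ℂ} {M lam κ s s1 s2 σ f1 f2 g1 g2 r : ℝ}

/-- The Gram matrix `Aᴴ A` of a pair of steering vectors. -/
def gramF (w : ℂ) (M s : ℝ) : Matrix (Fin 2) (Fin 2) ℂ :=
  !![(M : ℂ), M * (w * s); M * (conj w * s), M]

/-- The matrix `Aᴴ B` of a pair of steering vectors. -/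
def gramG (w : ℂ) (M lam κ s s1 : ℝ) : Matrix (Fin 2) (Fin 2) ℂ :=
  !![M * lam * (I * κ), M * lam * (w * (s1 + I * κ * s));
    M * lam * (conj w * (-s1 + I * κ * s)), M * lam * (I * κ)]

/-- The matrix `Bᴴ B` of a pair of steering vectors. -/
def gramH (w : ℂ) (M lam κ s s1 s2 σ : ℝ) : Matrix (Fin 2) (Fin 2) ℂ :=
  !![M * lam ^ 2 * (σ + κ ^ 2), M * lam ^ 2 * (w * (-s2 - 2 * I * κ * s1 + κ ^ 2 * s));
    M * lam ^ 2 * (conj w * (-s2 + 2 * I * κ * s1 + κ ^ 2 * s)), M * lam ^ 2 * (σ + κ ^ 2)]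

lemma gramF_inv (hw : w * conj w = 1) (hM : M ≠ 0) (hs : 1 - s ^ 2 ≠ 0) :
    (gramF w M s)⁻¹ = !![1 / (M * (1 - s ^ 2) : ℂ), -(w * s) / (M * (1 - s ^ 2));
      -(conj w * s) / (M * (1 - s ^ 2)), 1 / (M * (1 - s ^ 2))] := by
  have hM' : (M : ℂ) ≠ 0 := by exact_mod_cast hM
  have hs' : (1 - (s : ℂ) ^ 2) ≠ 0 := by exact_mod_cast hs
  refine Matrix.inv_eq_right_inv ?_
  ext i j
  fin_cases i <;> fin_cases j <;> simp [gramF, Matrix.mul_apply, Fin.sum_univ_two] <;>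
    field_simp
  · linear_combination (-(s : ℂ) ^ 2) * hw
  · ring
  · ring
  · linear_combination (-(s : ℂ) ^ 2) * hw

lemma gramF_inv_mul_gramG (hw : w * conj w = 1) (hM : M ≠ 0) (hs : 1 - s ^ 2 ≠ 0) :
    (gramF w M s)⁻¹ * gramG w M lam κ s s1 =
      !![lam * (I * κ + s1 * s / (1 - s ^ 2)), lam * (w * (s1 / (1 - s ^ 2)));
        -(lam * (conj w * (s1 / (1 - s ^ 2)))), lam * (I * κ - s1 * s / (1 - s ^ 2))] := by
  have hM' : (M : ℂ) ≠ 0 := by exact_mod_cast hM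
  have hs' : (1 - (s : ℂ) ^ 2) ≠ 0 := by exact_mod_cast hs
  rw [gramF_inv hw hM hs]
  ext i j
  fin_cases i <;> fin_cases j <;> simp [gramG, Matrix.mul_apply, Fin.sum_univ_two] <;>
    field_simp
  · linear_combination (-(lam : ℂ) * s * (-s1 + I * κ * s)) * hw
  · ring
  · ring
  · linear_combination (-(lam : ℂ) * s * (s1 + I * κ * s)) * hw

lemma gramG_conjTranspose_mul_gramF_inv (hw : w * conj w = 1) (hM : M ≠ 0)
    (hs : 1 - s ^ 2 ≠ 0) :
    (gramG w M lam κ s s1).conjTranspose * (gramF w M s)⁻¹ =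
      !![lam * (-(I * κ) + s1 * s / (1 - s ^ 2)), -(lam * (w * (s1 / (1 - s ^ 2))));
        lam * (conj w * (s1 / (1 - s ^ 2))), lam * (-(I * κ) - s1 * s / (1 - s ^ 2))] := by
  have hM' : (M : ℂ) ≠ 0 := by exact_mod_cast hM
  have hs' : (1 - (s : ℂ) ^ 2) ≠ 0 := by exact_mod_cast hs
  rw [gramF_inv hw hM hs]
  ext i j
  fin_cases i <;> fin_cases j <;> simp [gramG, Matrix.mul_apply, Fin.sum_univ_two] <;>
    field_simp
  · linear_combination (-(lam : ℂ) * s * (-s1 - I * κ * s)) * hw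
  · ring
  · ring
  · linear_combination (-(lam : ℂ) * s * (s1 - I * κ * s)) * hw

/-- The centre offset `κ` adds to each derivative vector a multiple of its own steering vector. The
projection kills that part, so `κ` cancels here; what remains is `kerK` on the diagonal and `kerL`
times the relative phase off it. -/
lemma gram_schur (hw : w * conj w = 1) (hM : M ≠ 0) (hs : 1 - s ^ 2 ≠ 0) :
    gramH w M lam κ s s1 s2 σ -
        (gramG w M lam κ s s1).conjTranspose * (gramF w M s)⁻¹ * gramG w M lam κ s s1 =
      !![((M * lam ^ 2 * (σ - s1 ^ 2 / (1 - s ^ 2)) : ℝ) : ℂ),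
        w * ((M * lam ^ 2 * (-s2 - s * s1 ^ 2 / (1 - s ^ 2)) : ℝ) : ℂ);
        conj w * ((M * lam ^ 2 * (-s2 - s * s1 ^ 2 / (1 - s ^ 2)) : ℝ) : ℂ),
        ((M * lam ^ 2 * (σ - s1 ^ 2 / (1 - s ^ 2)) : ℝ) : ℂ)] := by
  have hs' : (1 - (s : ℂ) ^ 2) ≠ 0 := by exact_mod_cast hs
  rw [gramG_conjTranspose_mul_gramF_inv hw hM hs]
  ext i j
  fin_cases i <;> fin_cases j <;> simp [gramG, gramH] <;>
    field_simp
  · linear_combination (M * lam ^ 2 * s1 * (-s1 + I * κ * s) : ℂ) * hw +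
      (M * lam ^ 2 * κ ^ 2 * (1 - s ^ 2) : ℂ) * I_sq
  · linear_combination (M * lam ^ 2 * w * κ ^ 2 * (1 - s ^ 2) * s : ℂ) * I_sq
  · linear_combination (M * lam ^ 2 * conj w * κ ^ 2 * (1 - s ^ 2) * s : ℂ) * I_sq
  · linear_combination (-M * lam ^ 2 * s1 * (s1 + I * κ * s) : ℂ) * hw +
      (M * lam ^ 2 * κ ^ 2 * (1 - s ^ 2) : ℂ) * I_sq

/-- The offset `κ` contributes only imaginary multiples of the unit diagonal of `corr ρ`, which the
real part removes. The opposite signs of the entries are the source-exchange symmetry. -/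
lemma gram_rhs (hw : w * conj w = 1) (hM : M ≠ 0) (hs : 1 - s ^ 2 ≠ 0) :
    (fun i => (((gramG w M lam κ s s1).conjTranspose * (gramF w M s)⁻¹ * corr ρ) i i).re) =
      ![lam * (s1 / (1 - s ^ 2) * (s - (conj w * ρ).re)),
        -(lam * (s1 / (1 - s ^ 2) * (s - (conj w * ρ).re)))] := by
  have key : ((gramG w M lam κ s s1).conjTranspose * (gramF w M s)⁻¹) =
      !![((lam * (s1 / (1 - s ^ 2)) * s : ℝ) : ℂ) - I * ((κ * lam : ℝ) : ℂ),
        -(w * ((lam * (s1 / (1 - s ^ 2)) : ℝ) : ℂ));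
        conj w * ((lam * (s1 / (1 - s ^ 2)) : ℝ) : ℂ),
        -((lam * (s1 / (1 - s ^ 2)) * s : ℝ) : ℂ) - I * ((κ * lam : ℝ) : ℂ)] := by
    rw [gramG_conjTranspose_mul_gramF_inv hw hM hs]
    push_cast
    congr 1
    ext i j
    fin_cases i <;> fin_cases j <;> simp <;> ring
  rw [key]
  ext i
  fin_cases i
  · simp [corr, Matrix.mul_apply, Fin.sum_univ_two, -ofReal_mul, -ofReal_div, -ofReal_sub,
      -ofReal_pow]
    ring
  · simp [corr, Matrix.mul_apply, Fin.sum_univ_two, -ofReal_mul, -ofReal_div, -ofReal_sub,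
      -ofReal_pow]
    ring

lemma gram_re (hw : w * conj w = 1) (hM : M ≠ 0) (hs : 1 - s ^ 2 ≠ 0) :
    (Matrix.hadamard (gramH w M lam κ s s1 s2 σ -
        (gramG w M lam κ s s1).conjTranspose * (gramF w M s)⁻¹ * gramG w M lam κ s s1)
        (corr ρ).transpose).map Complex.re =
      !![M * lam ^ 2 * (σ - s1 ^ 2 / (1 - s ^ 2)),
        M * lam ^ 2 * (-s2 - s * s1 ^ 2 / (1 - s ^ 2)) * (conj w * ρ).re;
        M * lam ^ 2 * (-s2 - s * s1 ^ 2 / (1 - s ^ 2)) * (conj w * ρ).re,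
        M * lam ^ 2 * (σ - s1 ^ 2 / (1 - s ^ 2))] := by
  rw [gram_schur hw hM hs]
  ext i j
  fin_cases i <;> fin_cases j <;>
    simp [corr, Matrix.hadamard, -ofReal_mul, -ofReal_div, -ofReal_sub, -ofReal_pow] <;> ring

/-- The vector `(c, -c)` is an eigenvector with eigenvalue `a - b`; the other factor `a + b` is
needed only for invertibility. -/
lemma inv_mulVec_symm {a b c : ℝ} (h1 : a - b ≠ 0) (h2 : a + b ≠ 0) :
    Matrix.mulVec (!![a, b; b, a])⁻¹ ![c, -c] = ![c / (a - b), -(c / (a - b))] := by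
  have hdet : IsUnit (!![a, b; b, a]).det := by
    rw [Matrix.det_fin_two_of, isUnit_iff_ne_zero]
    have := mul_ne_zero h1 h2
    intro h
    apply this
    linear_combination h
  have : ![c, -c] = Matrix.mulVec !![a, b; b, a] ![c / (a - b), -(c / (a - b))] := by
    ext i
    fin_cases i <;> simp <;> field_simp <;> ring
  rw [this, Matrix.mulVec_mulVec, Matrix.nonsing_inv_mul _ hdet, Matrix.one_mulVec]

/-- The real coefficients of the tested row vector. -/
lemma gramRow_eq (hw : w * conj w = 1) (hM : M ≠ 0) (hl : lam ≠ 0) (hs : 1 - s ^ 2 ≠ 0)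
    (hr : r = (conj w * ρ).re) {k l t : ℝ} (hk : k = σ - s1 ^ 2 / (1 - s ^ 2))
    (hll : l = -s2 - s * s1 ^ 2 / (1 - s ^ 2)) (h1 : k - l * r ≠ 0) (h2 : k + l * r ≠ 0)
    (ht : t = s1 / (1 - s ^ 2) * (s - r) / (k - l * r)) :
    gramRow (gramF w M s) (gramG w M lam κ s s1) (gramH w M lam κ s s1 s2 σ)
        ![M * (e * f1), M * (e * (w * f2))]
        ![M * lam * (e * (g1 + I * κ * f1)), M * lam * (e * (w * (g2 + I * κ * f2)))] (corr ρ) =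
      ![e * ((t * (g1 + s1 * ((f2 - s * f1) / (1 - s ^ 2))) - (f1 - s * f2) / (1 - s ^ 2) : ℝ) : ℂ),
        e * w * ((-t * (g2 - s1 * ((f1 - s * f2) / (1 - s ^ 2))) -
          (f2 - s * f1) / (1 - s ^ 2) : ℝ) : ℂ)] := by
  have hM' : (M : ℂ) ≠ 0 := by exact_mod_cast hM
  have hl' : (lam : ℂ) ≠ 0 := by exact_mod_cast hl
  have hs' : (1 - (s : ℂ) ^ 2) ≠ 0 := by exact_mod_cast hs
  have hML : M * lam ^ 2 ≠ 0 := mul_ne_zero hM (pow_ne_zero 2 hl)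
  unfold gramRow
  rw [gram_rhs hw hM hs, gram_re hw hM hs, gramF_inv_mul_gramG hw hM hs, gramF_inv hw hM hs,
    ← hk, ← hll, ← hr, inv_mulVec_symm
      (by rw [mul_assoc (M * lam ^ 2), ← mul_sub]; exact mul_ne_zero hML h1)
      (by rw [mul_assoc (M * lam ^ 2), ← mul_add]; exact mul_ne_zero hML h2)]
  have hβ : lam * (s1 / (1 - s ^ 2) * (s - r)) / (M * lam ^ 2 * k - M * lam ^ 2 * l * r) =
      t / (M * lam) := by
    rw [ht, mul_assoc (M * lam ^ 2), ← mul_sub]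
    field_simp
  rw [hβ]
  ext i
  rw [Pi.sub_apply, Matrix.vecMul_diagonal]
  fin_cases i
  · simp
    field_simp
    linear_combination (e * f2 * (s1 * t + s)) * hw
  · simp
    field_simp
    ring

end GramEvaluation

open scoped ComplexOrder in
-- Positivity is what makes `CFC.sqrt (corr ρ)` a genuine square root. The cross term is controlled
-- by `2 * ‖x 0‖ * ‖x 1‖ ≤ ‖x 0‖ ^ 2 + ‖x 1‖ ^ 2`.
lemma corr_posSemidef {ρ : ℂ} (hρ : ‖ρ‖ ≤ 1) : 0 ≤ corr ρ := by
  rw [Matrix.nonneg_iff_posSemidef]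
  refine Matrix.PosSemidef.of_dotProduct_mulVec_nonneg ?_ ?_
  · ext i j
    fin_cases i <;> fin_cases j <;> simp [corr]
  · intro x
    have h : star x ⬝ᵥ (corr ρ).mulVec x =
        ((‖x 0‖ ^ 2 + ‖x 1‖ ^ 2 + 2 * (conj (x 0) * ρ * x 1).re : ℝ) : ℂ) := by
      have h1 : conj (x 0) * ρ * x 1 + conj (conj (x 0) * ρ * x 1) =
        ((2 * (conj (x 0) * ρ * x 1).re : ℝ) : ℂ) := Complex.add_conj _
      have h2 : conj (x 0) * x 0 = (‖x 0‖ : ℂ) ^ 2 := Complex.conj_mul' _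
      have h3 : conj (x 1) * x 1 = (‖x 1‖ : ℂ) ^ 2 := Complex.conj_mul' _
      rw [Complex.ofReal_add, ← h1]
      push_cast
      rw [← h2, ← h3]
      simp [corr, dotProduct, Fin.sum_univ_two]
      ring
    rw [h]
    have h4 : |(conj (x 0) * ρ * x 1).re| ≤ ‖x 0‖ * ‖x 1‖ := by
      refine (Complex.abs_re_le_norm _).trans ?_
      rw [norm_mul, norm_mul, RCLike.norm_conj]
      have := mul_le_mul_of_nonneg_left hρ (norm_nonneg (x 0))
      have := mul_le_mul_of_nonneg_right this (norm_nonneg (x 1))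
      linarith
    have h5 := neg_abs_le (conj (x 0) * ρ * x 1).re
    have : 0 ≤ ‖x 0‖ ^ 2 + ‖x 1‖ ^ 2 + 2 * (conj (x 0) * ρ * x 1).re := by
      nlinarith [sq_nonneg (‖x 0‖ - ‖x 1‖)]
    exact_mod_cast this

/-- With `Q` the square root, `‖v Q‖² = v Q Qᴴ vᴴ = v Ξ vᴴ`; only `Q * Q = Ξ` and `Qᴴ = Q` enter, so
the square root is never computed. -/
lemma norm_vecMul_sqrt_corr {ρ : ℂ} (hρ : ‖ρ‖ ≤ 1) (v : Fin 2 → ℂ) :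
    ‖WithLp.toLp 2 (Matrix.vecMul v (CFC.sqrt (corr ρ)))‖ ^ 2 =
      ‖v 0‖ ^ 2 + ‖v 1‖ ^ 2 + 2 * (v 0 * ρ * conj (v 1)).re := by
  set Q := CFC.sqrt (corr ρ) with hQ
  have hQQ : Q * Q = corr ρ := CFC.sqrt_mul_sqrt_self _ (corr_posSemidef hρ)
  have hQs : Q.conjTranspose = Q := by
    have : 0 ≤ Q := CFC.sqrt_nonneg _
    exact (Matrix.nonneg_iff_posSemidef.1 this).1
  have e00 : Q 0 0 * Q 0 0 + Q 0 1 * Q 1 0 = 1 := by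
    have := congrFun (congrFun hQQ 0) 0
    simpa [Matrix.mul_apply, Fin.sum_univ_two, corr] using this
  have e01 : Q 0 0 * Q 0 1 + Q 0 1 * Q 1 1 = ρ := by
    have := congrFun (congrFun hQQ 0) 1
    simpa [Matrix.mul_apply, Fin.sum_univ_two, corr] using this
  have e10 : Q 1 0 * Q 0 0 + Q 1 1 * Q 1 0 = conj ρ := by
    have := congrFun (congrFun hQQ 1) 0
    simpa [Matrix.mul_apply, Fin.sum_univ_two, corr] using this
  have e11 : Q 1 0 * Q 0 1 + Q 1 1 * Q 1 1 = 1 := by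
    have := congrFun (congrFun hQQ 1) 1
    simpa [Matrix.mul_apply, Fin.sum_univ_two, corr] using this
  have c00 : conj (Q 0 0) = Q 0 0 := congrFun (congrFun hQs 0) 0
  have c01 : conj (Q 1 0) = Q 0 1 := congrFun (congrFun hQs 0) 1
  have c10 : conj (Q 0 1) = Q 1 0 := congrFun (congrFun hQs 1) 0
  have c11 : conj (Q 1 1) = Q 1 1 := congrFun (congrFun hQs 1) 1
  rw [EuclideanSpace.norm_sq_eq, Fin.sum_univ_two]
  have hv : ∀ i, Matrix.vecMul v Q i = v 0 * Q 0 i + v 1 * Q 1 i := by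
    intro i
    simp [Matrix.vecMul, dotProduct, Fin.sum_univ_two]
  simp only [hv]
  apply Complex.ofReal_injective
  have h1 : v 0 * ρ * conj (v 1) + conj (v 0 * ρ * conj (v 1)) =
        ((2 * (v 0 * ρ * conj (v 1)).re : ℝ) : ℂ) := Complex.add_conj _
  rw [Complex.ofReal_add, Complex.ofReal_add, Complex.ofReal_add, ← h1]
  push_cast
  rw [← Complex.mul_conj', ← Complex.mul_conj', ← Complex.mul_conj', ← Complex.mul_conj']
  simp only [map_add, map_mul, c00, c01, c10, c11, Complex.conj_conj]
  linear_combination v 0 * conj (v 0) * e00 + v 1 * conj (v 1) * e11 +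
    v 0 * conj (v 1) * e01 + v 1 * conj (v 0) * e10

/-- The squared norm of the tested row vector is `power`. -/
lemma norm_gramRow_sq {D : ℕ → ℝ → ℝ} {w e ρ : ℂ} {M lam κ δ x r : ℝ} (hw : w * conj w = 1)
    (he : e * conj e = 1) (hρ : ‖ρ‖ ≤ 1) (hM : M ≠ 0) (hl : lam ≠ 0)
    (hs : 1 - D 0 δ ^ 2 ≠ 0) (hr : r = (conj w * ρ).re)
    (h1 : kerK D δ - kerL D δ * r ≠ 0) (h2 : kerK D δ + kerL D δ * r ≠ 0) :
    ‖WithLp.toLp 2 (Matrix.vecMul (gramRow (gramF w M (D 0 δ)) (gramG w M lam κ (D 0 δ) (D 1 δ))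
        (gramH w M lam κ (D 0 δ) (D 1 δ) (D 2 δ) (-D 2 0))
        ![M * (e * D 0 x), M * (e * (w * D 0 (x + δ)))]
        ![M * lam * (e * (D 1 x + I * κ * D 0 x)),
          M * lam * (e * (w * (D 1 (x + δ) + I * κ * D 0 (x + δ))))] (corr ρ))
      (CFC.sqrt (corr ρ)))‖ ^ 2 = power D δ r x := by
  rw [norm_vecMul_sqrt_corr hρ,
    gramRow_eq hw hM hl hs hr (k := kerK D δ) (l := kerL D δ) (t := kerT D δ r) rfl rfl h1 h2 rfl]
  have hnw : ‖w‖ = 1 := by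
    rw [Complex.mul_conj'] at hw
    have h : ‖w‖ ^ 2 = 1 := by exact_mod_cast hw
    nlinarith [norm_nonneg w]
  have hne : ‖e‖ = 1 := by
    rw [Complex.mul_conj'] at he
    have h : ‖e‖ ^ 2 = 1 := by exact_mod_cast he
    nlinarith [norm_nonneg e]
  generalize hA : (kerT D δ r * (D 1 x + D 1 δ * ((D 0 (x + δ) - D 0 δ * D 0 x) /
    (1 - D 0 δ ^ 2))) - (D 0 x - D 0 δ * D 0 (x + δ)) / (1 - D 0 δ ^ 2)) = A
  generalize hB : (-kerT D δ r * (D 1 (x + δ) - D 1 δ * ((D 0 x - D 0 δ * D 0 (x + δ)) /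
    (1 - D 0 δ ^ 2))) - (D 0 (x + δ) - D 0 δ * D 0 x) / (1 - D 0 δ ^ 2)) = B
  have h3 : e * (A : ℂ) * ρ * conj (e * w * (B : ℂ)) = ((A * B : ℝ) : ℂ) * (conj w * ρ) := by
    simp only [map_mul, Complex.conj_ofReal]
    push_cast
    linear_combination (A * ρ * conj w * B) * he
  simp only [Matrix.cons_val_zero, Matrix.cons_val_one, h3, Complex.re_ofReal_mul, norm_mul, hnw,
    hne, ← hr, Complex.norm_real, Real.norm_eq_abs]
  have hp : 1 + D 0 δ ≠ 0 := fun h => hs (by linear_combination (1 - D 0 δ) * h)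
  have hm : 1 - D 0 δ ≠ 0 := fun h => hs (by linear_combination (1 + D 0 δ) * h)
  -- With real coefficients `A`, `B` the form is `A² + B² + 2rAB = (1+r)/2 (A+B)² + (1-r)/2 (A-B)²`,
  -- so the sum and difference of coefficients are the natural variables.
  have hE : evenV D δ (kerT D δ r) 0 x = -(A + B) := by
    rw [← hA, ← hB]
    have : 1 - D 0 δ ^ 2 = (1 - D 0 δ) * (1 + D 0 δ) := by ring
    rw [this]
    simp only [evenV, evenU, evenW]
    field_simp
    ring
  have hO : oddV D δ (kerT D δ r) 0 x = -(A - B) := by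
    rw [← hA, ← hB]
    have : 1 - D 0 δ ^ 2 = (1 - D 0 δ) * (1 + D 0 δ) := by ring
    rw [this]
    simp only [oddV, oddU, oddW]
    field_simp
    ring
  rw [power, hE, hO]
  simp only [one_mul, sq_abs]
  ring

/-! ### The centred array kernels and their limit -/

/-- The `j`-th derivative of `z ↦ e^{i u z}`. -/
def wave (j : ℕ) (u : ℝ) (z : ℂ) : ℂ := (I * u) ^ j * exp (I * u * z)

lemma hasDerivAt_wave (j : ℕ) (u : ℝ) (z : ℂ) : HasDerivAt (wave j u) (wave (j + 1) u z) z := by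
  have h : HasDerivAt (fun z : ℂ => exp (I * u * z)) (exp (I * u * z) * (I * u)) z := by
    have := ((hasDerivAt_id z).const_mul (I * (u : ℂ))).cexp
    simpa using this
  refine (h.const_mul ((I * (u : ℂ)) ^ j)).congr_deriv ?_
  simp only [wave]
  ring

lemma conj_wave (j : ℕ) (u x : ℝ) : conj (wave j u x) = wave j (-u) x := by
  simp [wave, ← exp_conj]

lemma wave_neg (j : ℕ) (u x : ℝ) : wave j u ((-x : ℝ) : ℂ) = (-1) ^ j * wave j (-u) x := by
  simp only [wave]
  rw [← mul_assoc, ← mul_pow]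
  congr 2 <;> push_cast <;> ring

lemma norm_wave (j : ℕ) (u x : ℝ) : ‖wave j u x‖ = |u| ^ j := by
  rw [wave, norm_mul, norm_pow, norm_mul, norm_I, one_mul, Complex.norm_real, Real.norm_eq_abs]
  have : I * (u : ℂ) * x = ((u * x : ℝ) : ℂ) * I := by push_cast; ring
  rw [this, norm_exp_ofReal_mul_I, mul_one]

lemma continuous_wave (j : ℕ) : Continuous fun p : ℝ × ℂ => wave j p.1 p.2 := by
  unfold wave
  fun_prop

/-- The position of the `k`-th sensor of `m`, centred and scaled to aperture one. -/
def pos (m k : ℕ) : ℝ := (k + 1 / 2) / m - 1 / 2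

lemma pos_reflect {m k : ℕ} (hk : k < m) : pos m (m - 1 - k) = -pos m k := by
  have hm : (m : ℝ) ≠ 0 := by
    have : 0 < m := by omega
    positivity
  have : ((m - 1 - k : ℕ) : ℝ) = m - 1 - k := by
    rw [Nat.cast_sub (by omega), Nat.cast_sub (by omega)]
    simp
  rw [pos, pos, this]
  field_simp
  ring

lemma abs_pos_le {m k : ℕ} (hk : k < m) : |pos m k| ≤ 1 / 2 := by
  have hm : (0 : ℝ) < m := by
    have : 0 < m := by omega
    positivity
  have hk' : (k : ℝ) + 1 ≤ m := by exact_mod_cast hk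
  have h1 : ((k : ℝ) + 1 / 2) / m ≤ 1 := by
    rw [div_le_one hm]
    linarith
  have h0 : 0 ≤ ((k : ℝ) + 1 / 2) / m := by positivity
  rw [abs_le, pos]
  constructor <;> linarith

/-- Complex form of the centred kernel of `m` sensors. -/
def dkC (m j : ℕ) (z : ℂ) : ℂ := (∑ k ∈ Finset.range m, wave j (pos m k) z) / m

/-- The `j`-th derivative of the centred kernel of `m` sensors. -/
def dk (m j : ℕ) (x : ℝ) : ℝ := (dkC m j x).re

/-- Complex form of the limit kernel. -/
def lkC (j : ℕ) (z : ℂ) : ℂ := ∫ u in (-(1 / 2) : ℝ)..(1 / 2), wave j u z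

/-- The `j`-th derivative of the limit kernel. -/
def lk (j : ℕ) (x : ℝ) : ℝ := (lkC j x).re

/-- The sensor positions are symmetric about 0. This makes the kernel real and gives its derivatives
their parity. -/
lemma sum_wave_neg (m j : ℕ) (z : ℂ) :
    ∑ k ∈ Finset.range m, wave j (-pos m k) z = ∑ k ∈ Finset.range m, wave j (pos m k) z := by
  rw [← Finset.sum_range_reflect (fun k => wave j (pos m k) z)]
  refine Finset.sum_congr rfl fun k hk => ?_
  rw [pos_reflect (Finset.mem_range.1 hk)]

lemma dkC_ofReal (m j : ℕ) (x : ℝ) : dkC m j x = (dk m j x : ℂ) := by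
  refine (Complex.conj_eq_iff_re.1 ?_).symm
  rw [dkC, map_div₀, map_sum, Complex.conj_natCast]
  simp only [conj_wave]
  rw [sum_wave_neg]

lemma lkC_comp_neg (j : ℕ) (z : ℂ) :
    ∫ u in (-(1 / 2) : ℝ)..(1 / 2), wave j (-u) z = lkC j z := by
  rw [intervalIntegral.integral_comp_neg (fun u => wave j u z), neg_neg, lkC]

lemma lkC_ofReal (j : ℕ) (x : ℝ) : lkC j x = (lk j x : ℂ) := by
  refine (Complex.conj_eq_iff_re.1 ?_).symm
  rw [lkC, intervalIntegral.integral_of_le (by norm_num), ← integral_conj]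
  simp only [conj_wave]
  rw [← intervalIntegral.integral_of_le (by norm_num), lkC_comp_neg, lkC,
    intervalIntegral.integral_of_le (by norm_num)]

lemma hasDerivAt_dkC (m j : ℕ) (z : ℂ) : HasDerivAt (dkC m j) (dkC m (j + 1) z) z := by
  unfold dkC
  exact (HasDerivAt.fun_sum fun k _ => hasDerivAt_wave j (pos m k) z).div_const _

lemma hasDerivAt_lkC (j : ℕ) (z : ℂ) : HasDerivAt (lkC j) (lkC (j + 1) z) z := by
  unfold lkC
  have hc : ∀ i z, Continuous fun u : ℝ => wave i u z := fun i z =>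
    (continuous_wave i).comp (continuous_id.prodMk continuous_const)
  refine (intervalIntegral.hasDerivAt_integral_of_dominated_loc_of_deriv_le
    (F := fun z u => wave j u z) (F' := fun z u => wave (j + 1) u z)
    (bound := fun _ => Real.exp (‖z‖ + 1)) (s := Metric.ball z 1)
    (Metric.ball_mem_nhds z one_pos) ?_ ?_ ?_ ?_ ?_ ?_).2
  · exact Eventually.of_forall fun y => (hc j y).aestronglyMeasurable
  · exact (hc j z).intervalIntegrable _ _
  · exact (hc (j + 1) z).aestronglyMeasurable
  · refine Eventually.of_forall fun u hu y hy => ?_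
    have hu' : |u| ≤ 1 := by
      rw [Set.uIoc_of_le (by norm_num)] at hu
      rw [abs_le]
      constructor <;> linarith [hu.1, hu.2]
    have hy' : ‖y‖ ≤ ‖z‖ + 1 := by
      have := norm_le_norm_add_norm_sub' y z
      rw [Metric.mem_ball, dist_eq_norm] at hy
      linarith
    rw [wave, norm_mul, norm_pow, norm_mul, norm_I, one_mul, Complex.norm_real, Real.norm_eq_abs]
    have h1 : |u| ^ (j + 1) ≤ 1 := pow_le_one₀ (abs_nonneg u) hu'
    have h2 : ‖exp (I * u * y)‖ ≤ Real.exp (‖z‖ + 1) := by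
      refine (Complex.norm_exp_le_exp_norm _).trans (Real.exp_le_exp.2 ?_)
      rw [norm_mul, norm_mul, norm_I, one_mul, Complex.norm_real, Real.norm_eq_abs]
      calc |u| * ‖y‖ ≤ 1 * ‖y‖ := mul_le_mul_of_nonneg_right hu' (norm_nonneg y)
        _ ≤ ‖z‖ + 1 := by linarith
    calc |u| ^ (j + 1) * ‖exp (I * u * y)‖ ≤ 1 * Real.exp (‖z‖ + 1) :=
          mul_le_mul h1 h2 (norm_nonneg _) zero_le_one
      _ = Real.exp (‖z‖ + 1) := one_mul _
  · exact intervalIntegrable_const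
  · exact Eventually.of_forall fun u _ y _ => hasDerivAt_wave j u y

lemma dk_neg (m j : ℕ) (x : ℝ) : dk m j (-x) = (-1) ^ j * dk m j x := by
  apply Complex.ofReal_injective
  push_cast
  rw [← dkC_ofReal, ← dkC_ofReal, dkC, dkC, ← mul_div_assoc, Finset.mul_sum]
  simp only [wave_neg]
  rw [← Finset.mul_sum, ← Finset.mul_sum, sum_wave_neg]

lemma lk_neg (j : ℕ) (x : ℝ) : lk j (-x) = (-1) ^ j * lk j x := by
  apply Complex.ofReal_injective
  push_cast
  rw [← lkC_ofReal, ← lkC_ofReal, lkC]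
  simp only [wave_neg]
  rw [intervalIntegral.integral_const_mul, lkC_comp_neg]

lemma isKernel_dk {m : ℕ} (hm : m ≠ 0) : IsKernel (dk m) where
  hasDerivAt j x := (hasDerivAt_dkC m j x).real_of_complex
  neg := dk_neg m
  one := by
    have : (m : ℂ) ≠ 0 := by exact_mod_cast hm
    simp [dk, dkC, wave, this]

lemma isKernel_lk : IsKernel lk where
  hasDerivAt j x := (hasDerivAt_lkC j x).real_of_complex
  neg := lk_neg
  one := by
    simp [lk, lkC, wave]
    norm_num

/-- Differentiability on all of `ℂ` gives analyticity, which is why the kernels are first built with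
a complex argument. -/
lemma analyticAt_lk (j : ℕ) (x : ℝ) : AnalyticAt ℝ (lk j) x := by
  have h : AnalyticAt ℂ (lkC j) (x : ℂ) := by
    have : Differentiable ℂ (lkC j) := fun z => (hasDerivAt_lkC j z).differentiableAt
    exact this.analyticAt _
  exact h.re_ofReal

/-! ### Convergence and decay of the kernels -/

lemma norm_pow_sub_pow_le {a b : ℂ} (ha : ‖a‖ ≤ 1) (hb : ‖b‖ ≤ 1) (j : ℕ) :
    ‖a ^ j - b ^ j‖ ≤ j * ‖a - b‖ := by
  induction j with
  | zero => simp
  | succ j ih =>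
    have h : a ^ (j + 1) - b ^ (j + 1) = a * (a ^ j - b ^ j) + (a - b) * b ^ j := by ring
    have h1 : ‖a * (a ^ j - b ^ j)‖ ≤ j * ‖a - b‖ := by
      rw [norm_mul]
      calc ‖a‖ * ‖a ^ j - b ^ j‖ ≤ 1 * ‖a ^ j - b ^ j‖ :=
            mul_le_mul_of_nonneg_right ha (norm_nonneg _)
        _ ≤ j * ‖a - b‖ := by linarith
    have h2 : ‖(a - b) * b ^ j‖ ≤ ‖a - b‖ := by
      rw [norm_mul, norm_pow]
      exact mul_le_of_le_one_right (norm_nonneg _) (pow_le_one₀ (norm_nonneg _) hb)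
    rw [h]
    refine (norm_add_le _ _).trans ?_
    push_cast
    linarith

lemma norm_I_mul_ofReal (u : ℝ) : ‖I * (u : ℂ)‖ = |u| := by
  rw [norm_mul, norm_I, one_mul, Complex.norm_real, Real.norm_eq_abs]

lemma norm_exp_I_mul_mul (u x : ℝ) : ‖exp (I * u * x)‖ = 1 := by
  simpa [wave] using norm_wave 0 u x

lemma norm_I_mul_pow_sub_le {u v : ℝ} (hu : |u| ≤ 1) (hv : |v| ≤ 1) (j : ℕ) :
    ‖(I * (u : ℂ)) ^ j - (I * (v : ℂ)) ^ j‖ ≤ j * |u - v| := by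
  have h := norm_pow_sub_pow_le (a := I * u) (b := I * v) (by rwa [norm_I_mul_ofReal])
    (by rwa [norm_I_mul_ofReal]) j
  rwa [← mul_sub, ← Complex.ofReal_sub, norm_I_mul_ofReal] at h

lemma norm_wave_sub_le {u v : ℝ} (hu : |u| ≤ 1) (hv : |v| ≤ 1) (j : ℕ) (x : ℝ) :
    ‖wave j u x - wave j v x‖ ≤ (j + |x|) * |u - v| := by
  have h : wave j u x - wave j v x = ((I * (u : ℂ)) ^ j - (I * (v : ℂ)) ^ j) * exp (I * u * x) +
      (I * (v : ℂ)) ^ j * (exp (I * v * x) * (exp (I * ((u - v) * x : ℝ)) - 1)) := by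
    rw [mul_sub, ← Complex.exp_add, wave, wave]
    have : I * (v : ℂ) * x + I * ((u - v) * x : ℝ) = I * u * x := by push_cast; ring
    rw [this]
    ring
  rw [h]
  refine (norm_add_le _ _).trans ?_
  rw [norm_mul, norm_mul, norm_mul, norm_exp_I_mul_mul, norm_exp_I_mul_mul, norm_pow,
    norm_I_mul_ofReal, mul_one, one_mul]
  have h1 := norm_I_mul_pow_sub_le hu hv j
  have h2 : ‖exp (I * ((u - v) * x : ℝ)) - 1‖ ≤ |u - v| * |x| := by
    refine (Real.norm_exp_I_mul_ofReal_sub_one_le).trans ?_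
    rw [Real.norm_eq_abs, abs_mul]
  have h3 : |v| ^ j * ‖exp (I * ((u - v) * x : ℝ)) - 1‖ ≤ 1 * (|u - v| * |x|) :=
    mul_le_mul (pow_le_one₀ (abs_nonneg v) hv) h2 (norm_nonneg _) zero_le_one
  nlinarith

/-- The array kernel is the midpoint Riemann sum of the integral over `[-1/2, 1/2]`. The integrand
is Lipschitz in `u` with constant `j + |x|`, so each of the `m` cells of width `1/m` contributes at
most `(j + |x|) / m²`. -/
lemma norm_lkC_sub_dkC_le {m : ℕ} (hm : 0 < m) (j : ℕ) (x : ℝ) :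
    ‖lkC j x - dkC m j x‖ ≤ (j + |x|) / m := by
  have hm' : (0 : ℝ) < m := by exact_mod_cast hm
  set a : ℕ → ℝ := fun k => (k : ℝ) / m - 1 / 2 with ha
  have hstep : ∀ k, a (k + 1) - a k = 1 / m := by
    intro k
    simp only [ha]
    push_cast
    ring
  have hle : ∀ k, a k ≤ a (k + 1) := fun k => by
    have : 0 ≤ 1 / (m : ℝ) := by positivity
    linarith [hstep k]
  have hc : Continuous fun u : ℝ => wave j u x :=
    (continuous_wave j).comp (continuous_id.prodMk continuous_const)
  have h1 : lkC j x = ∑ k ∈ Finset.range m, ∫ u in a k..a (k + 1), wave j u x := by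
    rw [intervalIntegral.sum_integral_adjacent_intervals fun k _ => hc.intervalIntegrable _ _, lkC]
    congr 1
    · simp [ha]
    · simp only [ha]
      rw [div_self hm'.ne']
      norm_num
  have h2 : dkC m j x = ∑ k ∈ Finset.range m, ∫ u in a k..a (k + 1), wave j (pos m k) x := by
    rw [dkC, Finset.sum_div]
    refine Finset.sum_congr rfl fun k _ => ?_
    rw [intervalIntegral.integral_const, hstep, Complex.real_smul]
    push_cast
    ring
  rw [h1, h2, ← Finset.sum_sub_distrib]
  refine (norm_sum_le _ _).trans ?_
  have h3 : ∀ k ∈ Finset.range m, ‖(∫ u in a k..a (k + 1), wave j u x) -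
      ∫ u in a k..a (k + 1), wave j (pos m k) x‖ ≤ (j + |x|) * (1 / m) * (1 / m) := by
    intro k hk
    have hkm : (k : ℝ) + 1 ≤ m := by exact_mod_cast Finset.mem_range.1 hk
    rw [← intervalIntegral.integral_sub (hc.intervalIntegrable _ _) intervalIntegrable_const]
    have := intervalIntegral.norm_integral_le_of_norm_le_const (a := a k) (b := a (k + 1))
      (f := fun u => wave j u x - wave j (pos m k) x) (C := (j + |x|) * (1 / m)) ?_
    · rwa [hstep, abs_of_nonneg (show (0 : ℝ) ≤ 1 / m by positivity)] at this
    · intro u hu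
      rw [Set.uIoc_of_le (hle k)] at hu
      have hak : -(1 / 2) ≤ a k := by
        have : 0 ≤ (k : ℝ) / m := by positivity
        simp only [ha]
        linarith
      have hak' : a (k + 1) ≤ 1 / 2 := by
        have : ((k : ℝ) + 1) / m ≤ 1 := (div_le_one hm').2 hkm
        simp only [ha]
        push_cast
        linarith
      have hp : pos m k = a k + 1 / m / 2 := by
        simp only [pos, ha]
        ring
      have hs := hstep k
      have hmm : 0 ≤ 1 / (m : ℝ) := by positivity
      refine (norm_wave_sub_le ?_ ?_ j x).trans ?_
      · rw [abs_le]
        constructor <;> linarith [hu.1, hu.2]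
      · exact (abs_pos_le (Finset.mem_range.1 hk)).trans (by norm_num)
      · refine mul_le_mul_of_nonneg_left ?_ (by positivity)
        rw [abs_le]
        constructor <;> linarith [hu.1, hu.2]
  refine (Finset.sum_le_sum h3).trans ?_
  rw [Finset.sum_const, Finset.card_range, nsmul_eq_mul]
  apply le_of_eq
  field_simp

lemma continuous_lk (j : ℕ) : Continuous (lk j) :=
  continuous_iff_continuousAt.2 fun x => (isKernel_lk.hasDerivAt j x).continuousAt

/-- Continuous convergence of the array kernels to the limit kernel. -/
lemma tendsto_dk {α : Type*} {F : Filter α} {n : α → ℕ} {y : α → ℝ} {y₀ : ℝ}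
    (hn : Tendsto n F atTop) (hy : Tendsto y F (𝓝 y₀)) (j : ℕ) :
    Tendsto (fun p => dk (n p) j (y p)) F (𝓝 (lk j y₀)) := by
  have h1 : Tendsto (fun p => lk j (y p)) F (𝓝 (lk j y₀)) := ((continuous_lk j).tendsto y₀).comp hy
  have h2 : Tendsto (fun p => ((j : ℝ) + |y p|) / n p) F (𝓝 0) := by
    have h3 : Tendsto (fun p => (j : ℝ) + |y p|) F (𝓝 (j + |y₀|)) := tendsto_const_nhds.add hy.abs
    exact h3.div_atTop (tendsto_natCast_atTop_atTop.comp hn)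
  have h3 : Tendsto (fun p => lk j (y p) - dk (n p) j (y p)) F (𝓝 0) := by
    refine squeeze_zero_norm' ?_ h2
    filter_upwards [hn.eventually_gt_atTop 0] with p hp
    have := norm_lkC_sub_dkC_le hp j (y p)
    rwa [lkC_ofReal, dkC_ofReal, ← Complex.ofReal_sub, Complex.norm_real] at this
  simpa using h1.sub h3

lemma sum_by_parts (a e : ℕ → ℂ) (z : ℂ) (he : ∀ k, e (k + 1) = z * e k) (n : ℕ) :
    (z - 1) * ∑ k ∈ Finset.range n, a k * e k =
      a n * e n - a 0 * e 0 - ∑ k ∈ Finset.range n, (a (k + 1) - a k) * e (k + 1) := by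
  induction n with
  | zero => simp
  | succ n ih =>
    rw [Finset.sum_range_succ, Finset.sum_range_succ, mul_add, ih, he n]
    ring

/-- Decay of the array kernels away from the multiples of the period. -/
lemma abs_dk_mul_le {m : ℕ} (hm : 0 < m) (j : ℕ) (x : ℝ) :
    |dk m j x| * (m * |Real.sin (x / (2 * m))|) ≤ 1 + j := by
  have hm' : (0 : ℝ) < m := by exact_mod_cast hm
  have hm1 : (1 : ℝ) ≤ m := by exact_mod_cast hm
  have hmC : (m : ℂ) ≠ 0 := by exact_mod_cast hm.ne'
  set z : ℂ := exp (I * ((x / m : ℝ) : ℂ)) with hz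
  have hstep : ∀ k, pos m (k + 1) - pos m k = 1 / m := by
    intro k
    simp only [pos]
    push_cast
    ring
  have he : ∀ k, exp (I * (pos m (k + 1) : ℂ) * x) = z * exp (I * (pos m k : ℂ) * x) := by
    intro k
    rw [hz, ← Complex.exp_add]
    congr 1
    have : pos m (k + 1) = pos m k + 1 / m := by linarith [hstep k]
    rw [this]
    push_cast
    ring
  -- The bound is 1 rather than 1/2 because summation by parts reaches index `m`, one past the last
  -- sensor, where the position is `1/2 + 1/(2m)`.
  have hpos : ∀ k, k ≤ m → |pos m k| ≤ 1 := by
    intro k hk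
    have hk' : (k : ℝ) ≤ m := by exact_mod_cast hk
    have h1 : ((k : ℝ) + 1 / 2) / m ≤ 3 / 2 := by
      rw [div_le_iff₀ hm']
      linarith
    have h0 : 0 ≤ ((k : ℝ) + 1 / 2) / m := by positivity
    rw [abs_le, pos]
    constructor <;> linarith
  -- Abel summation: the exponentials are geometric with ratio `z`, the two boundary terms have norm
  -- at most 1, and the increments of the amplitudes add up to at most `j`.
  have key := sum_by_parts (fun k => (I * (pos m k : ℂ)) ^ j) (fun k => exp (I * (pos m k : ℂ) * x))
    z he m
  have hzn : ‖z - 1‖ = 2 * |Real.sin (x / (2 * m))| := by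
    rw [hz, Complex.norm_exp_I_mul_ofReal_sub_one, Real.norm_eq_abs, abs_mul, abs_two, div_div,
      mul_comm (m : ℝ) 2]
  have hb : ∀ k, k ≤ m → ‖(I * (pos m k : ℂ)) ^ j * exp (I * (pos m k : ℂ) * x)‖ ≤ 1 := by
    intro k hk
    rw [norm_mul, norm_exp_I_mul_mul, mul_one, norm_pow, norm_I_mul_ofReal]
    exact pow_le_one₀ (abs_nonneg _) (hpos k hk)
  have hsum : ‖∑ k ∈ Finset.range m, ((I * (pos m (k + 1) : ℂ)) ^ j - (I * (pos m k : ℂ)) ^ j) *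
      exp (I * (pos m (k + 1) : ℂ) * x)‖ ≤ j := by
    refine (norm_sum_le _ _).trans ?_
    have : ∀ k ∈ Finset.range m, ‖((I * (pos m (k + 1) : ℂ)) ^ j - (I * (pos m k : ℂ)) ^ j) *
        exp (I * (pos m (k + 1) : ℂ) * x)‖ ≤ j * (1 / m) := by
      intro k hk
      have hkm := Finset.mem_range.1 hk
      rw [norm_mul, norm_exp_I_mul_mul, mul_one]
      refine (norm_I_mul_pow_sub_le (hpos _ hkm) (hpos _ hkm.le) j).trans ?_
      rw [hstep, abs_of_nonneg (by positivity)]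
    refine (Finset.sum_le_sum this).trans ?_
    rw [Finset.sum_const, Finset.card_range, nsmul_eq_mul]
    apply le_of_eq
    field_simp
  have h1 : ‖(z - 1) * ∑ k ∈ Finset.range m, (I * (pos m k : ℂ)) ^ j *
      exp (I * (pos m k : ℂ) * x)‖ ≤ 1 + 1 + j := by
    rw [key]
    refine (norm_sub_le _ _).trans (add_le_add ((norm_sub_le _ _).trans ?_) hsum)
    exact add_le_add (hb m le_rfl) (hb 0 (Nat.zero_le m))
  have h2 : ∑ k ∈ Finset.range m, (I * (pos m k : ℂ)) ^ j * exp (I * (pos m k : ℂ) * x) =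
      ((dk m j x * m : ℝ) : ℂ) := by
    push_cast
    rw [← dkC_ofReal, dkC, div_mul_cancel₀ _ hmC]
    rfl
  rw [h2, norm_mul, hzn, Complex.norm_real, Real.norm_eq_abs, abs_mul, abs_of_pos hm'] at h1
  have hj : (0 : ℝ) ≤ j := Nat.cast_nonneg j
  nlinarith

/-! ### The consistency test of the array and the limit test as conditions on `power` -/

lemma IsKernel.one_zero {D : ℕ → ℝ → ℝ} (hD : IsKernel D) : D 1 0 = 0 := by
  have := hD.neg 1 0
  simp at this
  linarith

lemma IsKernel.neg_zero {D : ℕ → ℝ → ℝ} (hD : IsKernel D) (x : ℝ) : D 0 (-x) = D 0 x := by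
  simpa using hD.neg 0 x

lemma IsKernel.neg_one {D : ℕ → ℝ → ℝ} (hD : IsKernel D) (x : ℝ) : D 1 (-x) = -D 1 x := by
  simpa using hD.neg 1 x

lemma IsKernel.neg_two {D : ℕ → ℝ → ℝ} (hD : IsKernel D) (x : ℝ) : D 2 (-x) = D 2 x := by
  simpa using hD.neg 2 x

lemma exp_I_mul_conj (y : ℝ) : exp (I * y) * conj (exp (I * y)) = 1 := by
  rw [← exp_conj, ← Complex.exp_add]
  simp

lemma conj_exp_I (y : ℝ) : conj (exp (I * y)) = exp (I * ((-y : ℝ) : ℂ)) := by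
  rw [← exp_conj]
  simp

/-- A Gram family: `K 0`, `K 1`, `K 2` are the inner products of steering vectors and of their
derivatives at electrical angles whose difference is given. -/
structure IsGramFamily (D : ℕ → ℝ → ℝ) (M lam κ : ℝ) (K0 K1 K2 : ℝ → ℂ) : Prop where
  K0_eq : ∀ y, K0 y = M * (exp (I * ((κ * (lam * y) : ℝ) : ℂ)) * D 0 (lam * y))
  K1_eq : ∀ y, K1 y = M * lam *
    (exp (I * ((κ * (lam * y) : ℝ) : ℂ)) * (D 1 (lam * y) + I * κ * D 0 (lam * y)))
  K2_eq : ∀ y, K2 y = M * lam ^ 2 * (exp (I * ((κ * (lam * y) : ℝ) : ℂ)) *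
    (-D 2 (lam * y) - 2 * I * κ * D 1 (lam * y) + κ ^ 2 * D 0 (lam * y)))

/-- One computation serves the array and the limit. The factor `exp (I κ lam y)` is multiplicative
in `y`, so the phases of all entries are products of `w`, `conj w` and `e`, and the Gram matrices
take the normal forms `gramF`, `gramG`, `gramH`. -/
lemma IsGramFamily.norm_sq {D : ℕ → ℝ → ℝ} {M lam κ : ℝ} {K0 K1 K2 : ℝ → ℂ}
    (h : IsGramFamily D M lam κ K0 K1 K2) (hD : IsKernel D) {ρ : ℂ} {Δ y r : ℝ}
    (hρ : ‖ρ‖ ≤ 1) (hM : M ≠ 0) (hl : lam ≠ 0) (hs : 1 - D 0 (lam * Δ) ^ 2 ≠ 0)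
    (hr : r = (conj (exp (I * ((κ * (lam * Δ) : ℝ) : ℂ))) * ρ).re)
    (h1 : kerK D (lam * Δ) - kerL D (lam * Δ) * r ≠ 0)
    (h2 : kerK D (lam * Δ) + kerL D (lam * Δ) * r ≠ 0) :
    ‖WithLp.toLp 2 (Matrix.vecMul (gramRow !![K0 0, K0 Δ; K0 (-Δ), K0 0]
      !![K1 0, K1 Δ; K1 (-Δ), K1 0] !![K2 0, K2 Δ; K2 (-Δ), K2 0] ![K0 y, K0 (Δ + y)]
      ![K1 y, K1 (Δ + y)] (corr ρ)) (CFC.sqrt (corr ρ)))‖ ^ 2 =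
      power D (lam * Δ) r (lam * y) := by
  set w := exp (I * ((κ * (lam * Δ) : ℝ) : ℂ)) with hw
  set e := exp (I * ((κ * (lam * y) : ℝ) : ℂ)) with he
  have hcw : exp (I * ((κ * (lam * -Δ) : ℝ) : ℂ)) = conj w := by
    rw [hw, conj_exp_I]
    congr 3
    ring
  have hew : exp (I * ((κ * (lam * (Δ + y)) : ℝ) : ℂ)) = e * w := by
    rw [hw, he, ← Complex.exp_add]
    congr 1
    push_cast
    ring
  have hadd : lam * (Δ + y) = lam * y + lam * Δ := by ring
  have hneg : lam * -Δ = -(lam * Δ) := by ring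
  rw [← norm_gramRow_sq (e := e) (κ := κ) (exp_I_mul_conj _) (exp_I_mul_conj _) hρ hM hl hs hr
    h1 h2]
  congr 5
  · rw [h.K0_eq 0, h.K0_eq Δ, h.K0_eq (-Δ), hcw, hneg, hD.neg_zero, gramF]
    simp [hD.one, hw]
  · rw [h.K1_eq 0, h.K1_eq Δ, h.K1_eq (-Δ), hcw, hneg, hD.neg_zero, hD.neg_one, gramG]
    simp [hD.one, hD.one_zero, hw]
  · rw [h.K2_eq 0, h.K2_eq Δ, h.K2_eq (-Δ), hcw, hneg, hD.neg_zero, hD.neg_one, hD.neg_two, gramH]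
    simp [hD.one, hD.one_zero, hw]
  · rw [h.K0_eq, h.K0_eq, hew, hadd, ← he, ← hw, mul_assoc e]
  · rw [h.K1_eq, h.K1_eq, hew, hadd, ← he, ← hw, mul_assoc e]

/-! #### The array -/

/-- Moves the phase reference from the first sensor to the centre: `k = m * (pos m k + κ)` with `κ =
(m - 1) / (2m)`. -/
lemma exp_eq_wave {m : ℕ} (hm : m ≠ 0) (k : ℕ) (y : ℝ) : exp (I * (k : ℂ) * y) =
    exp (I * (((m - 1) / (2 * m) * (m * y) : ℝ) : ℂ)) * wave 0 (pos m k) ((m * y : ℝ) : ℂ) := by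
  have hmC : (m : ℂ) ≠ 0 := by exact_mod_cast hm
  rw [wave, pow_zero, one_mul, ← Complex.exp_add, pos]
  congr 1
  push_cast
  field_simp
  ring

lemma natCast_eq_pos {m : ℕ} (hm : m ≠ 0) (k : ℕ) :
    (k : ℂ) = m * ((pos m k : ℂ) + (((m - 1) / (2 * m) : ℝ) : ℂ)) := by
  have hmC : (m : ℂ) ≠ 0 := by exact_mod_cast hm
  rw [pos]
  push_cast
  field_simp
  ring

lemma sum_wave_eq {m : ℕ} (hm : m ≠ 0) (j : ℕ) (x : ℝ) :
    ∑ k : Fin m, wave j (pos m k) x = m * (dk m j x : ℂ) := by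
  have hmC : (m : ℂ) ≠ 0 := by exact_mod_cast hm
  rw [← dkC_ofReal, dkC, mul_div_cancel₀ _ hmC, Fin.sum_univ_eq_sum_range (fun k => wave j (pos m k) x)]

lemma wave_succ (j : ℕ) (u : ℝ) (z : ℂ) : wave (j + 1) u z = I * u * wave j u z := by
  simp only [wave]
  ring

lemma isGramFamily_ula {m : ℕ} (hm : m ≠ 0) : IsGramFamily (dk m) m m ((m - 1) / (2 * m))
    (fun y => ∑ k : Fin m, exp (I * ((k : ℕ) : ℂ) * y))
    (fun y => ∑ k : Fin m, I * ((k : ℕ) : ℂ) * exp (I * ((k : ℕ) : ℂ) * y))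
    (fun y => ∑ k : Fin m, ((k : ℕ) : ℂ) ^ 2 * exp (I * ((k : ℕ) : ℂ) * y)) where
  K0_eq y := by
    simp only [exp_eq_wave hm]
    rw [← Finset.mul_sum, sum_wave_eq hm]
    push_cast
    ring
  K1_eq y := by
    set κ : ℝ := (m - 1) / (2 * m) with hκ
    set E := exp (I * ((κ * (m * y) : ℝ) : ℂ)) with hE
    have : ∀ k : Fin m, I * ((k : ℕ) : ℂ) * exp (I * ((k : ℕ) : ℂ) * y) =
        m * E * (wave 1 (pos m k) ((m * y : ℝ) : ℂ) +
          I * κ * wave 0 (pos m k) ((m * y : ℝ) : ℂ)) := by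
      intro k
      rw [exp_eq_wave hm, wave_succ, natCast_eq_pos hm, ← hκ, ← hE]
      ring
    simp only [this]
    rw [← Finset.mul_sum, Finset.sum_add_distrib, ← Finset.mul_sum, sum_wave_eq hm, sum_wave_eq hm]
    push_cast
    ring
  K2_eq y := by
    set κ : ℝ := (m - 1) / (2 * m) with hκ
    set E := exp (I * ((κ * (m * y) : ℝ) : ℂ)) with hE
    have : ∀ k : Fin m, ((k : ℕ) : ℂ) ^ 2 * exp (I * ((k : ℕ) : ℂ) * y) =
        m ^ 2 * E * (-wave 2 (pos m k) ((m * y : ℝ) : ℂ) -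
          2 * I * κ * wave 1 (pos m k) ((m * y : ℝ) : ℂ) +
          κ ^ 2 * wave 0 (pos m k) ((m * y : ℝ) : ℂ)) := by
      intro k
      rw [exp_eq_wave hm, wave_succ 1, wave_succ 0, natCast_eq_pos hm, ← hκ, ← hE]
      linear_combination ((m : ℂ) ^ 2 * E * wave 0 (pos m k) ((m * y : ℝ) : ℂ) *
        ((pos m k : ℂ) ^ 2 + 2 * κ * pos m k)) * I_sq
    simp only [this]
    rw [← Finset.mul_sum, Finset.sum_add_distrib, Finset.sum_sub_distrib, Finset.sum_neg_distrib,
      ← Finset.mul_sum, ← Finset.mul_sum, sum_wave_eq hm, sum_wave_eq hm, sum_wave_eq hm]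
    push_cast
    ring

lemma deriv_ula (m : ℕ) (y : ℝ) :
    deriv (ula m) y = fun k : Fin m => I * ((k : ℕ) : ℂ) * exp (I * ((k : ℕ) : ℂ) * y) := by
  refine HasDerivAt.deriv ?_
  rw [hasDerivAt_pi]
  intro k
  have := (((hasDerivAt_id y).ofReal_comp).const_mul (I * ((k : ℕ) : ℂ))).cexp
  simp only [id, Complex.ofReal_one, mul_one] at this
  rw [mul_comm]
  exact this

/-- Expanding `P_A^⊥` leaves only the products `Aᴴ A`, `Aᴴ B`, `Bᴴ B` and the two rows `v A`, `v B`,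
so the test sees the manifold only through inner products. -/
lemma gramRow_ula_eq (m : ℕ) (θ : Fin 2 → ℝ) (Ξ : Matrix (Fin 2) (Fin 2) ℂ) (v : Fin m → ℂ) :
    Matrix.vecMul v (projPerp (ula m) θ * dsteer (ula m) θ * D0 (ula m) θ Ξ -
        steerDual (ula m) θ) =
      gramRow ((steer (ula m) θ).conjTranspose * steer (ula m) θ)
        ((steer (ula m) θ).conjTranspose * dsteer (ula m) θ)
        ((dsteer (ula m) θ).conjTranspose * dsteer (ula m) θ)
        (Matrix.vecMul v (steer (ula m) θ)) (Matrix.vecMul v (dsteer (ula m) θ)) Ξ := by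
  have hK : (dsteer (ula m) θ).conjTranspose * projPerp (ula m) θ * dsteer (ula m) θ =
      (dsteer (ula m) θ).conjTranspose * dsteer (ula m) θ -
      ((steer (ula m) θ).conjTranspose * dsteer (ula m) θ).conjTranspose *
      ((steer (ula m) θ).conjTranspose * steer (ula m) θ)⁻¹ *
      ((steer (ula m) θ).conjTranspose * dsteer (ula m) θ) := by
    simp only [projPerp, steerDual, Matrix.conjTranspose_mul, Matrix.conjTranspose_conjTranspose,
      Matrix.mul_sub, Matrix.sub_mul, Matrix.mul_one, Matrix.mul_assoc]
  have hb : (dsteer (ula m) θ).conjTranspose * steerDual (ula m) θ =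
      ((steer (ula m) θ).conjTranspose * dsteer (ula m) θ).conjTranspose *
      ((steer (ula m) θ).conjTranspose * steer (ula m) θ)⁻¹ := by
    simp only [steerDual, Matrix.conjTranspose_mul, Matrix.conjTranspose_conjTranspose,
      Matrix.mul_assoc]
  have hPB : projPerp (ula m) θ * dsteer (ula m) θ = dsteer (ula m) θ - steer (ula m) θ *
      (((steer (ula m) θ).conjTranspose * steer (ula m) θ)⁻¹ *
      ((steer (ula m) θ).conjTranspose * dsteer (ula m) θ)) := by
    simp only [projPerp, steerDual, Matrix.sub_mul, Matrix.one_mul, Matrix.mul_assoc]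
  rw [gramRow, D0, ← hK, ← hb, hPB]
  rw [Matrix.vecMul_sub, ← Matrix.vecMul_vecMul, Matrix.vecMul_sub, ← Matrix.vecMul_vecMul,
    show Matrix.vecMul v (steerDual (ula m) θ) = _ from (Matrix.vecMul_vecMul _ _ _).symm]
  rfl

lemma conj_exp_mul_exp (k : ℕ) (a b : ℝ) : conj (exp (I * (k : ℂ) * a)) * exp (I * (k : ℂ) * b) =
    exp (I * (k : ℂ) * ((b - a : ℝ) : ℂ)) := by
  rw [← exp_conj, ← Complex.exp_add]
  congr 1
  simp only [map_mul, conj_I, Complex.conj_ofReal, Complex.conj_natCast]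
  push_cast
  ring

lemma steer_gram (m : ℕ) (θ : Fin 2 → ℝ) (i j : Fin 2) :
    ((steer (ula m) θ).conjTranspose * steer (ula m) θ) i j =
      ∑ k : Fin m, exp (I * ((k : ℕ) : ℂ) * ((θ j - θ i : ℝ) : ℂ)) := by
  rw [Matrix.mul_apply]
  refine Finset.sum_congr rfl fun k _ => ?_
  rw [← conj_exp_mul_exp]
  rfl

lemma steer_dsteer_gram (m : ℕ) (θ : Fin 2 → ℝ) (i j : Fin 2) :
    ((steer (ula m) θ).conjTranspose * dsteer (ula m) θ) i j =
      ∑ k : Fin m, I * ((k : ℕ) : ℂ) * exp (I * ((k : ℕ) : ℂ) * ((θ j - θ i : ℝ) : ℂ)) := by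
  rw [Matrix.mul_apply]
  refine Finset.sum_congr rfl fun k _ => ?_
  rw [← conj_exp_mul_exp, Matrix.conjTranspose_apply]
  simp only [steer, dsteer, Matrix.of_apply, deriv_ula, ula, Complex.star_def]
  ring

lemma dsteer_gram (m : ℕ) (θ : Fin 2 → ℝ) (i j : Fin 2) :
    ((dsteer (ula m) θ).conjTranspose * dsteer (ula m) θ) i j =
      ∑ k : Fin m, ((k : ℕ) : ℂ) ^ 2 * exp (I * ((k : ℕ) : ℂ) * ((θ j - θ i : ℝ) : ℂ)) := by
  rw [Matrix.mul_apply]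
  refine Finset.sum_congr rfl fun k _ => ?_
  rw [← conj_exp_mul_exp, Matrix.conjTranspose_apply]
  simp only [steer, dsteer, Matrix.of_apply, deriv_ula, Complex.star_def, map_mul, conj_I,
    Complex.conj_natCast]
  linear_combination (-((k : ℕ) : ℂ) ^ 2 * conj (exp (I * ((k : ℕ) : ℂ) * (θ i : ℂ))) *
    exp (I * ((k : ℕ) : ℂ) * (θ j : ℂ))) * I_sq

lemma vecMul_steer (m : ℕ) (θ : Fin 2 → ℝ) (y : ℝ) (j : Fin 2) :
    Matrix.vecMul (star (ula m y)) (steer (ula m) θ) j =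
      ∑ k : Fin m, exp (I * ((k : ℕ) : ℂ) * ((θ j - y : ℝ) : ℂ)) := by
  rw [Matrix.vecMul, dotProduct]
  refine Finset.sum_congr rfl fun k _ => ?_
  rw [← conj_exp_mul_exp]
  rfl

lemma vecMul_dsteer (m : ℕ) (θ : Fin 2 → ℝ) (y : ℝ) (j : Fin 2) :
    Matrix.vecMul (star (ula m y)) (dsteer (ula m) θ) j =
      ∑ k : Fin m, I * ((k : ℕ) : ℂ) * exp (I * ((k : ℕ) : ℂ) * ((θ j - y : ℝ) : ℂ)) := by
  rw [Matrix.vecMul, dotProduct]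
  refine Finset.sum_congr rfl fun k _ => ?_
  rw [← conj_exp_mul_exp]
  simp only [steer, dsteer, Matrix.of_apply, deriv_ula, ula, Complex.star_def, Pi.star_apply]
  ring

/-- The consistency test of the array at one electrical angle. -/
lemma ula_test_iff {m : ℕ} (hm : m ≠ 0) {ρ : ℂ} (hρ : ‖ρ‖ ≤ 1) {Δ r y : ℝ}
    (hs : 1 - dk m 0 (m * Δ) ^ 2 ≠ 0)
    (hr : r = (conj (exp (I * (((m - 1) / (2 * m) * (m * Δ) : ℝ) : ℂ))) * ρ).re)
    (h1 : kerK (dk m) (m * Δ) - kerL (dk m) (m * Δ) * r ≠ 0)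
    (h2 : kerK (dk m) (m * Δ) + kerL (dk m) (m * Δ) * r ≠ 0) :
    ‖WithLp.toLp 2 (Matrix.vecMul (star (ula m y))
      ((projPerp (ula m) ![0, Δ] * dsteer (ula m) ![0, Δ] * D0 (ula m) ![0, Δ] (corr ρ) -
        steerDual (ula m) ![0, Δ]) * CFC.sqrt (corr ρ)))‖ ≤ 1 ↔
      power (dk m) (m * Δ) r (-(m * y)) ≤ 1 := by
  have hm' : (m : ℝ) ≠ 0 := by exact_mod_cast hm
  rw [← Matrix.vecMul_vecMul, gramRow_ula_eq]
  -- The row `aᴴ(y) A` has entries depending on `θ j - y`, hence the evaluation point `-y`.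
  have key := (isGramFamily_ula hm).norm_sq (isKernel_dk hm) (y := -y) hρ hm' hm' hs hr h1 h2
  rw [← sq_le_one_iff₀ (norm_nonneg _), ← mul_neg, ← key]
  have hvec : ∀ v : Fin 2 → ℂ, v = ![v 0, v 1] := fun v => by
    ext i
    fin_cases i <;> rfl
  rw [Matrix.eta_fin_two ((steer (ula m) ![0, Δ]).conjTranspose * steer (ula m) ![0, Δ]),
    Matrix.eta_fin_two ((steer (ula m) ![0, Δ]).conjTranspose * dsteer (ula m) ![0, Δ]),
    Matrix.eta_fin_two ((dsteer (ula m) ![0, Δ]).conjTranspose * dsteer (ula m) ![0, Δ]),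
    hvec (Matrix.vecMul (star (ula m y)) (steer (ula m) ![0, Δ])),
    hvec (Matrix.vecMul (star (ula m y)) (dsteer (ula m) ![0, Δ]))]
  simp only [steer_gram, steer_dsteer_gram, dsteer_gram, vecMul_steer, vecMul_dsteer,
    Matrix.cons_val_zero, Matrix.cons_val_one, sub_self, zero_sub, sub_eq_add_neg Δ,
    neg_zero, add_zero]

/-! #### The limit test -/

lemma lk_zero_eq {x : ℝ} (hx : x ≠ 0) : lk 0 x = 2 * Real.sin (x / 2) / x := by
  have hxC : (x : ℂ) ≠ 0 := by exact_mod_cast hx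
  apply Complex.ofReal_injective
  rw [← lkC_ofReal, lkC]
  have h : ∀ u : ℝ, wave 0 u x = exp (I * x * u) := fun u => by
    simp only [wave, pow_zero, one_mul]
    congr 1
    ring
  simp only [h]
  rw [integral_exp_mul_complex (mul_ne_zero I_ne_zero hxC)]
  push_cast
  rw [Complex.sin]
  have e1 : I * (x : ℂ) * (1 / 2) = x / 2 * I := by ring
  have e2 : I * (x : ℂ) * -(1 / 2) = -(x / 2) * I := by ring
  rw [e1, e2]
  field_simp
  linear_combination (exp (x * I / 2) - exp (-(x * I / 2))) * I_sq

/-- `Fa` is the transform of the uniform density on `[0, 1]`; recentring at 1/2 extracts the phase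
and leaves the real kernel `lk 0`. -/
lemma Fa_eq (δ : ℝ) : Fa δ = exp (I * ((1 / 2 * δ : ℝ) : ℂ)) * lk 0 δ := by
  rw [Fa]
  split_ifs with h
  · simp [h, isKernel_lk.one]
  · have hC : (δ : ℂ) ≠ 0 := by exact_mod_cast h
    rw [lk_zero_eq h]
    push_cast
    rw [Complex.sin]
    have e1 : exp (I * (δ : ℂ)) = exp (δ / 2 * I) * exp (δ / 2 * I) := by
      rw [← Complex.exp_add]
      congr 1
      ring
    have e2 : exp (-(δ / 2 : ℂ) * I) * exp (δ / 2 * I) = 1 := by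
      rw [← Complex.exp_add, neg_mul, neg_add_cancel, Complex.exp_zero]
    have e3 : exp (I * (1 / 2 * (δ : ℂ))) = exp (δ / 2 * I) := by
      congr 1
      ring
    rw [e1, e3]
    generalize exp (-(δ / 2 : ℂ) * I) = A at *
    generalize exp ((δ / 2 : ℂ) * I) = B at *
    field_simp
    linear_combination (-I ^ 2) * e2 + (B * B - 1) * I_sq

lemma hasDerivAt_exp_half (δ : ℝ) : HasDerivAt (fun δ : ℝ => exp (I * ((1 / 2 * δ : ℝ) : ℂ)))
    (I / 2 * exp (I * ((1 / 2 * δ : ℝ) : ℂ))) δ := by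
  have h := ((((hasDerivAt_id δ).const_mul (1 / 2 : ℝ)).ofReal_comp).const_mul I).cexp
  refine h.congr_deriv ?_
  simp
  ring

lemma Ga_eq (δ : ℝ) :
    Ga δ = exp (I * ((1 / 2 * δ : ℝ) : ℂ)) * (lk 1 δ + I / 2 * lk 0 δ) := by
  rw [Ga, show Fa = fun δ => exp (I * ((1 / 2 * δ : ℝ) : ℂ)) * lk 0 δ from funext Fa_eq]
  rw [((hasDerivAt_exp_half δ).fun_mul (isKernel_lk.hasDerivAt 0 δ).ofReal_comp).deriv]
  ring

lemma Ha_eq (δ : ℝ) : Ha δ = exp (I * ((1 / 2 * δ : ℝ) : ℂ)) *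
    (-lk 2 δ - I * lk 1 δ + 1 / 4 * lk 0 δ) := by
  rw [Ha, show Ga = fun δ => exp (I * ((1 / 2 * δ : ℝ) : ℂ)) * (lk 1 δ + I / 2 * lk 0 δ)
    from funext Ga_eq]
  rw [((hasDerivAt_exp_half δ).fun_mul ((isKernel_lk.hasDerivAt 1 δ).ofReal_comp.fun_add
    ((isKernel_lk.hasDerivAt 0 δ).ofReal_comp.const_mul (I / 2)))).deriv]
  linear_combination (-1 / 4 * exp (I * ((1 / 2 * δ : ℝ) : ℂ)) * lk 0 δ) * I_sq

lemma isGramFamily_limit : IsGramFamily lk 1 1 (1 / 2) Fa Ga Ha where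
  K0_eq y := by
    rw [one_mul, Fa_eq]
    simp
  K1_eq y := by
    rw [one_mul, Ga_eq]
    push_cast
    ring
  K2_eq y := by
    rw [one_mul, Ha_eq]
    push_cast
    ring

lemma lk_two_zero : lk 2 0 = -(1 / 12) := by
  apply Complex.ofReal_injective
  rw [← lkC_ofReal, lkC]
  have h : ∀ u : ℝ, wave 2 u ((0 : ℝ) : ℂ) = ((-u ^ 2 : ℝ) : ℂ) := fun u => by
    simp [wave, mul_pow]
  simp only [h]
  rw [intervalIntegral.integral_ofReal]
  congr 1
  rw [intervalIntegral.integral_neg, integral_pow]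
  norm_num

lemma lk_four_zero : lk 4 0 = 1 / 80 := by
  apply Complex.ofReal_injective
  rw [← lkC_ofReal, lkC]
  have h : ∀ u : ℝ, wave 4 u ((0 : ℝ) : ℂ) = ((u ^ 4 : ℝ) : ℂ) := fun u => by
    simp [wave, mul_pow]
  simp only [h]
  rw [intervalIntegral.integral_ofReal]
  congr 1
  rw [integral_pow]
  norm_num

lemma abs_lk_zero_lt_one {x : ℝ} (hx : x ≠ 0) : |lk 0 x| < 1 := by
  rw [lk_zero_eq hx, abs_div, div_lt_one (abs_pos.2 hx), abs_mul, abs_two]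
  have := Real.abs_sin_lt_abs (x := x / 2) (by simpa using hx)
  rw [abs_div, abs_two] at this
  linarith

lemma one_sub_lk_zero_sq_pos {x : ℝ} (hx : x ≠ 0) : 0 < 1 - lk 0 x ^ 2 := by
  have := (sq_lt_one_iff_abs_lt_one _).2 (abs_lk_zero_lt_one hx)
  linarith

/-- The limit test at one point. -/
lemma limit_test_iff {ρ : ℂ} (hρ : ‖ρ‖ ≤ 1) {δ r : ℝ} (hδ : δ ≠ 0)
    (hr : r = (conj (exp (I * ((1 / 2 * δ : ℝ) : ℂ))) * ρ).re)
    (h1 : kerK lk δ - kerL lk δ * r ≠ 0) (h2 : kerK lk δ + kerL lk δ * r ≠ 0) :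
    LimitTest δ (corr ρ) ↔ ∀ x, power lk δ r x ≤ 1 := by
  refine forall_congr' fun y => ?_
  have hs := (one_sub_lk_zero_sq_pos hδ).ne'
  have key := isGramFamily_limit.norm_sq isKernel_lk (Δ := δ) (y := y) (r := r) hρ one_ne_zero
    one_ne_zero (by rwa [one_mul]) (by rwa [one_mul]) (by rwa [one_mul]) (by rwa [one_mul])
  rw [one_mul, one_mul] at key
  rw [← key, sq_le_one_iff₀ (norm_nonneg _)]
  -- The limit matrices carry literal diagonal entries, which have to be recognized as the values of
  -- the limit functions at 0.
  have e0 : Fa 0 = 1 := by simp [Fa]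
  have e1 : Ga 0 = I / 2 := by simp [Ga_eq, isKernel_lk.one, isKernel_lk.one_zero]
  have e2 : Ha 0 = 1 / 3 := by
    simp [Ha_eq, isKernel_lk.one, isKernel_lk.one_zero, lk_two_zero]
    norm_num
  rw [e0, e1, e2]
  rfl

/-! ### Behaviour of the power near the sources -/

section Power

variable {D : ℕ → ℝ → ℝ} {δ r t : ℝ}

/-- First derivative of `power`. -/
def power1 (D : ℕ → ℝ → ℝ) (δ r x : ℝ) : ℝ :=
  (1 + r) * (evenV D δ (kerT D δ r) 0 x * evenV D δ (kerT D δ r) 1 x) +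
    (1 - r) * (oddV D δ (kerT D δ r) 0 x * oddV D δ (kerT D δ r) 1 x)

/-- Second derivative of `power`. -/
def power2 (D : ℕ → ℝ → ℝ) (δ r x : ℝ) : ℝ :=
  (1 + r) * (evenV D δ (kerT D δ r) 1 x ^ 2 +
      evenV D δ (kerT D δ r) 0 x * evenV D δ (kerT D δ r) 2 x) +
    (1 - r) * (oddV D δ (kerT D δ r) 1 x ^ 2 +
      oddV D δ (kerT D δ r) 0 x * oddV D δ (kerT D δ r) 2 x)

lemma IsKernel.hasDerivAt_add (hD : IsKernel D) (j : ℕ) (x : ℝ) :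
    HasDerivAt (fun x => D j (x + δ)) (D (j + 1) (x + δ)) x :=
  (hD.hasDerivAt j (x + δ)).comp_add_const x δ

lemma IsKernel.hasDerivAt_evenU (hD : IsKernel D) (j : ℕ) (x : ℝ) :
    HasDerivAt (evenU D δ j) (evenU D δ (j + 1) x) x :=
  ((hD.hasDerivAt j x).fun_add (hD.hasDerivAt_add j x)).div_const _

lemma IsKernel.hasDerivAt_oddU (hD : IsKernel D) (j : ℕ) (x : ℝ) :
    HasDerivAt (oddU D δ j) (oddU D δ (j + 1) x) x :=
  ((hD.hasDerivAt j x).fun_sub (hD.hasDerivAt_add j x)).div_const _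

lemma IsKernel.hasDerivAt_evenV (hD : IsKernel D) (j : ℕ) (x : ℝ) :
    HasDerivAt (evenV D δ t j) (evenV D δ t (j + 1) x) x :=
  (hD.hasDerivAt_evenU j x).fun_sub ((((hD.hasDerivAt (j + 1) x).fun_sub
    (hD.hasDerivAt_add (j + 1) x)).fun_add ((hD.hasDerivAt_evenU j x).const_mul _)).const_mul t)

lemma IsKernel.hasDerivAt_oddV (hD : IsKernel D) (j : ℕ) (x : ℝ) :
    HasDerivAt (oddV D δ t j) (oddV D δ t (j + 1) x) x :=
  (hD.hasDerivAt_oddU j x).fun_sub ((((hD.hasDerivAt (j + 1) x).fun_add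
    (hD.hasDerivAt_add (j + 1) x)).fun_sub ((hD.hasDerivAt_oddU j x).const_mul _)).const_mul t)

lemma IsKernel.hasDerivAt_power (hD : IsKernel D) (x : ℝ) :
    HasDerivAt (power D δ r) (power1 D δ r x) x := by
  have h := (((hD.hasDerivAt_evenV (δ := δ) (t := kerT D δ r) 0 x).fun_pow 2).const_mul
    ((1 + r) / 2)).fun_add
    (((hD.hasDerivAt_oddV (δ := δ) (t := kerT D δ r) 0 x).fun_pow 2).const_mul ((1 - r) / 2))
  refine h.congr_deriv ?_
  simp only [power1]
  push_cast
  ring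

lemma IsKernel.hasDerivAt_power1 (hD : IsKernel D) (x : ℝ) :
    HasDerivAt (power1 D δ r) (power2 D δ r x) x := by
  have h := (((hD.hasDerivAt_evenV (δ := δ) (t := kerT D δ r) 0 x).fun_mul
    (hD.hasDerivAt_evenV (δ := δ) (t := kerT D δ r) 1 x)).const_mul (1 + r)).fun_add
    (((hD.hasDerivAt_oddV (δ := δ) (t := kerT D δ r) 0 x).fun_mul
    (hD.hasDerivAt_oddV (δ := δ) (t := kerT D δ r) 1 x)).const_mul (1 - r))
  refine h.congr_deriv ?_
  simp only [power2]
  ring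

lemma one_add_ne_zero_of {s : ℝ} (hs : 1 - s ^ 2 ≠ 0) : 1 + s ≠ 0 :=
  fun h => hs (by linear_combination (1 - s) * h)

lemma one_sub_ne_zero_of {s : ℝ} (hs : 1 - s ^ 2 ≠ 0) : 1 - s ≠ 0 :=
  fun h => hs (by linear_combination (1 + s) * h)

lemma IsKernel.evenV_zero_zero (hD : IsKernel D) (hs : 1 - D 0 δ ^ 2 ≠ 0) :
    evenV D δ t 0 0 = 1 := by
  have := one_add_ne_zero_of hs
  simp [evenV, evenW, evenU, hD.one, hD.one_zero, this]

lemma IsKernel.oddV_zero_zero (hD : IsKernel D) (hs : 1 - D 0 δ ^ 2 ≠ 0) :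
    oddV D δ t 0 0 = 1 := by
  have := one_sub_ne_zero_of hs
  simp [oddV, oddW, oddU, hD.one, hD.one_zero, this]

lemma kerK_sub_kerL (hs : 1 - D 0 δ ^ 2 ≠ 0) :
    kerK D δ - kerL D δ = -D 2 0 + D 2 δ - D 1 δ ^ 2 / (1 + D 0 δ) := by
  have h1 := one_sub_ne_zero_of hs
  have h2 := one_add_ne_zero_of hs
  have : 1 - D 0 δ ^ 2 = (1 - D 0 δ) * (1 + D 0 δ) := by ring
  rw [kerK, kerL, this]
  field_simp
  ring

lemma kerK_add_kerL (hs : 1 - D 0 δ ^ 2 ≠ 0) :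
    kerK D δ + kerL D δ = -D 2 0 - D 2 δ - D 1 δ ^ 2 / (1 - D 0 δ) := by
  have h1 := one_sub_ne_zero_of hs
  have h2 := one_add_ne_zero_of hs
  have : 1 - D 0 δ ^ 2 = (1 - D 0 δ) * (1 + D 0 δ) := by ring
  rw [kerK, kerL, this]
  field_simp
  ring

lemma IsKernel.evenV_one_zero (hD : IsKernel D) (hs : 1 - D 0 δ ^ 2 ≠ 0) :
    evenV D δ t 1 0 = D 1 δ / (1 + D 0 δ) + t * (kerK D δ - kerL D δ) := by
  rw [kerK_sub_kerL hs]
  simp only [evenV, evenW, evenU, hD.one_zero, zero_add]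
  ring

lemma IsKernel.oddV_one_zero (hD : IsKernel D) (hs : 1 - D 0 δ ^ 2 ≠ 0) :
    oddV D δ t 1 0 = -D 1 δ / (1 - D 0 δ) + t * (kerK D δ + kerL D δ) := by
  rw [kerK_add_kerL hs]
  simp only [oddV, oddW, oddU, hD.one_zero, zero_add]
  ring

lemma IsKernel.power_zero (hD : IsKernel D) (hs : 1 - D 0 δ ^ 2 ≠ 0) : power D δ r 0 = 1 := by
  rw [power, hD.evenV_zero_zero hs, hD.oddV_zero_zero hs]
  ring

/-- Stationarity at the source is the equation `t * (k - l r) = c * (s - r)` defining the shift: the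
slope is the weighted sum of the two one-part slopes, and `(1+r)(k-l) + (1-r)(k+l) = 2(k - l r)`. -/
lemma IsKernel.power1_zero (hD : IsKernel D) (hs : 1 - D 0 δ ^ 2 ≠ 0)
    (h : kerK D δ - kerL D δ * r ≠ 0) : power1 D δ r 0 = 0 := by
  rw [power1, hD.evenV_zero_zero hs, hD.oddV_zero_zero hs, hD.evenV_one_zero hs,
    hD.oddV_one_zero hs]
  have h3 : kerT D δ r * (kerK D δ - kerL D δ * r) =
      D 1 δ / (1 - D 0 δ ^ 2) * (D 0 δ - r) := by
    rw [kerT, div_mul_cancel₀ _ h]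
  have h1 := one_sub_ne_zero_of hs
  have h2 := one_add_ne_zero_of hs
  have h4 : D 1 δ / (1 - D 0 δ ^ 2) * (D 0 δ - r) * 2 =
      (1 - r) * (D 1 δ / (1 - D 0 δ)) - (1 + r) * (D 1 δ / (1 + D 0 δ)) := by
    have : 1 - D 0 δ ^ 2 = (1 - D 0 δ) * (1 + D 0 δ) := by ring
    rw [this]
    field_simp
    ring
  linear_combination 2 * h3 + h4

/-- The map `x ↦ -δ - x` exchanges the sources; the symmetric part is invariant and the
antisymmetric part changes sign. Facts near the first source thus transfer to the second. -/
lemma IsKernel.power_reflect (hD : IsKernel D) (x : ℝ) :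
    power D δ r (-δ - x) = power D δ r x := by
  have e1 : -δ - x = -(x + δ) := by ring
  have e2 : -δ - x + δ = -x := by ring
  have hu : evenU D δ 0 (-δ - x) = evenU D δ 0 x := by
    rw [evenU, evenU, e2, e1, hD.neg_zero, hD.neg_zero, add_comm]
  have ho : oddU D δ 0 (-δ - x) = -oddU D δ 0 x := by
    rw [oddU, oddU, e2, e1, hD.neg_zero, hD.neg_zero]
    ring
  have hw : evenW D δ 0 (-δ - x) = evenW D δ 0 x := by
    rw [evenW, evenW, hu, zero_add, e2, e1, hD.neg_one, hD.neg_one]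
    ring
  have hv : oddW D δ 0 (-δ - x) = -oddW D δ 0 x := by
    rw [oddW, oddW, ho, zero_add, e2, e1, hD.neg_one, hD.neg_one]
    ring
  rw [power, power, evenV, oddV, evenV, oddV, hu, ho, hw, hv]
  ring

/-- A function with a critical point and nonpositive second derivative nearby is at most its value
there. -/
lemma le_of_second_deriv_nonpos {h h1 h2 : ℝ → ℝ} (hh : ∀ x, HasDerivAt h (h1 x) x)
    (hh1 : ∀ x, HasDerivAt h1 (h2 x) x) (h0 : h1 0 = 0) {η : ℝ}
    (hη : ∀ x, |x| < η → h2 x ≤ 0) {x : ℝ} (hx : |x| < η) : h x ≤ h 0 := by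
  have hc : Continuous h := continuous_iff_continuousAt.2 fun x => (hh x).continuousAt
  have hc1 : Continuous h1 := continuous_iff_continuousAt.2 fun x => (hh1 x).continuousAt
  rw [abs_lt] at hx
  rcases lt_trichotomy x 0 with hx0 | hx0 | hx0
  -- The mean value theorem twice: `h x - h 0 = h1 ξ * x` and `h1 ξ = h2 ζ * ξ`, with `ξ` and `x` of
  -- equal sign.
  · obtain ⟨ξ, hξ, hξ'⟩ := exists_hasDerivAt_eq_slope h h1 hx0 hc.continuousOn fun x _ => hh x
    obtain ⟨ζ, hζ, hζ'⟩ := exists_hasDerivAt_eq_slope h1 h2 hξ.2 hc1.continuousOn fun x _ => hh1 x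
    have h3 := hη ζ (abs_lt.2 ⟨by linarith [hζ.1, hξ.1], by linarith [hζ.2]⟩)
    rw [hζ', h0, div_le_iff₀ (by linarith [hξ.2])] at h3
    rw [eq_div_iff (by linarith)] at hξ'
    nlinarith
  · rw [hx0]
  · obtain ⟨ξ, hξ, hξ'⟩ := exists_hasDerivAt_eq_slope h h1 hx0 hc.continuousOn fun x _ => hh x
    obtain ⟨ζ, hζ, hζ'⟩ := exists_hasDerivAt_eq_slope h1 h2 hξ.1 hc1.continuousOn fun x _ => hh1 x
    have h3 := hη ζ (abs_lt.2 ⟨by linarith [hζ.1], by linarith [hζ.2, hξ.2]⟩)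
    rw [hζ', h0, div_le_iff₀ (by linarith [hξ.1])] at h3
    rw [eq_div_iff (by linarith)] at hξ'
    nlinarith

/-- Near the first source the power is eventually at most one if its second derivative is
nonpositive. -/
lemma eventually_power_le_one_near {D : ℕ → ℕ → ℝ → ℝ} {δ r : ℕ → ℝ}
    (hD : ∀ᶠ m in atTop, IsKernel (D m)) (hs : ∀ᶠ m in atTop, 1 - D m 0 (δ m) ^ 2 ≠ 0)
    (hk : ∀ᶠ m in atTop, kerK (D m) (δ m) - kerL (D m) (δ m) * r m ≠ 0)
    (h2 : ∀ᶠ p : ℕ × ℝ in atTop ×ˢ 𝓝 0, power2 (D p.1) (δ p.1) (r p.1) p.2 ≤ 0) :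
    ∀ᶠ p : ℕ × ℝ in atTop ×ˢ 𝓝 0, power (D p.1) (δ p.1) (r p.1) p.2 ≤ 1 := by
  obtain ⟨pa, ha, pb, hb, hab⟩ := eventually_prod_iff.1 h2
  obtain ⟨η, hη, hball⟩ := Metric.eventually_nhds_iff.1 hb
  refine eventually_prod_iff.2 ⟨_, (ha.and hD).and (hs.and hk), _,
    Metric.ball_mem_nhds (0 : ℝ) hη, fun {m} hm x hx => ?_⟩
  obtain ⟨⟨hma, hmD⟩, hms, hmk⟩ := hm
  have := le_of_second_deriv_nonpos (hmD.hasDerivAt_power (δ := δ m) (r := r m))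
    hmD.hasDerivAt_power1 (hmD.power1_zero hms hmk) (η := η)
    (fun y hy => hab hma (hball (by rwa [Real.dist_0_eq_abs])))
    (x := x) (by rwa [← Real.dist_0_eq_abs])
  rwa [hmD.power_zero hms] at this

end Power

/-- Compactness turns thresholds that are local in `x` into one threshold for the whole interval. -/
lemma eventually_forall_Icc {P : ℕ → ℝ → Prop} {C : ℝ}
    (h : ∀ x₀, ∀ᶠ p : ℕ × ℝ in atTop ×ˢ 𝓝 x₀, P p.1 p.2) :
    ∀ᶠ m in atTop, ∀ x, |x| ≤ C → P m x := by
  have : ∀ᶠ m in atTop, ∀ x ∈ Set.Icc (-C) C, P m x := by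
    refine (isCompact_Icc (a := -C) (b := C)).induction_on
      (p := fun s => ∀ᶠ m in atTop, ∀ x ∈ s, P m x) (by simp)
      (fun s t hst ht => ht.mono fun m hm x hx => hm x (hst hx))
      (fun s t hs ht => (hs.and ht).mono fun m hm x hx => hx.elim (hm.1 x) (hm.2 x))
      fun x _ => ?_
    obtain ⟨pa, ha, pb, hb, hab⟩ := eventually_prod_iff.1 (h x)
    exact ⟨{y | pb y}, mem_nhdsWithin_of_mem_nhds hb, ha.mono fun m hm y hy => hab hm hy⟩
  exact this.mono fun m hm x hx => hm x (abs_le.1 hx)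

/-! ### Limits of the power along a filter -/

section Limits

variable {α : Type*} {F : Filter α} {D : α → ℕ → ℝ → ℝ} {δ x t r : α → ℝ} {j : ℕ}
  {a a' b b' s0 s1 t0 : ℝ}

lemma tendsto_evenV (ha : Tendsto (fun p => D p j (x p)) F (𝓝 a))
    (ha' : Tendsto (fun p => D p (j + 1) (x p)) F (𝓝 a'))
    (hb : Tendsto (fun p => D p j (x p + δ p)) F (𝓝 b))
    (hb' : Tendsto (fun p => D p (j + 1) (x p + δ p)) F (𝓝 b'))
    (hs : Tendsto (fun p => D p 0 (δ p)) F (𝓝 s0)) (hs1 : Tendsto (fun p => D p 1 (δ p)) F (𝓝 s1))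
    (ht : Tendsto t F (𝓝 t0)) (h : 1 + s0 ≠ 0) :
    Tendsto (fun p => evenV (D p) (δ p) (t p) j (x p)) F
      (𝓝 ((a + b) / (1 + s0) - t0 * (a' - b' + s1 * ((a + b) / (1 + s0))))) := by
  have hU : Tendsto (fun p => evenU (D p) (δ p) j (x p)) F (𝓝 ((a + b) / (1 + s0))) :=
    (ha.add hb).div (tendsto_const_nhds.add hs) h
  exact hU.sub (ht.mul ((ha'.sub hb').add (hs1.mul hU)))

lemma tendsto_oddV (ha : Tendsto (fun p => D p j (x p)) F (𝓝 a))
    (ha' : Tendsto (fun p => D p (j + 1) (x p)) F (𝓝 a'))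
    (hb : Tendsto (fun p => D p j (x p + δ p)) F (𝓝 b))
    (hb' : Tendsto (fun p => D p (j + 1) (x p + δ p)) F (𝓝 b'))
    (hs : Tendsto (fun p => D p 0 (δ p)) F (𝓝 s0)) (hs1 : Tendsto (fun p => D p 1 (δ p)) F (𝓝 s1))
    (ht : Tendsto t F (𝓝 t0)) (h : 1 - s0 ≠ 0) :
    Tendsto (fun p => oddV (D p) (δ p) (t p) j (x p)) F
      (𝓝 ((a - b) / (1 - s0) - t0 * (a' + b' - s1 * ((a - b) / (1 - s0))))) := by
  have hU : Tendsto (fun p => oddU (D p) (δ p) j (x p)) F (𝓝 ((a - b) / (1 - s0))) :=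
    (ha.sub hb).div (tendsto_const_nhds.sub hs) h
  exact hU.sub (ht.mul ((ha'.add hb').sub (hs1.mul hU)))

lemma tendsto_kerK {σ : ℝ} (h0 : Tendsto (fun p => D p 2 0) F (𝓝 σ))
    (hs : Tendsto (fun p => D p 0 (δ p)) F (𝓝 s0)) (hs1 : Tendsto (fun p => D p 1 (δ p)) F (𝓝 s1))
    (h : 1 - s0 ^ 2 ≠ 0) :
    Tendsto (fun p => kerK (D p) (δ p)) F (𝓝 (-σ - s1 ^ 2 / (1 - s0 ^ 2))) :=
  h0.neg.sub ((hs1.pow 2).div (tendsto_const_nhds.sub (hs.pow 2)) h)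

lemma tendsto_kerL {s2 : ℝ} (h2 : Tendsto (fun p => D p 2 (δ p)) F (𝓝 s2))
    (hs : Tendsto (fun p => D p 0 (δ p)) F (𝓝 s0)) (hs1 : Tendsto (fun p => D p 1 (δ p)) F (𝓝 s1))
    (h : 1 - s0 ^ 2 ≠ 0) :
    Tendsto (fun p => kerL (D p) (δ p)) F (𝓝 (-s2 - s0 * s1 ^ 2 / (1 - s0 ^ 2))) :=
  h2.neg.sub ((hs.mul (hs1.pow 2)).div (tendsto_const_nhds.sub (hs.pow 2)) h)

end Limits

/-- For `|r| ≤ 1` the power is a convex combination of the two squares. -/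
lemma power_le_one_of_sq_le {D : ℕ → ℝ → ℝ} {δ r x : ℝ} (hr : |r| ≤ 1)
    (h1 : evenV D δ (kerT D δ r) 0 x ^ 2 ≤ 1) (h2 : oddV D δ (kerT D δ r) 0 x ^ 2 ≤ 1) :
    power D δ r x ≤ 1 := by
  rw [abs_le] at hr
  rw [power]
  nlinarith

/-- Far from both sources the power is small. -/
lemma exists_far_bound {c σ τ : ℝ} (hc : 0 < c) (hσ : 0 ≤ σ) (hτ : 0 ≤ τ) :
    ∃ ε > 0, ∀ (D : ℕ → ℝ → ℝ) (δ r x : ℝ), |r| ≤ 1 → c ≤ |1 + D 0 δ| → c ≤ |1 - D 0 δ| →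
      |D 1 δ| ≤ σ → |kerT D δ r| ≤ τ → |D 0 x| ≤ ε → |D 1 x| ≤ ε → |D 0 (x + δ)| ≤ ε →
      |D 1 (x + δ)| ≤ ε → power D δ r x ≤ 1 := by
  -- `B` is the factor by which kernel values of size `ε` are amplified in either part of the row,
  -- so `ε = 1 / B` suffices.
  set B : ℝ := 2 / c + τ * (2 + σ * (2 / c)) with hB
  have hBpos : 0 < B := by positivity
  refine ⟨1 / B, by positivity, fun D δ r x hr hp hm h1 ht a0 a1 b0 b1 => ?_⟩
  have hε : 0 < 1 / B := by positivity
  have hεB : 1 / B * B = 1 := by field_simp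
  set ε := 1 / B
  have key : ∀ u w : ℝ, |u| ≤ 2 * ε / c → |w| ≤ 2 * ε + σ * (2 * ε / c) →
      (u - kerT D δ r * w) ^ 2 ≤ 1 := by
    intro u w hu hw
    rw [sq_le_one_iff_abs_le_one]
    have h2 : |kerT D δ r * w| ≤ τ * (2 * ε + σ * (2 * ε / c)) := by
      rw [abs_mul]
      exact mul_le_mul ht hw (abs_nonneg _) hτ
    calc |u - kerT D δ r * w| ≤ |u| + |kerT D δ r * w| := abs_sub _ _
      _ ≤ 2 * ε / c + τ * (2 * ε + σ * (2 * ε / c)) := add_le_add hu h2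
      _ = ε * B := by rw [hB]; ring
      _ ≤ 1 := hεB.le
  have quot : ∀ u s : ℝ, |u| ≤ 2 * ε → c ≤ |s| → |u / s| ≤ 2 * ε / c := by
    intro u s hu hs
    rw [abs_div]
    exact div_le_div₀ (by positivity) hu hc hs
  have hE : |evenU D δ 0 x| ≤ 2 * ε / c :=
    quot _ _ ((abs_add_le _ _).trans (by linarith)) hp
  have hO : |oddU D δ 0 x| ≤ 2 * ε / c :=
    quot _ _ ((abs_sub _ _).trans (by linarith)) hm
  refine power_le_one_of_sq_le hr (key _ _ hE ?_) (key _ _ hO ?_)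
  · refine (abs_add_le _ _).trans (add_le_add ((abs_sub _ _).trans ?_) ?_)
    · rw [zero_add]
      linarith
    · rw [abs_mul]
      exact mul_le_mul h1 hE (abs_nonneg _) hσ
  · refine (abs_sub _ _).trans (add_le_add ((abs_add_le _ _).trans ?_) ?_)
    · rw [zero_add]
      linarith
    · rw [abs_mul]
      exact mul_le_mul h1 hO (abs_nonneg _) hσ

/-! ### The distance to the multiples of the period -/

/-- A measure of the distance from `x` to the multiples of the period `2πm`. -/
def pdist (m : ℕ) (x : ℝ) : ℝ := m * |Real.sin (x / (2 * m))|

lemma pdist_neg (m : ℕ) (x : ℝ) : pdist m (-x) = pdist m x := by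
  rw [pdist, pdist, neg_div, Real.sin_neg, abs_neg]

lemma pdist_add_le {m : ℕ} (x y : ℝ) : pdist m (x + y) ≤ pdist m x + pdist m y := by
  rw [pdist, pdist, pdist, ← mul_add, add_div, Real.sin_add]
  refine mul_le_mul_of_nonneg_left ((abs_add_le _ _).trans (add_le_add ?_ ?_)) (Nat.cast_nonneg m)
  · rw [abs_mul]
    exact mul_le_of_le_one_right (abs_nonneg _) (Real.abs_cos_le_one _)
  · rw [abs_mul]
    exact mul_le_of_le_one_left (abs_nonneg _) (Real.abs_cos_le_one _)

lemma pdist_le {m : ℕ} (hm : 0 < m) (x : ℝ) : pdist m x ≤ |x| := by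
  have hm' : (0 : ℝ) < m := by exact_mod_cast hm
  have h : |Real.sin (x / (2 * m))| ≤ |x / (2 * m)| := Real.abs_sin_le_abs
  rw [abs_div, abs_of_pos (by positivity : (0 : ℝ) < 2 * m)] at h
  calc pdist m x ≤ m * (|x| / (2 * m)) := mul_le_mul_of_nonneg_left h hm'.le
    _ = |x| / 2 := by field_simp
    _ ≤ |x| := by linarith [abs_nonneg x]

/-- Jordan's inequality `sin y ≥ 2 y / π` on `[0, π/2]`: within half a period of 0, `pdist` is
comparable to the absolute value. -/
lemma le_pdist {m : ℕ} (hm : 0 < m) {x : ℝ} (hx : |x| ≤ Real.pi * m) : |x| / Real.pi ≤ pdist m x := by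
  have hm' : (0 : ℝ) < m := by exact_mod_cast hm
  have h1 : |x| / (2 * m) ≤ Real.pi / 2 := by
    rw [div_le_div_iff₀ (by positivity) two_pos]
    linarith
  have h2 := Real.mul_le_sin (by positivity : 0 ≤ |x| / (2 * m)) h1
  have h3 : |Real.sin (x / (2 * m))| = Real.sin (|x| / (2 * m)) := by
    have h4 : 0 ≤ Real.sin (|x| / (2 * m)) :=
      Real.sin_nonneg_of_nonneg_of_le_pi (by positivity) (by linarith [Real.pi_pos])
    rcases abs_choice x with h | h
    · rw [h] at h4 ⊢
      exact abs_of_nonneg h4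
    · rw [h] at h4 ⊢
      rw [neg_div, Real.sin_neg] at h4 ⊢
      exact abs_of_nonpos (by linarith)
  rw [pdist, h3]
  calc |x| / Real.pi = m * (2 / Real.pi * (|x| / (2 * m))) := by
        have := Real.pi_pos.ne'
        field_simp
    _ ≤ _ := mul_le_mul_of_nonneg_left h2 hm'.le

lemma abs_dk_mul_pdist_le {m : ℕ} (hm : 0 < m) (j : ℕ) (x : ℝ) :
    |dk m j x| * pdist m x ≤ 1 + j := abs_dk_mul_le hm j x

lemma abs_dk_le_of_le_pdist {m : ℕ} (hm : 0 < m) {j : ℕ} (hj : j ≤ 1) {x ε : ℝ} (hε : 0 < ε)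
    (hx : 2 / ε ≤ pdist m x) : |dk m j x| ≤ ε := by
  have h := abs_dk_mul_pdist_le hm j x
  have hj' : (j : ℝ) ≤ 1 := by exact_mod_cast hj
  have h2 : |dk m j x| * (2 / ε) ≤ 2 :=
    (mul_le_mul_of_nonneg_left hx (abs_nonneg _)).trans (by linarith)
  rw [mul_div_assoc', div_le_iff₀ hε] at h2
  linarith

lemma tendsto_dk_zero {α : Type*} {F : Filter α} {n : α → ℕ} {y : α → ℝ}
    (hn : ∀ᶠ p in F, 0 < n p) (hy : Tendsto (fun p => pdist (n p) (y p)) F atTop) (j : ℕ) :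
    Tendsto (fun p => dk (n p) j (y p)) F (𝓝 0) := by
  have h : Tendsto (fun p => (1 + j : ℝ) / pdist (n p) (y p)) F (𝓝 0) :=
    tendsto_const_nhds.div_atTop hy
  refine squeeze_zero_norm' ?_ h
  filter_upwards [hn, hy.eventually_gt_atTop 0] with p hp hpos
  rw [Real.norm_eq_abs, le_div_iff₀ hpos]
  exact abs_dk_mul_pdist_le hp j (y p)

lemma pdist_add_period {m : ℕ} (hm : 0 < m) (x : ℝ) : pdist m (x + 2 * Real.pi * m) = pdist m x := by
  have hm' : (m : ℝ) ≠ 0 := by exact_mod_cast hm.ne'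
  have : (x + 2 * Real.pi * m) / (2 * m) = x / (2 * m) + Real.pi := by field_simp
  rw [pdist, pdist, this, Real.sin_add_pi, abs_neg]

/-- Since `pos m k * 2πm = 2πk + π - πm`, a full period multiplies every summand by the same sign,
independent of `k`; the sign then disappears from the power. -/
lemma dk_add_period {m : ℕ} (hm : 0 < m) (j : ℕ) (x : ℝ) :
    dk m j (x + 2 * Real.pi * m) = -(-1) ^ m * dk m j x := by
  have hmC : (m : ℂ) ≠ 0 := by exact_mod_cast hm.ne'
  apply Complex.ofReal_injective
  push_cast
  rw [← dkC_ofReal, ← dkC_ofReal, dkC, dkC, ← mul_div_assoc, Finset.mul_sum]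
  congr 1
  refine Finset.sum_congr rfl fun k _ => ?_
  have h : exp (I * (pos m k : ℂ) * ((x + 2 * Real.pi * m : ℝ) : ℂ)) =
      -(-1) ^ m * exp (I * (pos m k : ℂ) * x) := by
    have e1 : I * (pos m k : ℂ) * ((x + 2 * Real.pi * m : ℝ) : ℂ) =
        I * (pos m k : ℂ) * x + (k * (2 * Real.pi * I) + Real.pi * I - m * (Real.pi * I)) := by
      rw [pos]
      push_cast
      field_simp
    rw [e1, Complex.exp_add, Complex.exp_sub, Complex.exp_add, Complex.exp_nat_mul_two_pi_mul_I,
      Complex.exp_pi_mul_I, Complex.exp_nat_mul, Complex.exp_pi_mul_I]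
    have : ((-1 : ℂ) ^ m) * (-1) ^ m = 1 := by rw [← mul_pow]; simp
    have h1 : ((-1 : ℂ) ^ m) ≠ 0 := by simp
    field_simp
    linear_combination this
  rw [wave, wave, h]
  ring

lemma power_add_period {m : ℕ} (hm : 0 < m) (δ r x : ℝ) :
    power (dk m) δ r (x + 2 * Real.pi * m) = power (dk m) δ r x := by
  have hc : ((-1 : ℝ) ^ m) * (-1) ^ m = 1 := by rw [← mul_pow]; simp
  have h : x + 2 * Real.pi * m + δ = x + δ + 2 * Real.pi * m := by ring
  set c : ℝ := (-1 : ℝ) ^ m with hcdef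
  have hE : ∀ t, evenV (dk m) δ t 0 (x + 2 * Real.pi * m) = -c * evenV (dk m) δ t 0 x := by
    intro t
    simp only [evenV, evenW, evenU, h, dk_add_period hm, ← hcdef]
    ring
  have hO : ∀ t, oddV (dk m) δ t 0 (x + 2 * Real.pi * m) = -c * oddV (dk m) δ t 0 x := by
    intro t
    simp only [oddV, oddW, oddU, h, dk_add_period hm, ← hcdef]
    ring
  rw [power, power, hE, hO]
  linear_combination ((1 + r) / 2 * evenV (dk m) δ (kerT (dk m) δ r) 0 x ^ 2 +
    (1 - r) / 2 * oddV (dk m) δ (kerT (dk m) δ r) 0 x ^ 2) * hc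

/-! ### Well separated sources -/

section Separated

variable {δ r : ℕ → ℝ}

lemma tendsto_mul_zero_of_abs_le_one {α : Type*} {F : Filter α} {f g : α → ℝ}
    (hf : Tendsto f F (𝓝 0)) (hg : ∀ p, |g p| ≤ 1) : Tendsto (fun p => f p * g p) F (𝓝 0) := by
  refine squeeze_zero_norm (fun p => ?_) (tendsto_zero_iff_norm_tendsto_zero.1 hf)
  rw [norm_mul]
  exact mul_le_of_le_one_right (norm_nonneg _) (hg p)

lemma tendsto_pdist_of_separated (hδ : Tendsto δ atTop atTop)
    (hle : ∀ m, |δ m| ≤ Real.pi * m) : Tendsto (fun m => pdist m (δ m)) atTop atTop := by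
  have h : Tendsto (fun m => δ m / Real.pi) atTop atTop := hδ.atTop_div_const Real.pi_pos
  refine tendsto_atTop_mono' _ ?_ h
  filter_upwards [eventually_gt_atTop 0] with m hm
  refine le_trans ?_ (le_pdist hm (hle m))
  exact div_le_div_of_nonneg_right (le_abs_self _) Real.pi_pos.le

lemma tendsto_pdist_add (hδ : Tendsto (fun m => pdist m (δ m)) atTop atTop) (x₀ : ℝ) :
    Tendsto (fun p : ℕ × ℝ => pdist p.1 (p.2 + δ p.1)) (atTop ×ˢ 𝓝 x₀) atTop := by
  have h1 : Tendsto (fun p : ℕ × ℝ => pdist p.1 (δ p.1)) (atTop ×ˢ 𝓝 x₀) atTop :=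
    hδ.comp tendsto_fst
  have h2 : Tendsto (fun p : ℕ × ℝ => -|p.2|) (atTop ×ˢ 𝓝 x₀) (𝓝 (-|x₀|)) :=
    (tendsto_snd (f := atTop) (g := 𝓝 x₀)).abs.neg
  refine tendsto_atTop_mono' _ ?_ (h1.atTop_add h2)
  filter_upwards [tendsto_fst.eventually (eventually_gt_atTop 0)] with p hp
  have h3 := pdist_add_le (m := p.1) (p.2 + δ p.1) (-p.2)
  rw [pdist_neg, add_neg_cancel_comm] at h3
  linarith [pdist_le hp p.2]

/-- For well separated sources the kernel parameters converge. -/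
lemma separated_params (hδ : Tendsto (fun m => pdist m (δ m)) atTop atTop)
    (hr : ∀ m, |r m| ≤ 1) :
    Tendsto (fun m => kerK (dk m) (δ m) - kerL (dk m) (δ m) * r m) atTop (𝓝 (1 / 12)) ∧
    Tendsto (fun m => kerK (dk m) (δ m) + kerL (dk m) (δ m) * r m) atTop (𝓝 (1 / 12)) ∧
    Tendsto (fun m => kerT (dk m) (δ m) (r m)) atTop (𝓝 0) := by
  have hpos : ∀ᶠ m : ℕ in atTop, 0 < m := eventually_gt_atTop 0
  have hs := tendsto_dk_zero hpos hδ 0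
  have hs1 := tendsto_dk_zero hpos hδ 1
  have hs2 := tendsto_dk_zero hpos hδ 2
  have h0 := tendsto_dk (tendsto_id (α := ℕ) (x := atTop)) (tendsto_const_nhds (x := (0 : ℝ))) 2
  simp only [id] at h0
  have hK := tendsto_kerK h0 hs hs1 (by norm_num)
  have hL := tendsto_kerL hs2 hs hs1 (by norm_num)
  rw [lk_two_zero] at hK
  have hL0 : Tendsto (fun m => kerL (dk m) (δ m)) atTop (𝓝 0) := by simpa using hL
  have hLr := tendsto_mul_zero_of_abs_le_one hL0 hr
  have h1 : Tendsto (fun m => kerK (dk m) (δ m) - kerL (dk m) (δ m) * r m) atTop (𝓝 (1 / 12)) := by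
    simpa using hK.sub hLr
  refine ⟨h1, by simpa using hK.add hLr, ?_⟩
  have hc : Tendsto (fun m => dk m 1 (δ m) / (1 - dk m 0 (δ m) ^ 2)) atTop (𝓝 0) := by
    have := hs1.div (tendsto_const_nhds.sub (hs.pow 2)) (by norm_num : (1 : ℝ) - 0 ^ 2 ≠ 0)
    rwa [zero_div] at this
  have hnum : Tendsto (fun m => dk m 1 (δ m) / (1 - dk m 0 (δ m) ^ 2) * (dk m 0 (δ m) - r m))
      atTop (𝓝 0) := by
    have := (hc.mul hs).sub (tendsto_mul_zero_of_abs_le_one hc hr)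
    simp only [← mul_sub] at this
    simpa using this
  have := hnum.div h1 (by norm_num)
  rwa [zero_div] at this

/-- At bounded distance from the first source the second one is invisible: the shift vanishes and
both parts converge to `lk`. Away from 0 this gives `lk 0 x₀ ^ 2 < 1`; at 0 the criterion on the
second derivative is needed. -/
lemma eventually_separated_pointwise (hδ : Tendsto (fun m => pdist m (δ m)) atTop atTop)
    (hr : ∀ m, |r m| ≤ 1) (x₀ : ℝ) :
    ∀ᶠ p : ℕ × ℝ in atTop ×ˢ 𝓝 x₀, power (dk p.1) (δ p.1) (r p.1) p.2 ≤ 1 := by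
  have hpos : ∀ᶠ m : ℕ in atTop, 0 < m := eventually_gt_atTop 0
  have hs := tendsto_dk_zero hpos hδ 0
  obtain ⟨hk, -, ht⟩ := separated_params hδ hr
  have hposp : ∀ᶠ p : ℕ × ℝ in atTop ×ˢ 𝓝 x₀, 0 < p.1 := tendsto_fst.eventually hpos
  have hb := tendsto_dk_zero hposp (tendsto_pdist_add hδ x₀)
  have ha := tendsto_dk (tendsto_fst (f := atTop) (g := 𝓝 x₀))
    (tendsto_snd (f := (atTop : Filter ℕ)) (g := 𝓝 x₀))
  have hs' : Tendsto (fun p : ℕ × ℝ => dk p.1 0 (δ p.1)) (atTop ×ˢ 𝓝 x₀) (𝓝 0) :=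
    hs.comp tendsto_fst
  have hs1' : Tendsto (fun p : ℕ × ℝ => dk p.1 1 (δ p.1)) (atTop ×ˢ 𝓝 x₀) (𝓝 0) :=
    (tendsto_dk_zero hpos hδ 1).comp tendsto_fst
  have ht' : Tendsto (fun p : ℕ × ℝ => kerT (dk p.1) (δ p.1) (r p.1)) (atTop ×ˢ 𝓝 x₀) (𝓝 0) :=
    ht.comp tendsto_fst
  have hE : ∀ j, Tendsto (fun p : ℕ × ℝ => evenV (dk p.1) (δ p.1) (kerT (dk p.1) (δ p.1) (r p.1))
      j p.2) (atTop ×ˢ 𝓝 x₀) (𝓝 (lk j x₀)) := fun j => by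
    simpa using tendsto_evenV (D := fun p : ℕ × ℝ => dk p.1) (x := fun p : ℕ × ℝ => p.2)
      (ha j) (ha (j + 1)) (hb j) (hb (j + 1)) hs' hs1' ht' (by norm_num)
  have hO : ∀ j, Tendsto (fun p : ℕ × ℝ => oddV (dk p.1) (δ p.1) (kerT (dk p.1) (δ p.1) (r p.1))
      j p.2) (atTop ×ˢ 𝓝 x₀) (𝓝 (lk j x₀)) := fun j => by
    simpa using tendsto_oddV (D := fun p : ℕ × ℝ => dk p.1) (x := fun p : ℕ × ℝ => p.2)
      (ha j) (ha (j + 1)) (hb j) (hb (j + 1)) hs' hs1' ht' (by norm_num)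
  by_cases hx : x₀ = 0
  · subst hx
    refine eventually_power_le_one_near (hpos.mono fun m hm => isKernel_dk hm.ne') ?_
      (hk.eventually_ne (by norm_num)) ?_
    · exact (tendsto_const_nhds.sub (hs.pow 2)).eventually_ne (by norm_num)
    · have hneg : lk 1 0 ^ 2 + lk 0 0 * lk 2 0 < 0 := by
        rw [isKernel_lk.one, isKernel_lk.one_zero, lk_two_zero]
        norm_num
      have e1 := (((hE 1).pow 2).add ((hE 0).mul (hE 2))).eventually_lt_const hneg
      have e2 := (((hO 1).pow 2).add ((hO 0).mul (hO 2))).eventually_lt_const hneg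
      filter_upwards [e1, e2] with p h1 h2
      have := abs_le.1 (hr p.1)
      rw [power2]
      nlinarith
  · have hlt : lk 0 x₀ ^ 2 < 1 := by linarith [one_sub_lk_zero_sq_pos hx]
    filter_upwards [((hE 0).pow 2).eventually_lt_const hlt,
      ((hO 0).pow 2).eventually_lt_const hlt] with p h1 h2
    exact power_le_one_of_sq_le (hr p.1) h1.le h2.le

/-- Well separated sources pass the test. -/
lemma eventually_separated (hδ : Tendsto δ atTop atTop) (hle : ∀ m, |δ m| ≤ Real.pi * m)
    (hr : ∀ m, |r m| ≤ 1) :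
    ∀ᶠ m : ℕ in atTop, ∀ x, |x| ≤ Real.pi * m → power (dk m) (δ m) (r m) x ≤ 1 := by
  have hpd := tendsto_pdist_of_separated hδ hle
  have hpos : ∀ᶠ m : ℕ in atTop, 0 < m := eventually_gt_atTop 0
  have hs := tendsto_dk_zero hpos hpd 0
  have hs1 := tendsto_dk_zero hpos hpd 1
  obtain ⟨-, -, ht⟩ := separated_params hpd hr
  obtain ⟨ε, hε, hfar⟩ := exists_far_bound (c := 1 / 2) (σ := 1) (τ := 1) (by norm_num)
    zero_le_one zero_le_one
  have hcpt := eventually_forall_Icc (P := fun m x => power (dk m) (δ m) (r m) x ≤ 1)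
    (C := Real.pi * (2 / ε)) (eventually_separated_pointwise hpd hr)
  have habs : ∀ {f : ℕ → ℝ}, Tendsto f atTop (𝓝 0) → ∀ c : ℝ, 0 < c →
      ∀ᶠ m in atTop, |f m| < c := fun {f} hf c hc => by
    have := hf.abs
    rw [abs_zero] at this
    exact this.eventually_lt_const hc
  filter_upwards [hpos, hcpt, habs hs (1 / 2) (by norm_num), habs hs1 1 one_pos,
    habs ht 1 one_pos, hpd.eventually_ge_atTop (2 * (2 / ε))] with m hm hcm hsm hs1m htm hdm
  have hmR : (0 : ℝ) < m := by exact_mod_cast hm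
  have hsm' := abs_lt.1 hsm
  have hp : 1 / 2 ≤ |1 + dk m 0 (δ m)| := le_trans (by linarith) (le_abs_self _)
  have hmn : 1 / 2 ≤ |1 - dk m 0 (δ m)| := le_trans (by linarith) (le_abs_self _)
  -- For a point at least as close to the first source as to the second, either it lies in a fixed
  -- compact interval or both sources are far.
  have claim : ∀ x, |x| ≤ Real.pi * m → pdist m x ≤ pdist m (x + δ m) →
      power (dk m) (δ m) (r m) x ≤ 1 := by
    intro x hx hd
    by_cases hxC : |x| ≤ Real.pi * (2 / ε)
    · exact hcm x hxC
    · have h1 : 2 / ε ≤ pdist m x := by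
        refine le_trans ?_ (le_pdist hm hx)
        rw [le_div_iff₀ Real.pi_pos]
        linarith
      have h2 : 2 / ε ≤ pdist m (x + δ m) := h1.trans hd
      exact hfar (dk m) (δ m) (r m) x (hr m) hp hmn hs1m.le htm.le
        (abs_dk_le_of_le_pdist hm zero_le_one hε h1) (abs_dk_le_of_le_pdist hm le_rfl hε h1)
        (abs_dk_le_of_le_pdist hm zero_le_one hε h2) (abs_dk_le_of_le_pdist hm le_rfl hε h2)
  intro x hx
  rcases le_total (pdist m x) (pdist m (x + δ m)) with h | h
  · exact claim x hx h
  · have hD := isKernel_dk hm.ne'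
    rw [← hD.power_reflect]
    have hy : pdist m (-δ m - x) ≤ pdist m (-δ m - x + δ m) := by
      have e1 : -δ m - x = -(x + δ m) := by ring
      have e2 : -δ m - x + δ m = -x := by ring
      rw [e2, e1, pdist_neg, pdist_neg]
      exact h
    generalize hyd : -δ m - x = y at hy
    have hya : |y| ≤ 2 * (Real.pi * m) := by
      rw [← hyd]
      refine (abs_sub _ _).trans ?_
      rw [abs_neg]
      linarith [hle m]
    -- The reflected point satisfies `|y| ≤ 2πm`, so it may leave the interval where `claim`
    -- applies; one shift by the period `2πm` brings it back.
    rcases lt_trichotomy (Real.pi * m) |y| with hlt | heq | hgt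
    · have hpm : 0 < Real.pi * m := mul_pos Real.pi_pos hmR
      rcases le_total 0 y with hy0 | hy0
      · rw [abs_of_nonneg hy0] at hlt hya
        have e : y = (y - 2 * Real.pi * m) + 2 * Real.pi * m := by ring
        have e' : y + δ m = (y - 2 * Real.pi * m + δ m) + 2 * Real.pi * m := by ring
        rw [e', e, pdist_add_period hm, sub_add_cancel, pdist_add_period hm] at hy
        rw [e, power_add_period hm]
        exact claim _ (abs_le.2 ⟨by linarith, by linarith⟩) hy
      · rw [abs_of_nonpos hy0] at hlt hya
        rw [← power_add_period hm]
        refine claim _ (abs_le.2 ⟨by linarith, by linarith⟩) ?_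
        have e' : y + 2 * Real.pi * m + δ m = (y + δ m) + 2 * Real.pi * m := by ring
        rwa [e', pdist_add_period hm, pdist_add_period hm]
    · exact claim y heq.ge hy
    · exact claim y hgt.le hy

end Separated

/-! ### Sources at a fixed scaled distance -/

/-- If the limit power is below one away from the sources and has a nondegenerate maximum at the
first one, then the array power is eventually at most one. -/
lemma eventually_of_limit {δ r : ℕ → ℝ} {δ₀ r₀ : ℝ} (hδ₀ : δ₀ ≠ 0)
    (hδ : Tendsto δ atTop (𝓝 δ₀)) (hr : Tendsto r atTop (𝓝 r₀)) (hr1 : ∀ m, |r m| ≤ 1)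
    (hk : kerK lk δ₀ - kerL lk δ₀ * r₀ ≠ 0)
    (hlt : ∀ x, x ≠ 0 → x ≠ -δ₀ → power lk δ₀ r₀ x < 1) (h2 : power2 lk δ₀ r₀ 0 < 0) :
    ∀ᶠ m : ℕ in atTop, ∀ x, |x| ≤ Real.pi * m → power (dk m) (δ m) (r m) x ≤ 1 := by
  have hpos : ∀ᶠ m : ℕ in atTop, 0 < m := eventually_gt_atTop 0
  have hne := (one_sub_lk_zero_sq_pos hδ₀).ne'
  have hid := tendsto_id (α := ℕ) (x := atTop)
  have hs : ∀ j, Tendsto (fun m => dk m j (δ m)) atTop (𝓝 (lk j δ₀)) := tendsto_dk hid hδ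
  have hσ : Tendsto (fun m => dk m 2 0) atTop (𝓝 (lk 2 0)) := tendsto_dk hid tendsto_const_nhds 2
  have hK : Tendsto (fun m => kerK (dk m) (δ m)) atTop (𝓝 (kerK lk δ₀)) :=
    tendsto_kerK hσ (hs 0) (hs 1) hne
  have hL : Tendsto (fun m => kerL (dk m) (δ m)) atTop (𝓝 (kerL lk δ₀)) :=
    tendsto_kerL (hs 2) (hs 0) (hs 1) hne
  have hkm := hK.sub (hL.mul hr)
  have ht : Tendsto (fun m => kerT (dk m) (δ m) (r m)) atTop (𝓝 (kerT lk δ₀ r₀)) :=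
    (((hs 1).div (tendsto_const_nhds.sub ((hs 0).pow 2)) hne).mul ((hs 0).sub hr)).div hkm hk
  have hEO : ∀ x₀ j, Tendsto (fun p : ℕ × ℝ => evenV (dk p.1) (δ p.1)
        (kerT (dk p.1) (δ p.1) (r p.1)) j p.2) (atTop ×ˢ 𝓝 x₀)
        (𝓝 (evenV lk δ₀ (kerT lk δ₀ r₀) j x₀)) ∧
      Tendsto (fun p : ℕ × ℝ => oddV (dk p.1) (δ p.1)
        (kerT (dk p.1) (δ p.1) (r p.1)) j p.2) (atTop ×ˢ 𝓝 x₀)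
        (𝓝 (oddV lk δ₀ (kerT lk δ₀ r₀) j x₀)) := by
    intro x₀ j
    have ha := tendsto_dk (tendsto_fst (f := atTop) (g := 𝓝 x₀))
      (tendsto_snd (f := (atTop : Filter ℕ)) (g := 𝓝 x₀))
    have hb := tendsto_dk (tendsto_fst (f := atTop) (g := 𝓝 x₀))
      ((tendsto_snd (f := (atTop : Filter ℕ)) (g := 𝓝 x₀)).add (hδ.comp tendsto_fst))
    exact ⟨tendsto_evenV (D := fun p : ℕ × ℝ => dk p.1) (x := fun p : ℕ × ℝ => p.2)
      (ha j) (ha (j + 1)) (hb j) (hb (j + 1)) ((hs 0).comp tendsto_fst)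
      ((hs 1).comp tendsto_fst) (ht.comp tendsto_fst) (one_add_ne_zero_of hne),
      tendsto_oddV (D := fun p : ℕ × ℝ => dk p.1) (x := fun p : ℕ × ℝ => p.2)
      (ha j) (ha (j + 1)) (hb j) (hb (j + 1)) ((hs 0).comp tendsto_fst)
      ((hs 1).comp tendsto_fst) (ht.comp tendsto_fst) (one_sub_ne_zero_of hne)⟩
  have hrp : ∀ x₀ : ℝ, Tendsto (fun p : ℕ × ℝ => r p.1) (atTop ×ˢ 𝓝 x₀) (𝓝 r₀) :=
    fun x₀ => hr.comp tendsto_fst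
  have hnear : ∀ᶠ p : ℕ × ℝ in atTop ×ˢ 𝓝 0, power (dk p.1) (δ p.1) (r p.1) p.2 ≤ 1 := by
    refine eventually_power_le_one_near (hpos.mono fun m hm => isKernel_dk hm.ne') ?_
      (hkm.eventually_ne hk) ?_
    · exact (tendsto_const_nhds.sub ((hs 0).pow 2)).eventually_ne hne
    · have hE := fun j => (hEO 0 j).1
      have hO := fun j => (hEO 0 j).2
      have hp2 : Tendsto (fun p : ℕ × ℝ => power2 (dk p.1) (δ p.1) (r p.1) p.2) (atTop ×ˢ 𝓝 0)
          (𝓝 (power2 lk δ₀ r₀ 0)) :=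
        ((tendsto_const_nhds.add (hrp 0)).mul (((hE 1).pow 2).add ((hE 0).mul (hE 2)))).add
          ((tendsto_const_nhds.sub (hrp 0)).mul (((hO 1).pow 2).add ((hO 0).mul (hO 2))))
      exact (hp2.eventually_lt_const h2).mono fun p hp => hp.le
  have hpt : ∀ x₀, ∀ᶠ p : ℕ × ℝ in atTop ×ˢ 𝓝 x₀, power (dk p.1) (δ p.1) (r p.1) p.2 ≤ 1 := by
    intro x₀
    by_cases h0 : x₀ = 0
    · rwa [h0]
    by_cases h1 : x₀ = -δ₀
    -- Near the second source, reflection at the current separation `δ m` carries the problem to the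
    -- first source.
    · have hmap : Tendsto (fun p : ℕ × ℝ => (p.1, -δ p.1 - p.2)) (atTop ×ˢ 𝓝 x₀)
          (atTop ×ˢ 𝓝 0) := by
        refine tendsto_fst.prodMk ?_
        have : Tendsto (fun p : ℕ × ℝ => -δ p.1 - p.2) (atTop ×ˢ 𝓝 x₀) (𝓝 (-δ₀ - x₀)) :=
          (hδ.comp tendsto_fst).neg.sub tendsto_snd
        rwa [h1, sub_self, ← h1] at this
      filter_upwards [hmap.eventually hnear, tendsto_fst.eventually hpos] with p hp hm
      rwa [(isKernel_dk (Nat.pos_iff_ne_zero.1 hm)).power_reflect] at hp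
    · have hp : Tendsto (fun p : ℕ × ℝ => power (dk p.1) (δ p.1) (r p.1) p.2) (atTop ×ˢ 𝓝 x₀)
          (𝓝 (power lk δ₀ r₀ x₀)) :=
        (((tendsto_const_nhds.add (hrp x₀)).div_const 2).mul ((hEO x₀ 0).1.pow 2)).add
          (((tendsto_const_nhds.sub (hrp x₀)).div_const 2).mul ((hEO x₀ 0).2.pow 2))
      exact (hp.eventually_lt_const (hlt x₀ h0 h1)).mono fun p hp => hp.le
  set c := min |1 + lk 0 δ₀| |1 - lk 0 δ₀| / 2 with hc
  have hp0 : 0 < |1 + lk 0 δ₀| := abs_pos.2 (one_add_ne_zero_of hne)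
  have hm0 : 0 < |1 - lk 0 δ₀| := abs_pos.2 (one_sub_ne_zero_of hne)
  have hmin : 0 < min |1 + lk 0 δ₀| |1 - lk 0 δ₀| := lt_min hp0 hm0
  have hcpos : 0 < c := by positivity
  have hc1 : c < |1 + lk 0 δ₀| := by linarith [min_le_left |1 + lk 0 δ₀| |1 - lk 0 δ₀|]
  have hc2 : c < |1 - lk 0 δ₀| := by linarith [min_le_right |1 + lk 0 δ₀| |1 - lk 0 δ₀|]
  obtain ⟨ε, hε, hfar⟩ := exists_far_bound (c := c) (σ := |lk 1 δ₀| + 1)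
    (τ := |kerT lk δ₀ r₀| + 1) hcpos (by positivity) (by positivity)
  -- The radius leaves room for the second source: outside it `pdist m x ≥ 2/ε + |δ₀| + 1`, and
  -- moving by `δ m` costs less than `|δ₀| + 1`.
  have hcpt := eventually_forall_Icc (P := fun m x => power (dk m) (δ m) (r m) x ≤ 1)
    (C := Real.pi * (2 / ε + |δ₀| + 1)) hpt
  filter_upwards [hpos, hcpt, (tendsto_const_nhds.add (hs 0)).abs.eventually_const_lt hc1,
    (tendsto_const_nhds.sub (hs 0)).abs.eventually_const_lt hc2,
    (hs 1).abs.eventually_lt_const (lt_add_one |lk 1 δ₀|),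
    ht.abs.eventually_lt_const (lt_add_one |kerT lk δ₀ r₀|),
    hδ.abs.eventually_lt_const (lt_add_one |δ₀|)] with m hm hcm h1 h2 h3 h4 h5 x hx
  by_cases hxC : |x| ≤ Real.pi * (2 / ε + |δ₀| + 1)
  · exact hcm x hxC
  · have hd1 : 2 / ε + |δ₀| + 1 ≤ pdist m x := by
      refine le_trans ?_ (le_pdist hm hx)
      rw [le_div_iff₀ Real.pi_pos]
      linarith
    have hd2 : 2 / ε ≤ pdist m (x + δ m) := by
      have h6 := pdist_add_le (m := m) (x + δ m) (-δ m)
      rw [pdist_neg, add_neg_cancel_right] at h6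
      linarith [pdist_le hm (δ m)]
    have hd1' : 2 / ε ≤ pdist m x := by linarith [abs_nonneg δ₀]
    exact hfar (dk m) (δ m) (r m) x (hr1 m) h1.le h2.le h3.le h4.le
      (abs_dk_le_of_le_pdist hm zero_le_one hε hd1') (abs_dk_le_of_le_pdist hm le_rfl hε hd1')
      (abs_dk_le_of_le_pdist hm zero_le_one hε hd2) (abs_dk_le_of_le_pdist hm le_rfl hε hd2)

/-! ### Coalescing sources -/

lemma exists_mean_value {f f' : ℝ → ℝ} (hf : ∀ x, HasDerivAt f (f' x) x) {a b : ℝ} (hab : a ≠ b) :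
    ∃ ξ, ξ ≠ a ∧ |ξ - a| ≤ |b - a| ∧ f b - f a = f' ξ * (b - a) := by
  have hc : Continuous f := continuous_iff_continuousAt.2 fun x => (hf x).continuousAt
  rcases lt_or_gt_of_ne hab with h | h
  · obtain ⟨ξ, hξ, e⟩ := exists_hasDerivAt_eq_slope f f' h hc.continuousOn fun x _ => hf x
    refine ⟨ξ, hξ.1.ne', ?_, ?_⟩
    · rw [abs_of_pos (by linarith [hξ.1]), abs_of_pos (by linarith)]
      linarith [hξ.2]
    · rw [e, div_mul_cancel₀ _ (by linarith)]
  · obtain ⟨ξ, hξ, e⟩ := exists_hasDerivAt_eq_slope f f' h hc.continuousOn fun x _ => hf x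
    refine ⟨ξ, hξ.2.ne, ?_, ?_⟩
    · rw [abs_of_neg (by linarith [hξ.2]), abs_of_neg (by linarith)]
      linarith [hξ.1]
    · rw [eq_div_iff (by linarith)] at e
      linarith

/-- Taylor's formula with Lagrange remainder: with `A` the quotient, `f x - A x²` takes equal values
at 0 and `e`, so its derivative vanishes at some `ξ` between them; a second application on `[0, ξ]`
uses `f' 0 = 0`. -/
lemma exists_second_order {f f' f'' : ℝ → ℝ} (hf : ∀ x, HasDerivAt f (f' x) x)
    (hf' : ∀ x, HasDerivAt f' (f'' x) x) (h0 : f' 0 = 0) {e : ℝ} (he : e ≠ 0) :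
    ∃ ζ, |ζ| ≤ |e| ∧ (f e - f 0) / e ^ 2 = f'' ζ / 2 := by
  set A := (f e - f 0) / e ^ 2 with hA
  have hg : ∀ x, HasDerivAt (fun x => f x - A * x ^ 2) (f' x - 2 * A * x) x := fun x => by
    refine ((hf x).fun_sub ((hasDerivAt_pow 2 x).const_mul A)).congr_deriv ?_
    push_cast
    ring
  have hg' : ∀ x, HasDerivAt (fun x => f' x - 2 * A * x) (f'' x - 2 * A) x := fun x => by
    refine ((hf' x).fun_sub ((hasDerivAt_id x).const_mul (2 * A))).congr_deriv ?_
    ring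
  obtain ⟨ξ, hξ0, hξ, e1⟩ := exists_mean_value hg he.symm
  have e2 : f' ξ - 2 * A * ξ = 0 := by
    have : f e - A * e ^ 2 - (f 0 - A * 0 ^ 2) = 0 := by
      rw [hA]
      field_simp
      ring
    rw [this, sub_zero] at e1
    exact (mul_eq_zero.1 e1.symm).resolve_right he
  obtain ⟨ζ, -, hζ, e3⟩ := exists_mean_value hg' hξ0.symm
  rw [e2, h0, sub_zero, sub_zero] at *
  refine ⟨ζ, ?_, ?_⟩
  · exact hζ.trans hξ
  · have : (f'' ζ - 2 * A) * ξ = 0 := by linarith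
    have := (mul_eq_zero.1 this).resolve_right hξ0
    linarith

section Coalescing

variable {δ r : ℕ → ℝ}

lemma tendsto_of_abs_sub_le {f : ℕ → ℝ} {a : ℝ} (hδ : Tendsto δ atTop (𝓝 0))
    (h : ∀ᶠ m in atTop, |f m - a| ≤ |δ m|) : Tendsto f atTop (𝓝 a) := by
  rw [tendsto_iff_norm_sub_tendsto_zero]
  have h0 : Tendsto (fun m => |δ m|) atTop (𝓝 0) := by simpa using hδ.abs
  exact squeeze_zero' (Eventually.of_forall fun m => norm_nonneg _) h h0

/-- The kernel changes with `m`, so the quotient is replaced by a derivative at an intermediate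
point tending to `x`, where continuous convergence (`tendsto_dk`) applies. -/
lemma tendsto_first_quotient (hδ : Tendsto δ atTop (𝓝 0)) (h0 : ∀ᶠ m in atTop, δ m ≠ 0) (j : ℕ)
    (x : ℝ) : Tendsto (fun m => (dk m j (x + δ m) - dk m j x) / δ m) atTop (𝓝 (lk (j + 1) x)) := by
  have h : ∀ m, ∃ ξ, 0 < m → δ m ≠ 0 → |ξ - x| ≤ |δ m| ∧
      (dk m j (x + δ m) - dk m j x) / δ m = dk m (j + 1) ξ := by
    intro m
    by_cases hm : 0 < m ∧ δ m ≠ 0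
    · obtain ⟨ξ, -, h1, h2⟩ := exists_mean_value ((isKernel_dk hm.1.ne').hasDerivAt j)
        (a := x) (b := x + δ m) (by simpa using hm.2)
      refine ⟨ξ, fun _ _ => ⟨by simpa using h1, ?_⟩⟩
      rw [h2, add_sub_cancel_left, mul_div_cancel_right₀ _ hm.2]
    · exact ⟨0, fun h1 h2 => (hm ⟨h1, h2⟩).elim⟩
  choose ξ hξ using h
  have hev : ∀ᶠ m : ℕ in atTop, 0 < m ∧ δ m ≠ 0 := (eventually_gt_atTop 0).and h0
  have hx : Tendsto ξ atTop (𝓝 x) :=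
    tendsto_of_abs_sub_le hδ (hev.mono fun m hm => (hξ m hm.1 hm.2).1)
  refine (tendsto_dk tendsto_id hx (j + 1)).congr' ?_
  filter_upwards [hev] with m hm
  exact (hξ m hm.1 hm.2).2.symm

lemma tendsto_second_quotient (hδ : Tendsto δ atTop (𝓝 0)) (h0 : ∀ᶠ m in atTop, δ m ≠ 0) {j : ℕ}
    (hj : Even j) :
    Tendsto (fun m => (dk m j (δ m) - dk m j 0) / δ m ^ 2) atTop (𝓝 (lk (j + 2) 0 / 2)) := by
  have hz : ∀ m, dk m (j + 1) 0 = 0 := fun m => by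
    have := dk_neg m (j + 1) 0
    rw [neg_zero, hj.add_one.neg_one_pow] at this
    linarith
  have h : ∀ m, ∃ ξ, 0 < m → δ m ≠ 0 → |ξ - 0| ≤ |δ m| ∧
      (dk m j (δ m) - dk m j 0) / δ m ^ 2 = dk m (j + 2) ξ / 2 := by
    intro m
    by_cases hm : 0 < m ∧ δ m ≠ 0
    · obtain ⟨ξ, h1, h2⟩ := exists_second_order ((isKernel_dk hm.1.ne').hasDerivAt j)
        ((isKernel_dk hm.1.ne').hasDerivAt (j + 1)) (hz m) hm.2
      exact ⟨ξ, fun _ _ => ⟨by simpa using h1, h2⟩⟩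
    · exact ⟨0, fun h1 h2 => (hm ⟨h1, h2⟩).elim⟩
  choose ξ hξ using h
  have hev : ∀ᶠ m : ℕ in atTop, 0 < m ∧ δ m ≠ 0 := (eventually_gt_atTop 0).and h0
  have hx : Tendsto ξ atTop (𝓝 0) :=
    tendsto_of_abs_sub_le hδ (hev.mono fun m hm => (hξ m hm.1 hm.2).1)
  refine ((tendsto_dk tendsto_id hx (j + 2)).div_const 2).congr' ?_
  filter_upwards [hev] with m hm
  exact (hξ m hm.1 hm.2).2.symm

lemma wave_zero_re (u x : ℝ) : (wave 0 u x).re = Real.cos (u * x) := by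
  have : I * (u : ℂ) * x = ((u * x : ℝ) : ℂ) * I := by push_cast; ring
  rw [wave, this, pow_zero, one_mul, exp_ofReal_mul_I_re]

lemma wave_one_re (u x : ℝ) : (wave 1 u x).re = -(u * Real.sin (u * x)) := by
  have : I * (u : ℂ) * x = ((u * x : ℝ) : ℂ) * I := by push_cast; ring
  rw [wave, this, pow_one, mul_comm I, mul_assoc, Complex.re_ofReal_mul, Complex.I_mul_re,
    exp_ofReal_mul_I_im]
  ring

lemma wave_two_re (u x : ℝ) : (wave 2 u x).re = -(u ^ 2 * Real.cos (u * x)) := by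
  have : I * (u : ℂ) * x = ((u * x : ℝ) : ℂ) * I := by push_cast; ring
  have h2 : (I * (u : ℂ)) ^ 2 = ((-u ^ 2 : ℝ) : ℂ) := by
    push_cast
    rw [mul_pow, I_sq]
    ring
  rw [wave, this, h2, Complex.re_ofReal_mul, exp_ofReal_mul_I_re]
  ring

lemma dk_eq_sum (m j : ℕ) (x : ℝ) :
    dk m j x = (∑ k ∈ Finset.range m, (wave j (pos m k) x).re) / m := by
  rw [dk, dkC, Complex.div_natCast_re, Complex.re_sum]

/-- By half-angle formulas the three quantities are the inner product and squared norms of `sin (u x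
/ 2)` and `u cos (u x / 2)` over the sensor positions, up to sign and scaling. It yields `kerK +
kerL ≥ 0`. -/
lemma dk_cauchy_schwarz (m : ℕ) (x : ℝ) :
    dk m 1 x ^ 2 ≤ (dk m 0 0 - dk m 0 x) * (-dk m 2 0 - dk m 2 x) := by
  have h := Finset.sum_mul_sq_le_sq_mul_sq (Finset.range m)
    (fun k => Real.sin (pos m k * x / 2)) (fun k => pos m k * Real.cos (pos m k * x / 2))
  have e0 : dk m 0 0 - dk m 0 x =
      (∑ k ∈ Finset.range m, Real.sin (pos m k * x / 2) ^ 2) * (2 / m) := by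
    rw [dk_eq_sum, dk_eq_sum, ← sub_div, ← Finset.sum_sub_distrib, mul_div_assoc',
      Finset.sum_mul]
    congr 1
    refine Finset.sum_congr rfl fun k _ => ?_
    rw [wave_zero_re, wave_zero_re, mul_zero, Real.cos_zero, Real.sin_sq_eq_half_sub]
    ring_nf
  have e1 : dk m 1 x = -(∑ k ∈ Finset.range m, Real.sin (pos m k * x / 2) *
      (pos m k * Real.cos (pos m k * x / 2))) * (2 / m) := by
    rw [dk_eq_sum, mul_div_assoc', neg_mul, Finset.sum_mul, ← Finset.sum_neg_distrib]
    congr 1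
    refine Finset.sum_congr rfl fun k _ => ?_
    have : pos m k * x = 2 * (pos m k * x / 2) := by ring
    rw [wave_one_re, this, Real.sin_two_mul]
    ring_nf
  have e2 : -dk m 2 0 - dk m 2 x = (∑ k ∈ Finset.range m,
      (pos m k * Real.cos (pos m k * x / 2)) ^ 2) * (2 / m) := by
    rw [dk_eq_sum, dk_eq_sum, ← neg_div, ← sub_div, ← Finset.sum_neg_distrib,
      ← Finset.sum_sub_distrib, mul_div_assoc', Finset.sum_mul]
    congr 1
    refine Finset.sum_congr rfl fun k _ => ?_
    rw [wave_two_re, wave_two_re, mul_zero, Real.cos_zero, mul_pow, Real.cos_sq]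
    ring_nf
  rw [e0, e1, e2, mul_pow, neg_sq]
  calc _ ≤ _ := mul_le_mul_of_nonneg_right h (sq_nonneg (2 / (m : ℝ)))
    _ = _ := by ring

/-- Otherwise two differentiations at 0 would give `lk 4 0 = -lk 2 0 / 12 = 1/144`, whereas the
value is `1/80`. -/
lemma exists_lk_ne : ∃ x, lk 2 x + 1 / 12 * lk 0 x ≠ 0 := by
  by_contra! h
  have hd : ∀ j, (∀ x, lk (j + 2) x + 1 / 12 * lk j x = 0) →
      ∀ x, lk (j + 3) x + 1 / 12 * lk (j + 1) x = 0 := by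
    intro j hj x
    have h1 := (isKernel_lk.hasDerivAt (j + 2) x).fun_add
      ((isKernel_lk.hasDerivAt j x).const_mul (1 / 12 : ℝ))
    simp only [hj] at h1
    exact h1.unique (hasDerivAt_const x 0)
  have := hd 1 (hd 0 h) 0
  simp only [Nat.reduceAdd] at this
  rw [lk_four_zero, lk_two_zero] at this
  norm_num at this

/-- Coalescing sources: the test is well defined and fails. -/
lemma eventually_coalescing {r₀ : ℝ} (hδ : Tendsto δ atTop (𝓝 0)) (h0 : ∀ᶠ m in atTop, δ m ≠ 0)
    (hr : Tendsto r atTop (𝓝 r₀)) (hr0 : |r₀| < 1) :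
    ∃ x, ∀ᶠ m in atTop, 1 - dk m 0 (δ m) ^ 2 ≠ 0 ∧
      kerK (dk m) (δ m) - kerL (dk m) (δ m) * r m ≠ 0 ∧
      kerK (dk m) (δ m) + kerL (dk m) (δ m) * r m ≠ 0 ∧ 1 < power (dk m) (δ m) (r m) x := by
  obtain ⟨x, hx⟩ := exists_lk_ne
  refine ⟨x, ?_⟩
  have hpos : ∀ᶠ m : ℕ in atTop, 0 < m := eventually_gt_atTop 0
  have hs : Tendsto (fun m => dk m 0 (δ m)) atTop (𝓝 1) := by
    have := tendsto_dk tendsto_id hδ 0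
    rwa [isKernel_lk.one] at this
  have hs2 : Tendsto (fun m => dk m 2 (δ m)) atTop (𝓝 (-(1 / 12))) := by
    have := tendsto_dk tendsto_id hδ 2
    rwa [lk_two_zero] at this
  have hσ : Tendsto (fun m => dk m 2 0) atTop (𝓝 (-(1 / 12))) := by
    have := tendsto_dk (tendsto_id (α := ℕ) (x := atTop)) (tendsto_const_nhds (x := (0 : ℝ))) 2
    rwa [lk_two_zero] at this
  have hq1 : Tendsto (fun m => dk m 1 (δ m) / δ m) atTop (𝓝 (-(1 / 12))) := by
    have := tendsto_first_quotient hδ h0 1 0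
    rw [lk_two_zero] at this
    refine this.congr' (hpos.mono fun m hm => ?_)
    rw [(isKernel_dk hm.ne').one_zero, zero_add, sub_zero]
  have hq0 : Tendsto (fun m => (1 - dk m 0 (δ m) ^ 2) / δ m ^ 2) atTop (𝓝 (1 / 12)) := by
    have := (tendsto_second_quotient hδ h0 (j := 0) (by simp)).neg.mul (hs.const_add 1)
    rw [zero_add, lk_two_zero, show -(-(1 / 12 : ℝ) / 2) * (1 + 1) = 1 / 12 by norm_num] at this
    refine this.congr' (hpos.mono fun m hm => ?_)
    simp only
    rw [(isKernel_dk hm.ne').one]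
    ring
  have hq2 : Tendsto (fun m => (dk m 2 (δ m) - dk m 2 0) / δ m ^ 2) atTop (𝓝 (1 / 160)) := by
    have := tendsto_second_quotient hδ h0 (j := 2) (by simp)
    rw [show 2 + 2 = 4 from rfl, lk_four_zero] at this
    convert this using 2
    norm_num
  have hne := hq0.eventually_ne (by norm_num : (1 / 12 : ℝ) ≠ 0)
  have hne' : ∀ᶠ m in atTop, 1 - dk m 0 (δ m) ^ 2 ≠ 0 := hne.mono fun m hm h => hm (by rw [h, zero_div])
  have hquot : Tendsto (fun m => dk m 1 (δ m) ^ 2 / (1 - dk m 0 (δ m) ^ 2)) atTop (𝓝 (1 / 12)) := by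
    have := (hq1.pow 2).div hq0 (by norm_num)
    rw [show (-(1 / 12 : ℝ)) ^ 2 / (1 / 12) = 1 / 12 by norm_num] at this
    refine this.congr' ?_
    filter_upwards [h0, hne'] with m hm hm'
    simp only [Pi.div_apply]
    field_simp
  have hK : Tendsto (fun m => kerK (dk m) (δ m)) atTop (𝓝 0) := by
    have := hσ.neg.sub hquot
    rwa [show -(-(1 / 12 : ℝ)) - 1 / 12 = 0 by norm_num] at this
  have hL : Tendsto (fun m => kerL (dk m) (δ m)) atTop (𝓝 0) := by
    have := hs2.neg.sub (hs.mul hquot)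
    rw [show -(-(1 / 12 : ℝ)) - 1 * (1 / 12) = 0 by norm_num] at this
    refine this.congr fun m => ?_
    rw [kerL, mul_div_assoc]
  have hkr : Tendsto (fun m => kerK (dk m) (δ m) - kerL (dk m) (δ m) * r m) atTop (𝓝 0) := by
    simpa using hK.sub (hL.mul hr)
  -- After division by `δ²` the limit is `1/160 - (1/144)/2 > 0`.
  have hkl : ∀ᶠ m in atTop, 0 < kerK (dk m) (δ m) - kerL (dk m) (δ m) := by
    have := hq2.sub ((hq1.pow 2).div (hs.const_add 1) (by norm_num))
    have h3 := this.eventually_const_lt (by norm_num : (0 : ℝ) < _)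
    filter_upwards [h3, h0, hne'] with m hm hm0 hm1
    rw [kerK_sub_kerL hm1]
    have h4 : 0 < δ m ^ 2 := by positivity
    have h5 := mul_pos hm h4
    simp only [Pi.div_apply] at h5
    refine lt_of_lt_of_eq h5 ?_
    have := one_add_ne_zero_of hm1
    field_simp
    ring
  -- Here Cauchy–Schwarz replaces an expansion. Nonnegativity is enough, because for `|r| < 1` the
  -- two factors `k ± l r` are combinations of `k + l` and `k - l` with positive weights.
  have hkl' : ∀ᶠ m in atTop, 0 ≤ kerK (dk m) (δ m) + kerL (dk m) (δ m) := by
    have h1 : ∀ᶠ m in atTop, 0 < (1 - dk m 0 (δ m) ^ 2) / δ m ^ 2 :=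
      hq0.eventually_const_lt (by norm_num)
    filter_upwards [h1, h0, hne', hs.eventually_const_lt (by norm_num : (0 : ℝ) < 1), hpos]
      with m hm hm0 hm1 hm2 hm3
    have h4 : 0 < δ m ^ 2 := by positivity
    have h5 : 0 < 1 - dk m 0 (δ m) ^ 2 := by
      rcases div_pos_iff.1 hm with h | h
      · exact h.1
      · linarith [h.2]
    have h6 : 0 < 1 - dk m 0 (δ m) := by nlinarith
    rw [kerK_add_kerL hm1, sub_nonneg, div_le_iff₀ h6, mul_comm]
    have := dk_cauchy_schwarz m (δ m)
    rwa [(isKernel_dk hm3.ne').one] at this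
  rw [abs_lt] at hr0
  have hgap : ∀ᶠ m in atTop, |r m| < 1 :=
    (hr.abs).eventually_lt_const (abs_lt.2 hr0)
  have hU : Tendsto (fun m => evenU (dk m) (δ m) 0 x) atTop (𝓝 (lk 0 x)) := by
    have h1 := tendsto_dk (tendsto_id (α := ℕ) (x := atTop)) (tendsto_const_nhds (x := x)) 0
    have h2 : Tendsto (fun m => dk m 0 (x + δ m)) atTop (𝓝 (lk 0 (x + 0))) :=
      tendsto_dk tendsto_id (hδ.const_add x) 0
    have := (h1.add h2).div (hs.const_add 1) (by norm_num)
    rw [add_zero, show (lk 0 x + lk 0 x) / (1 + 1) = lk 0 x by ring] at this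
    exact this
  have hW : Tendsto (fun m => evenW (dk m) (δ m) 0 x / δ m) atTop
      (𝓝 (-(lk 2 x + 1 / 12 * lk 0 x))) := by
    have := (tendsto_first_quotient hδ h0 1 x).neg.add (hq1.mul hU)
    rw [show -lk (1 + 1) x + -(1 / 12) * lk 0 x = -(lk 2 x + 1 / 12 * lk 0 x) by ring] at this
    refine this.congr fun m => ?_
    simp only [evenW, zero_add]
    ring
  have hcc : Tendsto (fun m => dk m 1 (δ m) / (1 - dk m 0 (δ m) ^ 2) * δ m) atTop (𝓝 (-1)) := by
    have := hq1.div hq0 (by norm_num)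
    rw [show (-(1 / 12 : ℝ)) / (1 / 12) = -1 by norm_num] at this
    refine this.congr' ?_
    filter_upwards [h0, hne'] with m hm hm'
    simp only [Pi.div_apply]
    field_simp
  -- Multiplying by `k - l r` clears the denominator of the shift. The product has a nonzero limit
  -- while `k - l r` itself tends to 0, so the symmetric part alone makes the power exceed one.
  have hV : Tendsto (fun m => evenU (dk m) (δ m) 0 x *
      (kerK (dk m) (δ m) - kerL (dk m) (δ m) * r m) -
      (dk m 1 (δ m) / (1 - dk m 0 (δ m) ^ 2) * δ m) * (dk m 0 (δ m) - r m) *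
        (evenW (dk m) (δ m) 0 x / δ m)) atTop
      (𝓝 (lk 0 x * 0 - -1 * (1 - r₀) * -(lk 2 x + 1 / 12 * lk 0 x))) :=
    (hU.mul hkr).sub ((hcc.mul (hs.sub hr)).mul hW)
  have hfin := (((hr.const_add 1).div_const 2).mul (hV.pow 2)).sub (hkr.pow 2)
  have hlim : 0 < (1 + r₀) / 2 *
      (lk 0 x * 0 - -1 * (1 - r₀) * -(lk 2 x + 1 / 12 * lk 0 x)) ^ 2 - 0 ^ 2 := by
    have h1 : 0 < (1 + r₀) / 2 := by linarith
    have h2 : lk 0 x * 0 - -1 * (1 - r₀) * -(lk 2 x + 1 / 12 * lk 0 x) ≠ 0 := by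
      rw [show lk 0 x * 0 - -1 * (1 - r₀) * -(lk 2 x + 1 / 12 * lk 0 x) =
        -((1 - r₀) * (lk 2 x + 1 / 12 * lk 0 x)) by ring]
      exact neg_ne_zero.2 (mul_ne_zero (by linarith) hx)
    have : 0 < (lk 0 x * 0 - -1 * (1 - r₀) * -(lk 2 x + 1 / 12 * lk 0 x)) ^ 2 := by positivity
    rw [zero_pow two_ne_zero, sub_zero]
    positivity
  filter_upwards [h0, hne', hkl, hkl', hgap, hfin.eventually_const_lt hlim]
    with m hm0 hm1 hm2 hm3 hm4 hm5
  rw [abs_lt] at hm4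
  have hA : 0 < kerK (dk m) (δ m) - kerL (dk m) (δ m) * r m := by nlinarith
  have hB : 0 < kerK (dk m) (δ m) + kerL (dk m) (δ m) * r m := by nlinarith
  refine ⟨hm1, hA.ne', hB.ne', ?_⟩
  have hev : evenU (dk m) (δ m) 0 x * (kerK (dk m) (δ m) - kerL (dk m) (δ m) * r m) -
      (dk m 1 (δ m) / (1 - dk m 0 (δ m) ^ 2) * δ m) * (dk m 0 (δ m) - r m) *
        (evenW (dk m) (δ m) 0 x / δ m) = evenV (dk m) (δ m) (kerT (dk m) (δ m) (r m)) 0 x *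
      (kerK (dk m) (δ m) - kerL (dk m) (δ m) * r m) := by
    rw [evenV, kerT]
    field_simp
  rw [hev] at hm5
  set V := evenV (dk m) (δ m) (kerT (dk m) (δ m) (r m)) 0 x with hVdef
  have h6 : 1 < (1 + r m) / 2 * V ^ 2 := by
    by_contra! hcon
    have := mul_le_mul_of_nonneg_right hcon
      (sq_nonneg (kerK (dk m) (δ m) - kerL (dk m) (δ m) * r m))
    nlinarith
  have h7 : 0 ≤ (1 - r m) / 2 * oddV (dk m) (δ m) (kerT (dk m) (δ m) (r m)) 0 x ^ 2 :=
    mul_nonneg (by linarith) (sq_nonneg _)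
  rw [power, ← hVdef]
  linarith

end Coalescing

/-! ### Strict positivity for the limit kernel -/

lemma continuous_wave_re (j : ℕ) (x : ℝ) : Continuous fun u : ℝ => (wave j u x).re :=
  Complex.continuous_re.comp ((continuous_wave j).comp (continuous_id.prodMk continuous_const))

lemma lk_eq_integral (j : ℕ) (x : ℝ) :
    lk j x = ∫ u in (-(1 / 2) : ℝ)..(1 / 2), (wave j u x).re := by
  rw [lk, lkC]
  have hc : Continuous fun u : ℝ => wave j u x :=
    (continuous_wave j).comp (continuous_id.prodMk continuous_const)
  exact (Complex.reCLM.intervalIntegral_comp_comm (hc.intervalIntegrable _ _)).symm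

lemma integral_pos_of_exists {f : ℝ → ℝ} (hf : Continuous f) (h0 : ∀ u, 0 ≤ f u)
    (h : ∃ u, |u| ≤ 1 / 2 ∧ f u ≠ 0) : 0 < ∫ u in (-(1 / 2) : ℝ)..(1 / 2), f u := by
  obtain ⟨u, hu, hne⟩ := h
  exact intervalIntegral.integral_pos (by norm_num) hf.continuousOn (fun u _ => h0 u)
    ⟨u, abs_le.1 hu, lt_of_le_of_ne (h0 u) hne.symm⟩

lemma exists_sin_ne_zero {δ : ℝ} (hδ : δ ≠ 0) :
    ∃ u, 0 < u ∧ u ≤ 1 / 4 ∧ Real.sin (u * δ / 2) ≠ 0 := by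
  have h1 : 0 < 1 + |δ| := by positivity
  refine ⟨1 / (4 * (1 + |δ|)), by positivity, ?_, ?_⟩
  · rw [div_le_div_iff₀ (by positivity) (by norm_num)]
    linarith [abs_nonneg δ]
  · have h2 : |1 / (4 * (1 + |δ|)) * δ / 2| < 1 := by
      rw [abs_div, abs_mul, abs_two, abs_of_pos (by positivity : 0 < 1 / (4 * (1 + |δ|)))]
      rw [div_lt_one two_pos, div_mul_eq_mul_div, one_mul, div_lt_iff₀ (by positivity)]
      linarith [abs_nonneg δ]
    have h3 : 1 / (4 * (1 + |δ|)) * δ / 2 ≠ 0 := by positivity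
    rw [abs_lt] at h2
    rcases lt_or_gt_of_ne h3 with h | h
    · exact (Real.sin_neg_of_neg_of_neg_pi_lt h (by linarith [Real.pi_gt_three])).ne
    · exact (Real.sin_pos_of_pos_of_lt_pi h (by linarith [Real.pi_gt_three])).ne'

/-- Strict Cauchy–Schwarz for `u cos (uδ/2)` and `sin (uδ/2)` on `[-1/2, 1/2]`: the quantity is
twice the integral of the squared residual, with `c` the least-squares coefficient. -/
lemma kerK_add_kerL_pos {δ : ℝ} (hδ : δ ≠ 0) : 0 < kerK lk δ + kerL lk δ := by
  have hs := one_sub_lk_zero_sq_pos hδ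
  have hm : 0 < 1 - lk 0 δ := by
    have := abs_lt.1 (abs_lk_zero_lt_one hδ)
    linarith
  rw [kerK_add_kerL hs.ne']
  set c := -lk 1 δ / (1 - lk 0 δ) with hc
  have hint := integral_pos_of_exists
    (f := fun u => (u * Real.cos (u * δ / 2) - c * Real.sin (u * δ / 2)) ^ 2) (by fun_prop)
    (fun u => sq_nonneg _) ?_
  · have h2 : ∀ u : ℝ, (u * Real.cos (u * δ / 2) - c * Real.sin (u * δ / 2)) ^ 2 =
        (-1 / 2) * (wave 2 u (0 : ℝ)).re + (-1 / 2) * (wave 2 u δ).re + c * (wave 1 u δ).re +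
        (c ^ 2 / 2) * (wave 0 u (0 : ℝ)).re + (-c ^ 2 / 2) * (wave 0 u δ).re := by
      intro u
      have e : u * δ = 2 * (u * δ / 2) := by ring
      rw [wave_two_re, wave_two_re, wave_one_re, wave_zero_re, wave_zero_re, mul_zero,
        Real.cos_zero, e, Real.sin_two_mul, Real.cos_two_mul, ← e]
      linear_combination (-c ^ 2) * Real.sin_sq_add_cos_sq (u * δ / 2) +
        2 * c ^ 2 * Real.sin_sq_add_cos_sq (u * δ / 2)
    simp only [h2] at hint
    have hi : ∀ (a : ℝ) j (x : ℝ), IntervalIntegrable (fun u : ℝ => a * (wave j u x).re)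
        MeasureTheory.volume (-(1 / 2)) (1 / 2) := fun a j x =>
      ((continuous_wave_re j x).const_mul a).intervalIntegrable _ _
    rw [intervalIntegral.integral_add ((((hi _ _ _).add (hi _ _ _)).add (hi _ _ _)).add (hi _ _ _))
        (hi _ _ _),
      intervalIntegral.integral_add (((hi _ _ _).add (hi _ _ _)).add (hi _ _ _)) (hi _ _ _),
      intervalIntegral.integral_add ((hi _ _ _).add (hi _ _ _)) (hi _ _ _),
      intervalIntegral.integral_add (hi _ _ _) (hi _ _ _)] at hint
    simp only [intervalIntegral.integral_const_mul, ← lk_eq_integral] at hint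
    rw [isKernel_lk.one] at hint
    have h3 : -lk 2 0 - lk 2 δ - lk 1 δ ^ 2 / (1 - lk 0 δ) = 2 * (-1 / 2 * lk 2 0 +
        -1 / 2 * lk 2 δ + c * lk 1 δ + c ^ 2 / 2 * 1 + -c ^ 2 / 2 * lk 0 δ) := by
      rw [hc]
      field_simp
      ring
    rw [h3]
    linarith
  · by_contra! h
    obtain ⟨u, hu0, hu1, hne⟩ := exists_sin_ne_zero hδ
    -- A residual vanishing at both `u` and `2u` forces `sin (uδ/2) = 0` by the double-angle
    -- formulas; `u ≤ 1/4` keeps `2u` inside the aperture.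
    have a1 := h u (by rw [abs_of_pos hu0]; linarith)
    have a2 := h (2 * u) (by rw [abs_of_pos (by linarith)]; linarith)
    rw [sq_eq_zero_iff] at a1 a2
    have e : 2 * u * δ / 2 = 2 * (u * δ / 2) := by ring
    rw [e, Real.sin_two_mul, Real.cos_two_mul] at a2
    have h4 : u * Real.sin (u * δ / 2) ^ 2 = 0 := by
      have := Real.sin_sq_add_cos_sq (u * δ / 2)
      linear_combination u * this + Real.cos (u * δ / 2) * a1 - a2 / 2
    rcases mul_eq_zero.1 h4 with h5 | h5
    · exact hu0.ne' h5
    · exact hne (pow_eq_zero_iff two_ne_zero |>.1 h5)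

/-- The same residual argument for `u sin (uδ/2)` against `cos (uδ/2)`; vanishing at `u = 0` already
forces `c = 0`. -/
lemma kerK_sub_kerL_pos {δ : ℝ} (hδ : δ ≠ 0) : 0 < kerK lk δ - kerL lk δ := by
  have hs := one_sub_lk_zero_sq_pos hδ
  have hm : 0 < 1 + lk 0 δ := by
    have := abs_lt.1 (abs_lk_zero_lt_one hδ)
    linarith
  rw [kerK_sub_kerL hs.ne']
  set c := lk 1 δ / (1 + lk 0 δ) with hc
  have hint := integral_pos_of_exists
    (f := fun u => (u * Real.sin (u * δ / 2) + c * Real.cos (u * δ / 2)) ^ 2) (by fun_prop)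
    (fun u => sq_nonneg _) ?_
  · have h2 : ∀ u : ℝ, (u * Real.sin (u * δ / 2) + c * Real.cos (u * δ / 2)) ^ 2 =
        (-1 / 2) * (wave 2 u (0 : ℝ)).re + (1 / 2) * (wave 2 u δ).re + (-c) * (wave 1 u δ).re +
        (c ^ 2 / 2) * (wave 0 u (0 : ℝ)).re + (c ^ 2 / 2) * (wave 0 u δ).re := by
      intro u
      have e : u * δ = 2 * (u * δ / 2) := by ring
      rw [wave_two_re, wave_two_re, wave_one_re, wave_zero_re, wave_zero_re, mul_zero,
        Real.cos_zero, e, Real.sin_two_mul, Real.cos_two_mul, ← e]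
      linear_combination u ^ 2 * Real.sin_sq_add_cos_sq (u * δ / 2)
    simp only [h2] at hint
    have hi : ∀ (a : ℝ) j (x : ℝ), IntervalIntegrable (fun u : ℝ => a * (wave j u x).re)
        MeasureTheory.volume (-(1 / 2)) (1 / 2) := fun a j x =>
      ((continuous_wave_re j x).const_mul a).intervalIntegrable _ _
    rw [intervalIntegral.integral_add ((((hi _ _ _).add (hi _ _ _)).add (hi _ _ _)).add (hi _ _ _))
        (hi _ _ _),
      intervalIntegral.integral_add (((hi _ _ _).add (hi _ _ _)).add (hi _ _ _)) (hi _ _ _),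
      intervalIntegral.integral_add ((hi _ _ _).add (hi _ _ _)) (hi _ _ _),
      intervalIntegral.integral_add (hi _ _ _) (hi _ _ _)] at hint
    simp only [intervalIntegral.integral_const_mul, ← lk_eq_integral] at hint
    rw [isKernel_lk.one] at hint
    have h3 : -lk 2 0 + lk 2 δ - lk 1 δ ^ 2 / (1 + lk 0 δ) = 2 * (-1 / 2 * lk 2 0 +
        1 / 2 * lk 2 δ + -c * lk 1 δ + c ^ 2 / 2 * 1 + c ^ 2 / 2 * lk 0 δ) := by
      rw [hc]
      field_simp
      ring
    rw [h3]
    linarith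
  · by_contra! h
    obtain ⟨u, hu0, hu1, hne⟩ := exists_sin_ne_zero hδ
    have a1 := h u (by rw [abs_of_pos hu0]; linarith)
    have a2 := h 0 (by norm_num)
    simp only [zero_mul, zero_div, Real.cos_zero, mul_one, zero_add] at a2
    rw [sq_eq_zero_iff] at a1 a2
    rw [a2, zero_mul, add_zero] at a1
    exact (mul_ne_zero hu0.ne' hne) a1

lemma kerK_lk_pos {δ : ℝ} (hδ : δ ≠ 0) : 0 < kerK lk δ := by
  linarith [kerK_add_kerL_pos hδ, kerK_sub_kerL_pos hδ]

lemma kerK_sub_mul_pos {δ r : ℝ} (hδ : δ ≠ 0) (hr : |r| ≤ 1) : 0 < kerK lk δ - kerL lk δ * r := by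
  have h1 := kerK_add_kerL_pos hδ
  have h2 := kerK_sub_kerL_pos hδ
  rw [abs_le] at hr
  rcases le_total 0 r with h | h <;> nlinarith

lemma kerK_add_mul_pos {δ r : ℝ} (hδ : δ ≠ 0) (hr : |r| ≤ 1) : 0 < kerK lk δ + kerL lk δ * r := by
  have := kerK_sub_mul_pos hδ (r := -r) (by rwa [abs_neg])
  linarith

lemma eq_zero_of_sin_eq_zero {y : ℝ} (h : ∀ u : ℝ, |u| ≤ 1 / 2 → Real.sin (u * y) = 0) : y = 0 := by
  by_contra hy
  obtain ⟨u, hu0, hu1, hne⟩ := exists_sin_ne_zero hy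
  refine hne ?_
  have := h (u / 2) (by rw [abs_of_pos (by linarith)]; linarith)
  rwa [div_mul_eq_mul_div] at this

/-- A third steering direction is not in the span of the two sources. -/
lemma gram_strict {δ x : ℝ} (hδ : δ ≠ 0) (hx : x ≠ 0) (hxδ : x ≠ -δ) :
    (1 + lk 0 δ) / 2 * evenU lk δ 0 x ^ 2 + (1 - lk 0 δ) / 2 * oddU lk δ 0 x ^ 2 < 1 := by
  have hs := one_sub_lk_zero_sq_pos hδ
  have h1 := one_add_ne_zero_of hs.ne'
  have h2 := one_sub_ne_zero_of hs.ne'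
  set a := (evenU lk δ 0 x + oddU lk δ 0 x) / 2 with ha
  set b := (evenU lk δ 0 x - oddU lk δ 0 x) / 2 with hb
  -- The integrand is `|e^{iux} - a - b e^{-iuδ}|²`, where `a`, `b` are the coefficients of the
  -- projection onto the span of the two sources; its integral is one minus the left-hand side.
  have hint := integral_pos_of_exists
    (f := fun u => (Real.cos (u * x) - a - b * Real.cos (u * δ)) ^ 2 +
      (Real.sin (u * x) + b * Real.sin (u * δ)) ^ 2) (by fun_prop) (fun u => by positivity) ?_
  · have h3 : ∀ u : ℝ, (Real.cos (u * x) - a - b * Real.cos (u * δ)) ^ 2 +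
        (Real.sin (u * x) + b * Real.sin (u * δ)) ^ 2 = (1 + a ^ 2 + b ^ 2) *
        (wave 0 u (0 : ℝ)).re + (-2 * a) * (wave 0 u x).re + (-2 * b) * (wave 0 u (x + δ : ℝ)).re +
        (2 * a * b) * (wave 0 u δ).re := by
      intro u
      rw [wave_zero_re, wave_zero_re, wave_zero_re, wave_zero_re, mul_zero, Real.cos_zero, mul_add,
        Real.cos_add]
      linear_combination Real.sin_sq_add_cos_sq (u * x) + b ^ 2 * Real.sin_sq_add_cos_sq (u * δ)
    simp only [h3] at hint
    have hi : ∀ (a : ℝ) j (x : ℝ), IntervalIntegrable (fun u : ℝ => a * (wave j u x).re)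
        MeasureTheory.volume (-(1 / 2)) (1 / 2) := fun a j x =>
      ((continuous_wave_re j x).const_mul a).intervalIntegrable _ _
    rw [intervalIntegral.integral_add (((hi _ _ _).add (hi _ _ _)).add (hi _ _ _)) (hi _ _ _),
      intervalIntegral.integral_add ((hi _ _ _).add (hi _ _ _)) (hi _ _ _),
      intervalIntegral.integral_add (hi _ _ _) (hi _ _ _)] at hint
    simp only [intervalIntegral.integral_const_mul, ← lk_eq_integral] at hint
    rw [isKernel_lk.one] at hint
    have e1 : lk 0 x + lk 0 (x + δ) = evenU lk δ 0 x * (1 + lk 0 δ) := by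
      rw [evenU, div_mul_cancel₀ _ h1]
    have e2 : lk 0 x - lk 0 (x + δ) = oddU lk δ 0 x * (1 - lk 0 δ) := by
      rw [oddU, div_mul_cancel₀ _ h2]
    have e3 : (1 + a ^ 2 + b ^ 2) * 1 + -2 * a * lk 0 x + -2 * b * lk 0 (x + δ) +
        2 * a * b * lk 0 δ = 1 - ((1 + lk 0 δ) / 2 * evenU lk δ 0 x ^ 2 +
          (1 - lk 0 δ) / 2 * oddU lk δ 0 x ^ 2) := by
      rw [ha, hb]
      linear_combination (-evenU lk δ 0 x) * e1 - oddU lk δ 0 x * e2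
    rw [e3] at hint
    linarith
  · by_contra! h
    have hc : ∀ u : ℝ, |u| ≤ 1 / 2 → Real.cos (u * x) = a + b * Real.cos (u * δ) ∧
        Real.sin (u * x) = -b * Real.sin (u * δ) := by
      intro u hu
      have h4 := h u hu
      have h5 := (add_eq_zero_iff_of_nonneg (sq_nonneg _) (sq_nonneg _)).1 h4
      rw [sq_eq_zero_iff, sq_eq_zero_iff] at h5
      exact ⟨by linarith [h5.1], by linarith [h5.2]⟩
    have hab : a + b = 1 := by
      have := (hc 0 (by norm_num)).1
      simp only [zero_mul, Real.cos_zero, mul_one] at this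
      linarith
    obtain ⟨u, hu0, hu1, hne⟩ := exists_sin_ne_zero hδ
    -- Comparing moduli in `e^{iux} = a + b e^{-iuδ}` with `a + b = 1` leaves only the two trivial
    -- representations.
    have hprod : a * b = 0 := by
      obtain ⟨c1, c2⟩ := hc u (by rw [abs_of_pos hu0]; linarith)
      have h6 := Real.sin_sq_add_cos_sq (u * x)
      have h7 := Real.sin_sq_add_cos_sq (u * δ)
      rw [c1, c2] at h6
      have h8 : 2 * a * b * (Real.cos (u * δ) - 1) = 0 := by
        linear_combination h6 - b ^ 2 * h7 - (a + b + 1) * hab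
      have e : u * δ = 2 * (u * δ / 2) := by ring
      rw [e, Real.cos_two_mul] at h8
      have h9 : a * b * Real.sin (u * δ / 2) ^ 2 = 0 := by
        linear_combination a * b * Real.sin_sq_add_cos_sq (u * δ / 2) - h8 / 4
      exact (mul_eq_zero.1 h9).resolve_right (pow_ne_zero 2 hne)
    rcases mul_eq_zero.1 hprod with h6 | h6
    · have hb1 : b = 1 := by linarith
      apply hxδ
      have : x + δ = 0 := by
        refine eq_zero_of_sin_eq_zero fun u hu => ?_
        obtain ⟨c1, c2⟩ := hc u hu
        rw [mul_add, Real.sin_add, c1, c2, h6, hb1]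
        ring
      linarith
    · apply hx
      refine eq_zero_of_sin_eq_zero fun u hu => ?_
      rw [(hc u hu).2, h6]
      ring

/-! ### The discriminant of the touching condition -/

lemma lk_one_eq {x : ℝ} (hx : x ≠ 0) :
    lk 1 x = Real.cos (x / 2) / x - 2 * Real.sin (x / 2) / x ^ 2 := by
  have h1 : HasDerivAt (fun y : ℝ => 2 * Real.sin (y / 2) / y)
      (Real.cos (x / 2) / x - 2 * Real.sin (x / 2) / x ^ 2) x := by
    have := ((((hasDerivAt_id x).div_const 2).sin).const_mul 2).fun_div (hasDerivAt_id x) hx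
    refine this.congr_deriv ?_
    simp only [id]
    field_simp
  have h2 : lk 0 =ᶠ[𝓝 x] fun y : ℝ => 2 * Real.sin (y / 2) / y :=
    (eventually_ne_nhds hx).mono fun y hy => lk_zero_eq hy
  exact (isKernel_lk.hasDerivAt 0 x).unique (h1.congr_of_eventuallyEq h2)

/-- Discriminant of the cubic `a t³ + b t² + c t + d`. -/
def cubicDisc (a b c d : ℝ) : ℝ :=
  b ^ 2 * c ^ 2 - 4 * a * c ^ 3 - 4 * b ^ 3 * d - 27 * a ^ 2 * d ^ 2 + 18 * a * b * c * d

/-- A common root of the polynomial and its derivative determines `c` and `d` from `a`, `b`, `t`. No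
leading coefficient has to be nonzero, so degenerate cubics are covered. -/
lemma cubicDisc_eq_zero {a b c d t : ℝ} (h : a * t ^ 3 + b * t ^ 2 + c * t + d = 0)
    (h' : 3 * a * t ^ 2 + 2 * b * t + c = 0) : cubicDisc a b c d = 0 := by
  have hc : c = -(3 * a * t ^ 2 + 2 * b * t) := by linarith
  have hd : d = 2 * a * t ^ 3 + b * t ^ 2 := by
    linear_combination h - t * h'
  rw [cubicDisc, hd, hc]
  ring

/-- The common factor of the normalized shifts. -/
def kerC (δ : ℝ) : ℝ := lk 1 δ / (1 - lk 0 δ ^ 2)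

/-- The excess of the limit power over one, as a cubic in the shift. -/
def cubic (δ x t : ℝ) : ℝ :=
  (kerC δ * (1 + lk 0 δ) - (kerK lk δ + kerL lk δ) * t) * evenV lk δ t 0 x ^ 2 +
    (kerC δ * (1 - lk 0 δ) + (kerK lk δ - kerL lk δ) * t) * oddV lk δ t 0 x ^ 2 -
    2 * (kerC δ - kerL lk δ * t)

/-- Cubic coefficient of `cubic`. -/
def coefA (δ x : ℝ) : ℝ :=
  -(kerK lk δ + kerL lk δ) * evenW lk δ 0 x ^ 2 + (kerK lk δ - kerL lk δ) * oddW lk δ 0 x ^ 2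

/-- Quadratic coefficient of `cubic`. -/
def coefB (δ x : ℝ) : ℝ :=
  kerC δ * (1 + lk 0 δ) * evenW lk δ 0 x ^ 2 +
    2 * (kerK lk δ + kerL lk δ) * (evenU lk δ 0 x * evenW lk δ 0 x) +
    kerC δ * (1 - lk 0 δ) * oddW lk δ 0 x ^ 2 -
    2 * (kerK lk δ - kerL lk δ) * (oddU lk δ 0 x * oddW lk δ 0 x)

/-- Linear coefficient of `cubic`, up to its limit. -/
def coefC (δ x : ℝ) : ℝ :=
  -2 * (kerC δ * (1 + lk 0 δ)) * (evenU lk δ 0 x * evenW lk δ 0 x) -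
    (kerK lk δ + kerL lk δ) * evenU lk δ 0 x ^ 2 -
    2 * (kerC δ * (1 - lk 0 δ)) * (oddU lk δ 0 x * oddW lk δ 0 x) +
    (kerK lk δ - kerL lk δ) * oddU lk δ 0 x ^ 2

/-- Constant coefficient of `cubic`, up to its limit. -/
def coefD (δ x : ℝ) : ℝ :=
  kerC δ * (1 + lk 0 δ) * evenU lk δ 0 x ^ 2 + kerC δ * (1 - lk 0 δ) * oddU lk δ 0 x ^ 2

lemma cubic_eq (δ x t : ℝ) : cubic δ x t = coefA δ x * t ^ 3 + coefB δ x * t ^ 2 +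
    (coefC δ x + 2 * kerL lk δ) * t + (coefD δ x - 2 * kerC δ) := by
  simp only [cubic, coefA, coefB, coefC, coefD, evenV, oddV]
  ring

/-- The discriminant of `cubic`. -/
def disc (δ x : ℝ) : ℝ :=
  cubicDisc (coefA δ x) (coefB δ x) (coefC δ x + 2 * kerL lk δ) (coefD δ x - 2 * kerC δ)

lemma analyticAt_disc (δ x : ℝ) : AnalyticAt ℝ (disc δ) x := by
  have h1 : ∀ j, AnalyticAt ℝ (lk j) x := fun j => analyticAt_lk j x
  have h2 : ∀ j, AnalyticAt ℝ (fun x => lk j (x + δ)) x := fun j =>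
    AnalyticAt.fun_comp (g := lk j) (f := fun x => x + δ) (analyticAt_lk j (x + δ))
      (analyticAt_id.fun_add analyticAt_const)
  have hE : AnalyticAt ℝ (evenU lk δ 0) x := ((h1 0).fun_add (h2 0)).div_const
  have hO : AnalyticAt ℝ (oddU lk δ 0) x := ((h1 0).fun_sub (h2 0)).div_const
  have hX : AnalyticAt ℝ (evenW lk δ 0) x :=
    ((h1 1).fun_sub (h2 1)).fun_add (analyticAt_const.fun_mul hE)
  have hY : AnalyticAt ℝ (oddW lk δ 0) x :=
    ((h1 1).fun_add (h2 1)).fun_sub (analyticAt_const.fun_mul hO)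
  unfold disc cubicDisc coefA coefB coefC coefD
  fun_prop

/-- Asymptotic form of the discriminant along a sequence. -/
lemma exists_disc_ne_zero_of_tendsto {δ : ℝ} (hc : kerC δ ≠ 0) {z : ℕ → ℝ}
    (hz : Tendsto z atTop atTop) {e o u w : ℝ}
    (he : Tendsto (fun n => z n * evenU lk δ 0 (z n)) atTop (𝓝 e))
    (ho : Tendsto (fun n => z n * oddU lk δ 0 (z n)) atTop (𝓝 o))
    (hu : Tendsto (fun n => z n * evenW lk δ 0 (z n)) atTop (𝓝 u))
    (hw : Tendsto (fun n => z n * oddW lk δ 0 (z n)) atTop (𝓝 w))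
    (hA : -(kerK lk δ + kerL lk δ) * u ^ 2 + (kerK lk δ - kerL lk δ) * w ^ 2 ≠ 0) :
    ∃ x, disc δ x ≠ 0 := by
  by_contra! h
  set aLim := -(kerK lk δ + kerL lk δ) * u ^ 2 + (kerK lk δ - kerL lk δ) * w ^ 2 with haLim
  have hzero : ∀ {f : ℝ → ℝ} {l : ℝ}, Tendsto (fun n => z n ^ 2 * f (z n)) atTop (𝓝 l) →
      Tendsto (fun n => f (z n)) atTop (𝓝 0) := by
    intro f l hf
    refine (hf.div_atTop ((tendsto_pow_atTop two_ne_zero).comp hz)).congr' ?_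
    filter_upwards [hz.eventually_gt_atTop 0] with n hn
    simp only [Function.comp]
    field_simp
  have tA : Tendsto (fun n => z n ^ 2 * coefA δ (z n)) atTop (𝓝 aLim) := by
    refine (((hu.pow 2).const_mul (-(kerK lk δ + kerL lk δ))).add
      ((hw.pow 2).const_mul (kerK lk δ - kerL lk δ))).congr fun n => ?_
    rw [coefA]
    ring
  obtain ⟨B, tB⟩ : ∃ B, Tendsto (fun n => z n ^ 2 * coefB δ (z n)) atTop (𝓝 B) := by
    refine ⟨_, (((((hu.pow 2).const_mul (kerC δ * (1 + lk 0 δ))).add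
      ((he.mul hu).const_mul (2 * (kerK lk δ + kerL lk δ)))).add
      ((hw.pow 2).const_mul (kerC δ * (1 - lk 0 δ)))).sub
      ((ho.mul hw).const_mul (2 * (kerK lk δ - kerL lk δ)))).congr fun n => ?_⟩
    rw [coefB]
    ring
  obtain ⟨C, tC⟩ : ∃ C, Tendsto (fun n => z n ^ 2 * coefC δ (z n)) atTop (𝓝 C) := by
    refine ⟨_, (((((he.mul hu).const_mul (-2 * (kerC δ * (1 + lk 0 δ)))).sub
      ((he.pow 2).const_mul (kerK lk δ + kerL lk δ))).sub
      ((ho.mul hw).const_mul (2 * (kerC δ * (1 - lk 0 δ))))).add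
      ((ho.pow 2).const_mul (kerK lk δ - kerL lk δ))).congr fun n => ?_⟩
    rw [coefC]
    ring
  obtain ⟨E, tD⟩ : ∃ E, Tendsto (fun n => z n ^ 2 * coefD δ (z n)) atTop (𝓝 E) := by
    refine ⟨_, (((he.pow 2).const_mul (kerC δ * (1 + lk 0 δ))).add
      ((ho.pow 2).const_mul (kerC δ * (1 - lk 0 δ)))).congr fun n => ?_⟩
    rw [coefD]
    ring
  have a0 := hzero tA
  have b0 := hzero tB
  have c0 := (hzero tC).add_const (2 * kerL lk δ)
  have d0 := (hzero tD).sub_const (2 * kerC δ)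
  rw [zero_add] at c0
  rw [zero_sub] at d0
  -- The four `coef` functions are `O(z⁻²)`. If `l ≠ 0`, the discriminant times `z²` tends to `-4
  -- aLim (2l)³`. If `l = 0`, the linear coefficient decays too and the discriminant times `z⁴`
  -- tends to `-27 aLim² (2c)²`.
  by_cases hl : kerL lk δ = 0
  · have tC' : Tendsto (fun n => z n ^ 2 * (coefC δ (z n) + 2 * kerL lk δ)) atTop (𝓝 C) := by
      simpa [hl] using tC
    have lim := (((((tB.pow 2).mul (c0.pow 2)).sub (((tA.const_mul 4).mul tC').mul (c0.pow 2))).sub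
      ((((tB.pow 2).const_mul 4).mul b0).mul d0)).sub
      (((tA.pow 2).const_mul 27).mul (d0.pow 2))).add
      ((((tA.const_mul 18).mul tB).mul c0).mul d0)
    have hz0 : ∀ n, (z n ^ 2 * coefB δ (z n)) ^ 2 * (coefC δ (z n) + 2 * kerL lk δ) ^ 2 -
        4 * (z n ^ 2 * coefA δ (z n)) * (z n ^ 2 * (coefC δ (z n) + 2 * kerL lk δ)) *
          (coefC δ (z n) + 2 * kerL lk δ) ^ 2 -
        4 * (z n ^ 2 * coefB δ (z n)) ^ 2 * coefB δ (z n) * (coefD δ (z n) - 2 * kerC δ) -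
        27 * (z n ^ 2 * coefA δ (z n)) ^ 2 * (coefD δ (z n) - 2 * kerC δ) ^ 2 +
        18 * (z n ^ 2 * coefA δ (z n)) * (z n ^ 2 * coefB δ (z n)) *
          (coefC δ (z n) + 2 * kerL lk δ) * (coefD δ (z n) - 2 * kerC δ) = 0 := by
      intro n
      have := h (z n)
      rw [disc, cubicDisc] at this
      linear_combination z n ^ 4 * this
    simp only [hz0] at lim
    have := tendsto_nhds_unique lim tendsto_const_nhds
    rw [hl] at this
    have h2 : aLim ^ 2 * kerC δ ^ 2 = 0 := by linear_combination -this / 108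
    exact mul_ne_zero (pow_ne_zero 2 hA) (pow_ne_zero 2 hc) h2
  · have lim := (((((tB.mul b0).mul (c0.pow 2)).sub ((tA.const_mul 4).mul (c0.pow 3))).sub
      (((tB.const_mul 4).mul (b0.pow 2)).mul d0)).sub
      (((tA.const_mul 27).mul a0).mul (d0.pow 2))).add
      ((((tA.const_mul 18).mul b0).mul c0).mul d0)
    have hz0 : ∀ n, z n ^ 2 * coefB δ (z n) * coefB δ (z n) *
          (coefC δ (z n) + 2 * kerL lk δ) ^ 2 -
        4 * (z n ^ 2 * coefA δ (z n)) * (coefC δ (z n) + 2 * kerL lk δ) ^ 3 -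
        4 * (z n ^ 2 * coefB δ (z n)) * coefB δ (z n) ^ 2 * (coefD δ (z n) - 2 * kerC δ) -
        27 * (z n ^ 2 * coefA δ (z n)) * coefA δ (z n) * (coefD δ (z n) - 2 * kerC δ) ^ 2 +
        18 * (z n ^ 2 * coefA δ (z n)) * coefB δ (z n) *
          (coefC δ (z n) + 2 * kerL lk δ) * (coefD δ (z n) - 2 * kerC δ) = 0 := by
      intro n
      have := h (z n)
      rw [disc, cubicDisc] at this
      linear_combination z n ^ 2 * this
    simp only [hz0] at lim
    have := tendsto_nhds_unique lim tendsto_const_nhds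
    have h2 : aLim * kerL lk δ ^ 3 = 0 := by linear_combination -this / 32
    exact mul_ne_zero hA (pow_ne_zero 3 hl) h2

/-- Kernel asymptotics along a sequence of fixed phase. -/
lemma tendsto_scaled_lk {z : ℕ → ℝ} (hz : Tendsto z atTop atTop) {a S C : ℝ}
    (hS : ∀ n, Real.sin ((z n + a) / 2) = S) (hC : ∀ n, Real.cos ((z n + a) / 2) = C) :
    Tendsto (fun n => z n * lk 0 (z n + a)) atTop (𝓝 (2 * S)) ∧
      Tendsto (fun n => z n * lk 1 (z n + a)) atTop (𝓝 C) := by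
  have hza : Tendsto (fun n => z n + a) atTop atTop := tendsto_atTop_add_const_right _ _ hz
  have hinv : Tendsto (fun n => (z n + a)⁻¹) atTop (𝓝 0) := tendsto_inv_atTop_zero.comp hza
  have hq : Tendsto (fun n => 1 - a * (z n + a)⁻¹) atTop (𝓝 1) := by
    simpa using (hinv.const_mul a).const_sub 1
  constructor
  · have := hq.mul_const (2 * S)
    rw [one_mul] at this
    refine this.congr' ?_
    filter_upwards [hza.eventually_gt_atTop 0] with n hn
    rw [lk_zero_eq hn.ne', hS]
    field_simp
    ring
  · have := (hq.mul_const C).sub ((hq.mul_const (2 * S)).mul hinv)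
    rw [one_mul, mul_zero, sub_zero] at this
    refine this.congr' ?_
    filter_upwards [hza.eventually_gt_atTop 0] with n hn
    rw [lk_one_eq hn.ne', hS, hC]
    field_simp
    ring

lemma exists_disc_ne_zero_of_phase {δ : ℝ} (hc : kerC δ ≠ 0) {z : ℕ → ℝ}
    (hz : Tendsto z atTop atTop) {S1 C1 S2 C2 : ℝ}
    (hS1 : ∀ n, Real.sin (z n / 2) = S1) (hC1 : ∀ n, Real.cos (z n / 2) = C1)
    (hS2 : ∀ n, Real.sin ((z n + δ) / 2) = S2) (hC2 : ∀ n, Real.cos ((z n + δ) / 2) = C2)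
    (hA : -(kerK lk δ + kerL lk δ) *
        (C1 - C2 + lk 1 δ * ((2 * S1 + 2 * S2) / (1 + lk 0 δ))) ^ 2 +
      (kerK lk δ - kerL lk δ) *
        (C1 + C2 - lk 1 δ * ((2 * S1 - 2 * S2) / (1 - lk 0 δ))) ^ 2 ≠ 0) :
    ∃ x, disc δ x ≠ 0 := by
  obtain ⟨a0, a1⟩ := tendsto_scaled_lk hz (a := 0) (by simpa using hS1) (by simpa using hC1)
  obtain ⟨b0, b1⟩ := tendsto_scaled_lk hz hS2 hC2
  simp only [add_zero] at a0 a1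
  have he : Tendsto (fun n => z n * evenU lk δ 0 (z n)) atTop
      (𝓝 ((2 * S1 + 2 * S2) / (1 + lk 0 δ))) := by
    refine ((a0.add b0).div_const (1 + lk 0 δ)).congr fun n => ?_
    rw [evenU]
    ring
  have ho : Tendsto (fun n => z n * oddU lk δ 0 (z n)) atTop
      (𝓝 ((2 * S1 - 2 * S2) / (1 - lk 0 δ))) := by
    refine ((a0.sub b0).div_const (1 - lk 0 δ)).congr fun n => ?_
    rw [oddU]
    ring
  refine exists_disc_ne_zero_of_tendsto hc hz he ho
    (u := C1 - C2 + lk 1 δ * ((2 * S1 + 2 * S2) / (1 + lk 0 δ)))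
    (w := C1 + C2 - lk 1 δ * ((2 * S1 - 2 * S2) / (1 - lk 0 δ))) ?_ ?_ hA
  · refine ((a1.sub b1).add (he.const_mul (lk 1 δ))).congr fun n => ?_
    rw [evenW]
    ring
  · refine ((a1.add b1).sub (ho.const_mul (lk 1 δ))).congr fun n => ?_
    rw [oddW]
    ring

/-- Along the phase `-δ/4` the scaled `evenW` tends to 0, along `π/2 - δ/4` the scaled `oddW` does,
and the other one decides. If both failed, then `lk 0 δ = cos (δ/2)`, hence `lk 1 δ = 0`, and then
`sin (δ/4) = cos (δ/4) = 0`. -/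
lemma exists_disc_ne_zero {δ : ℝ} (hδ : δ ≠ 0) (hc : kerC δ ≠ 0) : ∃ x, disc δ x ≠ 0 := by
  have hs := one_sub_lk_zero_sq_pos hδ
  have h1 := one_add_ne_zero_of hs.ne'
  have h2 := one_sub_ne_zero_of hs.ne'
  set sn := Real.sin (δ / 4) with hsn
  set cn := Real.cos (δ / 4) with hcn
  have hlin : ∀ a : ℝ, Tendsto (fun n : ℕ => 2 * (n * (2 * Real.pi) + a)) atTop atTop := fun a =>
    (tendsto_atTop_add_const_right _ _
      (tendsto_natCast_atTop_atTop.atTop_mul_const (by positivity))).const_mul_atTop two_pos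
  by_cases hb2 : 2 * cn + 4 * lk 1 δ * sn / (1 - lk 0 δ) = 0
  · by_cases hb1 : 2 * sn + 4 * lk 1 δ * cn / (1 + lk 0 δ) = 0
    · exfalso
      have e1 : sn * (1 + lk 0 δ) = -2 * lk 1 δ * cn := by
        field_simp at hb1
        linarith
      have e2 : cn * (1 - lk 0 δ) = -2 * lk 1 δ * sn := by
        field_simp at hb2
        linarith
      have hsq : sn ^ 2 + cn ^ 2 = 1 := Real.sin_sq_add_cos_sq _
      have hs0 : lk 0 δ = cn ^ 2 - sn ^ 2 := by
        linear_combination (-lk 0 δ) * hsq + sn * e1 - cn * e2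
      have hcos : Real.cos (δ / 2) = cn ^ 2 - sn ^ 2 := by
        rw [show δ / 2 = 2 * (δ / 4) by ring, Real.cos_two_mul, ← hcn]
        linear_combination hsq
      have hs1 : lk 1 δ = 0 := by
        have h3 := lk_zero_eq hδ
        rw [lk_one_eq hδ, hcos, ← hs0, h3]
        field_simp
        ring
      rw [hs1] at e1 e2
      have h5 : sn = 0 := (mul_eq_zero.1 (show sn * (1 + lk 0 δ) = 0 by linarith)).resolve_right h1
      have h6 : cn = 0 := (mul_eq_zero.1 (show cn * (1 - lk 0 δ) = 0 by linarith)).resolve_right h2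
      rw [h5, h6] at hsq
      norm_num at hsq
    · refine exists_disc_ne_zero_of_phase hc (hlin (Real.pi / 2 - δ / 4))
        (S1 := cn) (C1 := sn) (S2 := cn) (C2 := -sn) (fun n => ?_) (fun n => ?_) (fun n => ?_)
        (fun n => ?_) ?_
      · rw [mul_div_cancel_left₀ _ two_ne_zero, add_comm, Real.sin_add_nat_mul_two_pi,
          Real.sin_pi_div_two_sub]
      · rw [mul_div_cancel_left₀ _ two_ne_zero, add_comm, Real.cos_add_nat_mul_two_pi,
          Real.cos_pi_div_two_sub]
      · rw [show (2 * ((n : ℝ) * (2 * Real.pi) + (Real.pi / 2 - δ / 4)) + δ) / 2 =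
          (δ / 4 + Real.pi / 2) + n * (2 * Real.pi) by ring, Real.sin_add_nat_mul_two_pi,
          Real.sin_add_pi_div_two]
      · rw [show (2 * ((n : ℝ) * (2 * Real.pi) + (Real.pi / 2 - δ / 4)) + δ) / 2 =
          (δ / 4 + Real.pi / 2) + n * (2 * Real.pi) by ring, Real.cos_add_nat_mul_two_pi,
          Real.cos_add_pi_div_two]
      · have e : -(kerK lk δ + kerL lk δ) *
            (sn - -sn + lk 1 δ * ((2 * cn + 2 * cn) / (1 + lk 0 δ))) ^ 2 +
            (kerK lk δ - kerL lk δ) *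
            (sn + -sn - lk 1 δ * ((2 * cn - 2 * cn) / (1 - lk 0 δ))) ^ 2 =
            -((kerK lk δ + kerL lk δ) * (2 * sn + 4 * lk 1 δ * cn / (1 + lk 0 δ)) ^ 2) := by
          ring
        rw [e]
        exact neg_ne_zero.2 (mul_ne_zero (kerK_add_kerL_pos hδ).ne' (pow_ne_zero 2 hb1))
  · refine exists_disc_ne_zero_of_phase hc (hlin (-(δ / 4)))
      (S1 := -sn) (C1 := cn) (S2 := sn) (C2 := cn) (fun n => ?_) (fun n => ?_) (fun n => ?_)
      (fun n => ?_) ?_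
    · rw [mul_div_cancel_left₀ _ two_ne_zero, add_comm, Real.sin_add_nat_mul_two_pi, Real.sin_neg]
    · rw [mul_div_cancel_left₀ _ two_ne_zero, add_comm, Real.cos_add_nat_mul_two_pi, Real.cos_neg]
    · rw [show (2 * ((n : ℝ) * (2 * Real.pi) + -(δ / 4)) + δ) / 2 =
        δ / 4 + n * (2 * Real.pi) by ring, Real.sin_add_nat_mul_two_pi]
    · rw [show (2 * ((n : ℝ) * (2 * Real.pi) + -(δ / 4)) + δ) / 2 =
        δ / 4 + n * (2 * Real.pi) by ring, Real.cos_add_nat_mul_two_pi]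
    · have e : -(kerK lk δ + kerL lk δ) *
          (cn - cn + lk 1 δ * ((2 * -sn + 2 * sn) / (1 + lk 0 δ))) ^ 2 +
          (kerK lk δ - kerL lk δ) *
          (cn + cn - lk 1 δ * ((2 * -sn - 2 * sn) / (1 - lk 0 δ))) ^ 2 =
          (kerK lk δ - kerL lk δ) * (2 * cn + 4 * lk 1 δ * sn / (1 - lk 0 δ)) ^ 2 := by
        ring
      rw [e]
      exact mul_ne_zero (kerK_sub_kerL_pos hδ).ne' (pow_ne_zero 2 hb2)

/-! ### Genericity of strict limit tests -/

lemma countable_zeros {f : ℝ → ℝ} (hf : ∀ x, AnalyticAt ℝ f x) (h : ∃ x, f x ≠ 0) :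
    {x | f x = 0}.Countable := by
  refine (countable_setOfPred_isolated_right_within (s := {x | f x = 0})).mono fun x hx => ?_
  refine ⟨hx, ?_⟩
  have h1 : ∀ᶠ z in 𝓝[≠] x, f z ≠ 0 := by
    by_contra hcon
    obtain ⟨y, hy⟩ := h
    exact hy (AnalyticOnNhd.eqOn_zero_of_preconnected_of_frequently_eq_zero
      (U := Set.univ) (fun z _ => hf z) isPreconnected_univ (Set.mem_univ x)
      (not_not.1 (fun h => hcon (Filter.not_frequently.1 h))) (Set.mem_univ y))
  have h2 : 𝓝[{x | f x = 0} ∩ Set.Ioi x] x ≤ 𝓝[≠] x :=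
    nhdsWithin_mono _ fun z hz => ne_of_gt hz.2
  have h3 : ∀ᶠ z in 𝓝[{x | f x = 0} ∩ Set.Ioi x] x, f z = 0 :=
    (eventually_mem_nhdsWithin).mono fun z hz => hz.1
  rw [← Filter.eventually_false_iff_eq_bot]
  filter_upwards [h2 h1, h3] with z hz hz'
  exact hz hz'

/-- If `S` accumulates at `t` from the right, the slopes along `S` are nonpositive. With its mirror
image this gives a zero derivative at a two-sided accumulation point. -/
lemma deriv_nonpos_of_right {g : ℝ → ℝ} {g' t : ℝ} {S : Set ℝ} (hg : HasDerivAt g g' t)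
    (h0 : g t = 0) (hS : ∀ u ∈ S, g u ≤ 0) (hne : 𝓝[S ∩ Set.Ioi t] t ≠ ⊥) : g' ≤ 0 := by
  have : (𝓝[S ∩ Set.Ioi t] t).NeBot := ⟨hne⟩
  have h := (hasDerivWithinAt_iff_tendsto_slope' (s := S ∩ Set.Ioi t)
    (fun h => lt_irrefl t h.2)).1 hg.hasDerivWithinAt
  refine le_of_tendsto h (eventually_mem_nhdsWithin.mono fun u hu => ?_)
  rw [slope_def_field, h0, sub_zero]
  exact div_nonpos_of_nonpos_of_nonneg (hS u hu.1) (sub_nonneg.2 (le_of_lt hu.2))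

lemma deriv_nonneg_of_left {g : ℝ → ℝ} {g' t : ℝ} {S : Set ℝ} (hg : HasDerivAt g g' t)
    (h0 : g t = 0) (hS : ∀ u ∈ S, g u ≤ 0) (hne : 𝓝[S ∩ Set.Iio t] t ≠ ⊥) : 0 ≤ g' := by
  have : (𝓝[S ∩ Set.Iio t] t).NeBot := ⟨hne⟩
  have h := (hasDerivWithinAt_iff_tendsto_slope' (s := S ∩ Set.Iio t)
    (fun h => lt_irrefl t h.2)).1 hg.hasDerivWithinAt
  refine ge_of_tendsto h (eventually_mem_nhdsWithin.mono fun u hu => ?_)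
  rw [slope_def_field, h0, sub_zero]
  exact div_nonneg_of_nonpos (hS u hu.1) (sub_nonpos.2 (le_of_lt hu.2))

lemma finite_cubic_roots {a b c d : ℝ} (hd : d ≠ 0) :
    {t : ℝ | a * t ^ 3 + b * t ^ 2 + c * t + d = 0}.Finite := by
  classical
  set p : Polynomial ℝ := Polynomial.C a * Polynomial.X ^ 3 + Polynomial.C b * Polynomial.X ^ 2 +
    Polynomial.C c * Polynomial.X + Polynomial.C d with hp
  have hp0 : p ≠ 0 := fun h => hd (by simpa [hp] using congrArg (Polynomial.eval 0) h)
  refine p.roots.toFinset.finite_toSet.subset fun t ht => ?_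
  have hroot : p.eval t = 0 := by simpa [hp] using ht
  simpa [hp0] using hroot

lemma kerT_eq (δ r : ℝ) :
    kerT lk δ r = kerC δ * (lk 0 δ - r) / (kerK lk δ - kerL lk δ * r) := rfl

lemma abs_lk_zero_le_one {δ : ℝ} (hδ : δ ≠ 0) : |lk 0 δ| ≤ 1 := (abs_lk_zero_lt_one hδ).le

/-- The relation `t (k - l r) = c (s - r)` eliminates `r`: for example `(c (1+s) - (k+l) t)(k - l r)
= c (k - l s)(1 + r)`. -/
lemma cubic_kerT {δ r x : ℝ} (hδ : δ ≠ 0) (hr : |r| ≤ 1) :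
    (kerK lk δ - kerL lk δ * r) * cubic δ x (kerT lk δ r) =
      2 * kerC δ * (kerK lk δ - kerL lk δ * lk 0 δ) * (power lk δ r x - 1) := by
  have hq := (kerK_sub_mul_pos hδ hr).ne'
  have ht : kerT lk δ r * (kerK lk δ - kerL lk δ * r) = kerC δ * (lk 0 δ - r) := by
    rw [kerT_eq, div_mul_cancel₀ _ hq]
  rw [cubic, power]
  set t := kerT lk δ r
  linear_combination (-(kerK lk δ + kerL lk δ) * evenV lk δ t 0 x ^ 2 +
    (kerK lk δ - kerL lk δ) * oddV lk δ t 0 x ^ 2 + 2 * kerL lk δ) * ht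

/-- The shift is a Möbius function of `r` with determinant `-c (k - l s)`, nonzero since `|s| ≤ 1`.
-/
lemma injOn_kerT {δ : ℝ} (hδ : δ ≠ 0) (hc : kerC δ ≠ 0) : Set.InjOn (kerT lk δ) {r | |r| ≤ 1} := by
  intro r hr r' hr' h
  have hq := (kerK_sub_mul_pos hδ hr).ne'
  have hq' := (kerK_sub_mul_pos hδ hr').ne'
  have hqs := (kerK_sub_mul_pos hδ (abs_lk_zero_le_one hδ)).ne'
  rw [kerT_eq, kerT_eq, div_eq_div_iff hq hq'] at h
  have : (r' - r) * (kerC δ * (kerK lk δ - kerL lk δ * lk 0 δ)) = 0 := by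
    linear_combination h
  have := (mul_eq_zero.1 this).resolve_right (mul_ne_zero hc hqs)
  linarith

/-- The correlations for which the limit test holds with equality off the sources. -/
def touching (δ : ℝ) : Set ℝ :=
  {r | |r| ≤ 1 ∧ (∀ x, power lk δ r x ≤ 1) ∧ ∃ x, x ≠ 0 ∧ x ≠ -δ ∧ power lk δ r x = 1}

lemma hasDerivAt_cubic (δ x t : ℝ) : HasDerivAt (cubic δ x) (3 * coefA δ x * t ^ 2 +
    2 * coefB δ x * t + (coefC δ x + 2 * kerL lk δ)) t := by
  have h := ((((hasDerivAt_pow 3 t).const_mul (coefA δ x)).fun_add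
    ((hasDerivAt_pow 2 t).const_mul (coefB δ x))).fun_add
    ((hasDerivAt_id t).const_mul (coefC δ x + 2 * kerL lk δ))).add_const (coefD δ x - 2 * kerC δ)
  refine (h.congr_of_eventuallyEq (Eventually.of_forall fun t => ?_)).congr_deriv ?_
  · rw [cubic_eq]
    simp
  · push_cast
    ring

lemma countable_touching_of_ne {δ : ℝ} (hδ : δ ≠ 0) (hc : kerC δ ≠ 0) :
    (touching δ).Countable := by
  set S : Set ℝ := {t | ∀ x, kerC δ * cubic δ x t ≤ 0} with hS
  set Z : Set ℝ := {x | disc δ x = 0} ∩ {x | x ≠ 0 ∧ x ≠ -δ} with hZ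
  have hqs := kerK_sub_mul_pos hδ (abs_lk_zero_le_one hδ)
  have hcount : ({t ∈ S | 𝓝[S ∩ Set.Ioi t] t = ⊥} ∪ {t ∈ S | 𝓝[S ∩ Set.Iio t] t = ⊥} ∪
      ⋃ x ∈ Z, {t | cubic δ x t = 0}).Countable := by
    refine (countable_setOfPred_isolated_right_within.union
      countable_setOfPred_isolated_left_within).union (Set.Countable.biUnion ?_ ?_)
    · exact (countable_zeros (analyticAt_disc δ) (exists_disc_ne_zero hδ hc)).mono
        Set.inter_subset_left
    · intro x hx
      simp only [cubic_eq]
      refine (finite_cubic_roots ?_).countable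
      -- The constant coefficient is the excess at zero shift, nonzero off the sources, so the cubic
      -- is not the zero polynomial.
      have h1 := gram_strict hδ hx.2.1 hx.2.2
      have h2 : coefD δ x - 2 * kerC δ = 2 * kerC δ * ((1 + lk 0 δ) / 2 * evenU lk δ 0 x ^ 2 +
          (1 - lk 0 δ) / 2 * oddU lk δ 0 x ^ 2 - 1) := by
        rw [coefD]
        ring
      rw [h2]
      exact mul_ne_zero (mul_ne_zero two_ne_zero hc) (sub_ne_zero.2 h1.ne)
  refine Set.MapsTo.countable_of_injOn (f := kerT lk δ) ?_
    ((injOn_kerT hδ hc).mono fun r hr => hr.1) hcount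
  rintro r ⟨hr, hle, x, hx, hxδ, heq⟩
  have hq := kerK_sub_mul_pos hδ hr
  have hmem : kerT lk δ r ∈ S := by
    intro y
    have h1 := cubic_kerT (x := y) hδ hr
    have h2 : (kerK lk δ - kerL lk δ * r) * (kerC δ * cubic δ y (kerT lk δ r)) =
        2 * kerC δ ^ 2 * (kerK lk δ - kerL lk δ * lk 0 δ) * (power lk δ r y - 1) := by
      linear_combination kerC δ * h1
    have h3 : (kerK lk δ - kerL lk δ * r) * (kerC δ * cubic δ y (kerT lk δ r)) ≤ 0 := by
      rw [h2]
      exact mul_nonpos_of_nonneg_of_nonpos (by positivity) (sub_nonpos.2 (hle y))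
    exact nonpos_of_mul_nonpos_right h3 hq
  have hzero : cubic δ x (kerT lk δ r) = 0 := by
    have h1 := cubic_kerT (x := x) hδ hr
    rw [heq, sub_self, mul_zero] at h1
    exact (mul_eq_zero.1 h1).resolve_left hq.ne'
  by_cases hR : 𝓝[S ∩ Set.Ioi (kerT lk δ r)] (kerT lk δ r) = ⊥
  · exact Or.inl (Or.inl ⟨hmem, hR⟩)
  by_cases hL : 𝓝[S ∩ Set.Iio (kerT lk δ r)] (kerT lk δ r) = ⊥
  · exact Or.inl (Or.inr ⟨hmem, hL⟩)
  -- Admissible shifts accumulate from both sides and the excess is nonpositive at all of them, so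
  -- its derivative in the shift vanishes and the root is double.
  have hd := (hasDerivAt_cubic δ x (kerT lk δ r)).const_mul (kerC δ)
  have h0 : kerC δ * cubic δ x (kerT lk δ r) = 0 := by rw [hzero, mul_zero]
  have hle1 := deriv_nonpos_of_right hd h0 (S := S) (fun u hu => hu x) hR
  have hle2 := deriv_nonneg_of_left hd h0 (S := S) (fun u hu => hu x) hL
  have h4 := (mul_eq_zero.1 (le_antisymm hle1 hle2)).resolve_left hc
  refine Or.inr (Set.mem_biUnion (x := x) ⟨?_, hx, hxδ⟩ hzero)
  rw [cubic_eq] at hzero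
  exact cubicDisc_eq_zero hzero h4

/-- The shift is zero, so at a touching point `x` the power is affine in `r`, below one at `r = lk 0
δ` and equal to one at the touching `r`. Beyond that `r` the test fails, which makes it an extreme
admissible value. -/
lemma countable_touching_of_eq {δ : ℝ} (hδ : δ ≠ 0) (hc : kerC δ = 0) :
    (touching δ).Countable := by
  set S : Set ℝ := {r | |r| ≤ 1 ∧ ∀ x, power lk δ r x ≤ 1} with hS
  have hT : ∀ r, kerT lk δ r = 0 := fun r => by rw [kerT_eq, hc, zero_mul, zero_div]
  have hsub : touching δ ⊆ {r | IsGreatest S r} ∪ {r | IsLeast S r} := by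
    rintro r ⟨hr, hle, x, hx, hxδ, heq⟩
    have hg := gram_strict hδ hx hxδ
    have hp : ∀ r', power lk δ r' x = (1 + r') / 2 * evenU lk δ 0 x ^ 2 +
        (1 - r') / 2 * oddU lk δ 0 x ^ 2 := fun r' => by
      rw [power, hT, evenV, oddV, zero_mul, zero_mul, sub_zero, sub_zero]
    rw [hp] at heq
    set E := evenU lk δ 0 x ^ 2
    set O := oddU lk δ 0 x ^ 2
    have hslope : 0 < (r - lk 0 δ) * (E - O) := by nlinarith
    rcases pos_and_pos_or_neg_and_neg_of_mul_pos hslope with h | h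
    · refine Or.inl ⟨⟨hr, hle⟩, fun r' hr' => ?_⟩
      have h1 := hr'.2 x
      rw [hp] at h1
      by_contra! hlt
      nlinarith [mul_pos (sub_pos.2 hlt) h.2]
    · refine Or.inr ⟨⟨hr, hle⟩, fun r' hr' => ?_⟩
      have h1 := hr'.2 x
      rw [hp] at h1
      by_contra! hlt
      nlinarith [mul_pos (sub_pos.2 hlt) (neg_pos.2 h.2)]
  refine (Set.Countable.union ?_ ?_).mono hsub
  · exact Set.Subsingleton.countable fun a ha b hb => ha.unique hb
  · exact Set.Subsingleton.countable fun a ha b hb => ha.unique hb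

lemma countable_touching {δ : ℝ} (hδ : δ ≠ 0) : (touching δ).Countable := by
  by_cases hc : kerC δ = 0
  · exact countable_touching_of_eq hδ hc
  · exact countable_touching_of_ne hδ hc

lemma finite_power2_zero {δ : ℝ} (hδ : δ ≠ 0) :
    {r | |r| ≤ 1 ∧ power2 lk δ r 0 = 0}.Finite := by
  classical
  have hs := (one_sub_lk_zero_sq_pos hδ).ne'
  have h1 := one_add_ne_zero_of hs
  have h2 := one_sub_ne_zero_of hs
  set k := kerK lk δ with hk
  set l := kerL lk δ with hl
  set c := kerC δ with hc
  set s := lk 0 δ with hsdef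
  set X : Polynomial ℝ := Polynomial.X
  set n : Polynomial ℝ := Polynomial.C c * (Polynomial.C s - X) with hn
  set q : Polynomial ℝ := Polynomial.C k - Polynomial.C l * X with hq
  set p : Polynomial ℝ := (1 + X) * ((Polynomial.C (lk 1 δ / (1 + s)) * q +
      n * Polynomial.C (k - l)) ^ 2 + q * (Polynomial.C (evenU lk δ 2 0) * q -
      n * Polynomial.C (evenW lk δ 2 0))) +
    (1 - X) * ((Polynomial.C (-lk 1 δ / (1 - s)) * q +
      n * Polynomial.C (k + l)) ^ 2 + q * (Polynomial.C (oddU lk δ 2 0) * q -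
      n * Polynomial.C (oddW lk δ 2 0))) with hp
  have hp0 : p ≠ 0 := by
    intro h
    -- At `r = s` the shift is zero and the cleared second derivative reduces to `-2 k (k - l s)²`.
    have h3 := congrArg (Polynomial.eval s) h
    simp [hp, hn, hq, X] at h3
    have hks := kerK_sub_mul_pos hδ (abs_lk_zero_le_one hδ)
    have h4 : -2 * k * (k - l * s) ^ 2 = 0 := by
      rw [← h3, hk, kerK, evenU, oddU, zero_add, ← hsdef]
      field_simp
      ring
    exact mul_ne_zero (mul_ne_zero (by norm_num) (kerK_lk_pos hδ).ne')
      (pow_ne_zero 2 hks.ne') h4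
  refine p.roots.toFinset.finite_toSet.subset ?_
  rintro r ⟨hr, h0⟩
  have hqr := (kerK_sub_mul_pos hδ hr).ne'
  have ht : kerT lk δ r * (k - l * r) = c * (s - r) := by
    rw [kerT_eq, div_mul_cancel₀ _ hqr]
  have hroot : p.eval r = 0 := by
    rw [power2, isKernel_lk.evenV_zero_zero hs, isKernel_lk.oddV_zero_zero hs,
      isKernel_lk.evenV_one_zero hs, isKernel_lk.oddV_one_zero hs, evenV, oddV] at h0
    have h5 : p.eval r = (k - l * r) ^ 2 * ((1 + r) * ((lk 1 δ / (1 + s) +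
        kerT lk δ r * (k - l)) ^ 2 + 1 * (evenU lk δ 2 0 - kerT lk δ r * evenW lk δ 2 0)) +
        (1 - r) * ((-lk 1 δ / (1 - s) + kerT lk δ r * (k + l)) ^ 2 +
        1 * (oddU lk δ 2 0 - kerT lk δ r * oddW lk δ 2 0))) := by
      simp only [hp, hn, hq, X, Polynomial.eval_add, Polynomial.eval_sub, Polynomial.eval_mul,
        Polynomial.eval_pow, Polynomial.eval_C, Polynomial.eval_X, Polynomial.eval_one, ← ht]
      ring
    rw [h5, h0, mul_zero]
  simpa [hp0] using hroot

lemma power2_nonpos {δ r : ℝ} (hδ : δ ≠ 0) (hr : |r| ≤ 1) (h : ∀ x, power lk δ r x ≤ 1) :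
    power2 lk δ r 0 ≤ 0 := by
  have hs := (one_sub_lk_zero_sq_pos hδ).ne'
  by_contra! hpos
  have hcont : ContinuousAt (power2 lk δ r) 0 := by
    have hE : ∀ j, ContinuousAt (evenV lk δ (kerT lk δ r) j) 0 := fun j =>
      (isKernel_lk.hasDerivAt_evenV j 0).continuousAt
    have hO : ∀ j, ContinuousAt (oddV lk δ (kerT lk δ r) j) 0 := fun j =>
      (isKernel_lk.hasDerivAt_oddV j 0).continuousAt
    have := hE 0
    have := hE 1
    have := hE 2
    have := hO 0
    have := hO 1
    have := hO 2
    unfold power2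
    fun_prop
  obtain ⟨ε, hε, hball⟩ := Metric.eventually_nhds_iff.1 (hcont.eventually (lt_mem_nhds hpos))
  obtain ⟨ζ, hζ, heq⟩ := exists_second_order (fun x => isKernel_lk.hasDerivAt_power (δ := δ)
    (r := r) x) (fun x => isKernel_lk.hasDerivAt_power1 x)
    (isKernel_lk.power1_zero hs (kerK_sub_mul_pos hδ hr).ne') (half_pos hε).ne'
  have h1 : 0 < power2 lk δ r ζ := hball (by
    rw [Real.dist_eq, sub_zero]
    exact hζ.trans_lt (by rw [abs_of_pos (half_pos hε)]; linarith))
  rw [isKernel_lk.power_zero hs] at heq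
  have h2 : (power lk δ r (ε / 2) - 1) / (ε / 2) ^ 2 ≤ 0 :=
    div_nonpos_of_nonpos_of_nonneg (sub_nonpos.2 (h _)) (sq_nonneg _)
  linarith

/-- Outside a countable set of correlations, the limit test is strict whenever it holds. -/
lemma exists_countable_strict {δ : ℝ} (hδ : δ ≠ 0) : ∃ B : Set ℝ, B.Countable ∧ ∀ r, |r| ≤ 1 →
    r ∉ B → (∀ x, power lk δ r x ≤ 1) →
      (∀ x, x ≠ 0 → x ≠ -δ → power lk δ r x < 1) ∧ power2 lk δ r 0 < 0 := by
  refine ⟨_, (countable_touching hδ).union (finite_power2_zero hδ).countable,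
    fun r hr hB hle => ⟨fun x hx hxδ => ?_, ?_⟩⟩
  · exact lt_of_le_of_ne (hle x) fun h => hB (Or.inl ⟨hr, hle, x, hx, hxδ, h⟩)
  · exact lt_of_le_of_ne (power2_nonpos hδ hr hle) fun h => hB (Or.inr ⟨hr, h⟩)

/-! ### Almost all correlations -/

/-- The effective real correlation of two sources with relative phase `a`. -/
def effCorr (ρ : ℂ) (a : ℝ) : ℝ := (conj (exp (I * (a : ℂ))) * ρ).re

lemma norm_exp_I_mul_ofReal (a : ℝ) : ‖exp (I * (a : ℂ))‖ = 1 := by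
  rw [mul_comm, Complex.norm_exp_ofReal_mul_I]

lemma abs_effCorr_le {ρ : ℂ} (hρ : ‖ρ‖ ≤ 1) (a : ℝ) : |effCorr ρ a| ≤ 1 := by
  refine (Complex.abs_re_le_norm _).trans ?_
  rw [norm_mul, RCLike.norm_conj, norm_exp_I_mul_ofReal, one_mul]
  exact hρ

lemma continuous_effCorr (ρ : ℂ) : Continuous (effCorr ρ) := by
  unfold effCorr
  fun_prop

lemma effCorr_exp (ψ a : ℝ) : effCorr (exp (ψ * I)) a = Real.cos (ψ - a) := by
  rw [effCorr, ← Complex.exp_conj, ← Complex.exp_add, map_mul, Complex.conj_I, Complex.conj_ofReal,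
    show -I * (a : ℂ) + ψ * I = ((ψ - a : ℝ) : ℂ) * I by push_cast; ring,
    Complex.exp_ofReal_mul_I_re]

lemma countable_cos_sub_mem {B : Set ℝ} (hB : B.Countable) (a : ℝ) :
    {ψ : ℝ | Real.cos (ψ - a) ∈ B}.Countable := by
  have h : {ψ : ℝ | Real.cos (ψ - a) ∈ B} = ⋃ b ∈ B, {ψ : ℝ | Real.cos (ψ - a) - b = 0} := by
    ext ψ
    simp [sub_eq_zero]
  rw [h]
  refine hB.biUnion fun b _ => countable_zeros (fun ψ => ?_) ?_
  · exact (AnalyticAt.fun_comp (g := Real.cos) (f := fun ψ => ψ - a) Real.analyticAt_cos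
      (analyticAt_id.fun_sub analyticAt_const)).fun_sub analyticAt_const
  · by_contra! hcon
    have h1 := hcon a
    have h2 := hcon (a + Real.pi)
    rw [sub_self, Real.cos_zero] at h1
    rw [add_sub_cancel_left, Real.cos_pi] at h2
    linarith

/-- Each level set of the effective correlation is an affine line in `ℂ`, and only countably many
levels occur. -/
lemma volume_effCorr_mem {B : Set ℝ} (hB : B.Countable) (a : ℝ) :
    MeasureTheory.volume {ρ : ℂ | effCorr ρ a ∈ B} = 0 := by
  have h : {ρ : ℂ | effCorr ρ a ∈ B} = ⋃ b ∈ B, {ρ : ℂ | effCorr ρ a = b} := by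
    ext ρ
    simp
  rw [h, MeasureTheory.measure_biUnion_null_iff hB]
  intro b _
  set w := exp (I * (a : ℂ)) with hw
  set f : ℂ →ₗ[ℝ] ℝ := Complex.reLm ∘ₗ LinearMap.mulLeft ℝ (conj w) with hf
  have hfw : f w = 1 := by
    have : conj w * w = 1 := by
      rw [Complex.conj_mul', hw, norm_exp_I_mul_ofReal]
      simp
    simp [hf, this]
  set A := AffineSubspace.mk' ((b : ℂ) * w) (LinearMap.ker f) with hA
  have hfb : f ((b : ℂ) * w) = b := by
    rw [← Complex.real_smul, map_smul, hfw, smul_eq_mul, mul_one]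
  have hmem : ∀ ρ, ρ ∈ A ↔ f ρ = b := fun ρ => by
    rw [hA, AffineSubspace.mem_mk', LinearMap.mem_ker, vsub_eq_sub, map_sub, hfb, sub_eq_zero]
  have hset : {ρ : ℂ | effCorr ρ a = b} = A := by
    ext ρ
    exact (hmem ρ).symm
  rw [hset]
  refine MeasureTheory.Measure.addHaar_affineSubspace _ _ fun htop => ?_
  have h1 := (hmem 0).1 (htop ▸ AffineSubspace.mem_top ℝ ℂ 0)
  have h2 := (hmem w).1 (htop ▸ AffineSubspace.mem_top ℝ ℂ w)
  rw [map_zero] at h1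
  linarith

lemma almostAll_of_countable (T : ℕ) {P : Matrix (Fin 2) (Fin 2) ℂ → Prop} {B : Set ℝ}
    (hB : B.Countable) (a : ℝ) (h : ∀ ρ : ℂ, ‖ρ‖ ≤ 1 → effCorr ρ a ∉ B → P (corr ρ)) :
    AlmostAll T P := by
  unfold AlmostAll
  split_ifs
  · filter_upwards [(countable_cos_sub_mem hB a).ae_notMem MeasureTheory.volume] with ψ hψ
    refine h _ (Complex.norm_exp_ofReal_mul_I ψ).le fun hmem => hψ ?_
    rwa [effCorr_exp] at hmem
  · rw [MeasureTheory.ae_restrict_iff' measurableSet_closedBall]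
    filter_upwards [MeasureTheory.measure_eq_zero_iff_ae_notMem.1 (volume_effCorr_mem hB a)]
      with ρ hρ hball
    exact h ρ (by simpa using hball) hρ

lemma AlmostAll.mono {T : ℕ} {P Q : Matrix (Fin 2) (Fin 2) ℂ → Prop}
    (h : AlmostAll T fun Ξ => P Ξ → Q Ξ) (hP : AlmostAll T P) : AlmostAll T Q := by
  unfold AlmostAll at *
  split_ifs at *
  · filter_upwards [h, hP] with ψ h1 h2 using h1 h2
  · filter_upwards [h, hP] with ψ h1 h2 using h1 h2

/-- Sets of full measure are dense, so they meet the open arc `0 < ψ < π`, respectively the open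
disk, where `|Re ρ| < 1`. -/
lemma AlmostAll.exists_incoherent {T : ℕ} {P : Matrix (Fin 2) (Fin 2) ℂ → Prop}
    (h : AlmostAll T P) : ∃ ρ : ℂ, ‖ρ‖ ≤ 1 ∧ |ρ.re| < 1 ∧ P (corr ρ) := by
  unfold AlmostAll at h
  split_ifs at h
  · obtain ⟨ψ, hψ, hP⟩ := (MeasureTheory.Measure.dense_of_ae h).exists_mem_open
      (isOpen_Ioo (a := (0 : ℝ)) (b := Real.pi)) ⟨Real.pi / 2, by
        constructor <;> linarith [Real.pi_pos]⟩
    refine ⟨_, (Complex.norm_exp_ofReal_mul_I ψ).le, ?_, hψ⟩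
    rw [Complex.exp_ofReal_mul_I_re, ← sq_lt_one_iff_abs_lt_one]
    have h1 := Real.sin_pos_of_pos_of_lt_pi hP.1 hP.2
    nlinarith [Real.sin_sq_add_cos_sq ψ]
  · rw [MeasureTheory.ae_restrict_iff' measurableSet_closedBall] at h
    obtain ⟨ρ, hρ, hball⟩ := (MeasureTheory.Measure.dense_of_ae h).exists_mem_open
      (Metric.isOpen_ball (x := (0 : ℂ)) (ε := 1)) ⟨0, by simp⟩
    have hn : ‖ρ‖ < 1 := by simpa using hball
    exact ⟨ρ, hn.le, (Complex.abs_re_le_norm ρ).trans_lt hn, hρ (Metric.ball_subset_closedBall hball)⟩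

/-! ### Consistency of a sequence of pairs -/

/-- The relative phase of two sources at the array centre. -/
def arrayPhase (Δφ : ℕ → ℝ) (m : ℕ) : ℝ := (m - 1) / (2 * m) * (m * Δφ m)

lemma tendsto_arrayPhase {Δφ : ℕ → ℝ} {δ : ℝ}
    (hδ : Tendsto (fun m : ℕ => (m : ℝ) * Δφ m) atTop (𝓝 δ)) :
    Tendsto (arrayPhase Δφ) atTop (𝓝 (1 / 2 * δ)) := by
  have h1 : Tendsto (fun m : ℕ => 1 / 2 - 1 / 2 * (m : ℝ)⁻¹) atTop (𝓝 (1 / 2)) := by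
    have := ((tendsto_inv_atTop_nhds_zero_nat (𝕜 := ℝ)).const_mul (1 / 2)).const_sub (1 / 2)
    rwa [mul_zero, sub_zero] at this
  refine (h1.mul hδ).congr' ?_
  filter_upwards [eventually_ne_atTop 0] with m hm
  have : (m : ℝ) ≠ 0 := by exact_mod_cast hm
  rw [arrayPhase]
  field_simp

lemma eventuallyConsistentOver_of_power {Δφ : ℕ → ℝ} {ρ : ℂ} (hρ : ‖ρ‖ ≤ 1)
    (hs : ∀ᶠ m : ℕ in atTop, 1 - dk m 0 (m * Δφ m) ^ 2 ≠ 0)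
    (h1 : ∀ᶠ m : ℕ in atTop,
      kerK (dk m) (m * Δφ m) - kerL (dk m) (m * Δφ m) * effCorr ρ (arrayPhase Δφ m) ≠ 0)
    (h2 : ∀ᶠ m : ℕ in atTop,
      kerK (dk m) (m * Δφ m) + kerL (dk m) (m * Δφ m) * effCorr ρ (arrayPhase Δφ m) ≠ 0)
    (hp : ∀ᶠ m : ℕ in atTop, ∀ x, |x| ≤ Real.pi * m →
      power (dk m) (m * Δφ m) (effCorr ρ (arrayPhase Δφ m)) x ≤ 1) :
    EventuallyConsistentOver (fun m => ![0, Δφ m]) (corr ρ) := by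
  obtain ⟨M, hM⟩ := eventually_atTop.1 (hs.and (h1.and (h2.and (hp.and (eventually_ne_atTop 0)))))
  refine ⟨M, fun m hm y hy => ?_⟩
  obtain ⟨hs, h1, h2, hp, h0⟩ := hM m hm.le
  refine (ula_test_iff h0 hρ hs rfl h1 h2).2 (hp _ ?_)
  rw [abs_neg, abs_mul, abs_of_nonneg (Nat.cast_nonneg m), mul_comm]
  exact mul_le_mul_of_nonneg_right (abs_le.2 hy) (Nat.cast_nonneg m)

lemma eventually_regular {δ r : ℕ → ℝ} {δ₀ r₀ : ℝ} (hδ₀ : δ₀ ≠ 0)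
    (hδ : Tendsto δ atTop (𝓝 δ₀)) (hr : Tendsto r atTop (𝓝 r₀)) (hr₀ : |r₀| ≤ 1) :
    (∀ᶠ m in atTop, 1 - dk m 0 (δ m) ^ 2 ≠ 0) ∧
      (∀ᶠ m in atTop, kerK (dk m) (δ m) - kerL (dk m) (δ m) * r m ≠ 0) ∧
      (∀ᶠ m in atTop, kerK (dk m) (δ m) + kerL (dk m) (δ m) * r m ≠ 0) := by
  have hs := (one_sub_lk_zero_sq_pos hδ₀).ne'
  have t : ∀ j, Tendsto (fun m => dk m j (δ m)) atTop (𝓝 (lk j δ₀)) := tendsto_dk tendsto_id hδ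
  have t0 : Tendsto (fun m => dk m 2 0) atTop (𝓝 (lk 2 0)) :=
    tendsto_dk tendsto_id tendsto_const_nhds 2
  have tK : Tendsto (fun m => kerK (dk m) (δ m)) atTop (𝓝 (kerK lk δ₀)) :=
    tendsto_kerK t0 (t 0) (t 1) hs
  have tL : Tendsto (fun m => kerL (dk m) (δ m)) atTop (𝓝 (kerL lk δ₀)) :=
    tendsto_kerL (t 2) (t 0) (t 1) hs
  exact ⟨(((t 0).pow 2).const_sub 1).eventually_ne hs,
    (tK.sub (tL.mul hr)).eventually_ne (kerK_sub_mul_pos hδ₀ hr₀).ne',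
    (tK.add (tL.mul hr)).eventually_ne (kerK_add_mul_pos hδ₀ hr₀).ne'⟩

/-- Sources whose scaled separation converges to a nonzero limit. -/
lemma almostAll_limitTest_imp (T : ℕ) {Δφ : ℕ → ℝ} {δ : ℝ} (hδ₀ : δ ≠ 0)
    (hδ : Tendsto (fun m : ℕ => (m : ℝ) * Δφ m) atTop (𝓝 δ)) :
    AlmostAll T fun Ξ => LimitTest δ Ξ → EventuallyConsistentOver (fun m => ![0, Δφ m]) Ξ := by
  obtain ⟨B, hB, hstrict⟩ := exists_countable_strict hδ₀
  -- The exceptional set is taken at the limiting phase `δ/2` only; the array phases converge to it,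
  -- so one null set serves all `m`.
  refine almostAll_of_countable T hB (1 / 2 * δ) fun ρ hρ hnot hlim => ?_
  have hr₀ := abs_effCorr_le hρ (1 / 2 * δ)
  have hr : Tendsto (fun m => effCorr ρ (arrayPhase Δφ m)) atTop (𝓝 (effCorr ρ (1 / 2 * δ))) :=
    ((continuous_effCorr ρ).tendsto _).comp (tendsto_arrayPhase hδ)
  have hk := (kerK_sub_mul_pos hδ₀ hr₀).ne'
  obtain ⟨hlt, h2⟩ := hstrict _ hr₀ hnot
    ((limit_test_iff hρ hδ₀ rfl hk (kerK_add_mul_pos hδ₀ hr₀).ne').1 hlim)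
  obtain ⟨e0, e1, e2⟩ := eventually_regular hδ₀ hδ hr hr₀
  exact eventuallyConsistentOver_of_power hρ e0 e1 e2
    (eventually_of_limit hδ₀ hδ hr (fun m => abs_effCorr_le hρ _) hk hlt h2)

/-- Sources whose scaled separation diverges. -/
lemma almostAsymptoticallyConsistent_of_separated (T : ℕ) {Δφ : ℕ → ℝ}
    (hrange : ∀ m, Δφ m ∈ electricalAngles)
    (hδ : Tendsto (fun m : ℕ => (m : ℝ) * Δφ m) atTop atTop) :
    AlmostAsymptoticallyConsistent T fun m => ![0, Δφ m] := by
  refine almostAll_of_countable T Set.countable_empty 0 fun ρ hρ _ => ?_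
  have hr : ∀ m, |effCorr ρ (arrayPhase Δφ m)| ≤ 1 := fun m => abs_effCorr_le hρ _
  have hle : ∀ m : ℕ, |(m : ℝ) * Δφ m| ≤ Real.pi * m := fun m => by
    rw [abs_mul, abs_of_nonneg (Nat.cast_nonneg m), mul_comm]
    exact mul_le_mul_of_nonneg_right (abs_le.2 (hrange m)) (Nat.cast_nonneg m)
  have hd := tendsto_pdist_of_separated hδ hle
  obtain ⟨t1, t2, -⟩ := separated_params hd hr
  have t0 : Tendsto (fun m : ℕ => dk m 0 (m * Δφ m)) atTop (𝓝 0) :=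
    tendsto_dk_zero (eventually_gt_atTop 0) hd 0
  refine eventuallyConsistentOver_of_power hρ ?_ (t1.eventually_ne (by norm_num))
    (t2.eventually_ne (by norm_num)) (eventually_separated hδ hle hr)
  exact ((t0.pow 2).const_sub 1).eventually_ne (by norm_num)

/-- Sources whose scaled separation vanishes. -/
lemma not_almostAsymptoticallyConsistent_of_coalescing (T : ℕ) {Δφ : ℕ → ℝ}
    (hne : ∀ m, Δφ m ≠ 0) (hδ : Tendsto (fun m : ℕ => (m : ℝ) * Δφ m) atTop (𝓝 0)) :
    ¬ AlmostAsymptoticallyConsistent T fun m => ![0, Δφ m] := by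
  intro h
  obtain ⟨ρ, hρ, hre, M, hM⟩ := AlmostAll.exists_incoherent h
  have hr : Tendsto (fun m => effCorr ρ (arrayPhase Δφ m)) atTop (𝓝 ρ.re) := by
    have h0 : effCorr ρ (1 / 2 * 0) = ρ.re := by simp [effCorr]
    rw [← h0]
    exact ((continuous_effCorr ρ).tendsto _).comp (tendsto_arrayPhase hδ)
  obtain ⟨x, hx⟩ := eventually_coalescing hδ
    ((eventually_ne_atTop 0).mono fun m hm => mul_ne_zero (Nat.cast_ne_zero.2 hm) (hne m)) hr hre
  -- The fixed scaled point `x` corresponds to the electrical angle `-x / m`, which must lie in the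
  -- admissible range.
  have hlarge : ∀ᶠ m : ℕ in atTop, |x| ≤ Real.pi * m :=
    (tendsto_natCast_atTop_atTop.const_mul_atTop Real.pi_pos).eventually_ge_atTop _
  obtain ⟨m, ⟨hs, h1, h2, hgt⟩, hxm, hmM, hm0⟩ :=
    (hx.and (hlarge.and ((eventually_gt_atTop M).and (eventually_ne_atTop 0)))).exists
  have hm : (0 : ℝ) < m := Nat.cast_pos.2 (Nat.pos_of_ne_zero hm0)
  have hy : -x / m ∈ electricalAngles := by
    refine abs_le.1 ?_
    rw [abs_div, abs_neg, abs_of_pos hm, div_le_iff₀ hm]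
    exact hxm
  have h3 := (ula_test_iff hm0 hρ hs rfl h1 h2).1 (hM m hmM _ hy)
  rw [mul_div_cancel₀ _ hm.ne', neg_neg] at h3
  exact absurd h3 (not_le.2 hgt)

end CLASS

end

theorem proposition3 (T : ℕ) (hT : 1 ≤ T) (Δφ : ℕ → ℝ)
    (hrange : ∀ m, Δφ m ∈ CLASS.electricalAngles) (hne : ∀ m, Δφ m ≠ 0) :
    (∀ δ : ℝ, δ ≠ 0 →
      Filter.Tendsto (fun m : ℕ => (m : ℝ) * Δφ m) Filter.atTop (nhds δ) →
        CLASS.AlmostAll T (fun Ξ => CLASS.LimitTest δ Ξ →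
          CLASS.EventuallyConsistentOver (fun m => ![0, Δφ m]) Ξ) ∧
        (CLASS.AlmostAll T (CLASS.LimitTest δ) →
          CLASS.AlmostAsymptoticallyConsistent T (fun m => ![0, Δφ m]))) ∧
    (Filter.Tendsto (fun m : ℕ => (m : ℝ) * Δφ m) Filter.atTop Filter.atTop →
      CLASS.AlmostAsymptoticallyConsistent T (fun m => ![0, Δφ m])) ∧
    (Filter.Tendsto (fun m : ℕ => (m : ℝ) * Δφ m) Filter.atTop (nhds 0) →
      ¬ CLASS.AlmostAsymptoticallyConsistent T (fun m => ![0, Δφ m])) :=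
  ⟨fun _ hδ₀ hδ => ⟨CLASS.almostAll_limitTest_imp T hδ₀ hδ,
      CLASS.AlmostAll.mono (CLASS.almostAll_limitTest_imp T hδ₀ hδ)⟩,
    CLASS.almostAsymptoticallyConsistent_of_separated T hrange,
    CLASS.not_almostAsymptoticallyConsistent_of_coalescing T hne⟩
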